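/- Let $\pi:\mathbb{CP}^3\to\mathbb{HP}^1\cong S^4$, $\pi[z_0,z_1,z_2,z_3]=[z_0+z_1j,\,z_2+z_3j]$, be the twistor fibration, where $\mathbb{HP}^1$ is the left quaternionic projective line and $S^4\subset\mathbb{R}^5=\mathbb{H}\times\mathbb{R}$ is identified with it by $[p_0,p_1]\mapsto\bigl(2\bar p_0p_1,\ |p_0|^2-|p_1|^2\bigr)/(|p_0|^2+|p_1|^2)$. The twistor lines are the projective lines $\sigma(q)=\pi^{-1}(q)$, $q\in S^4$; we identify $S^4$ with the set $\sigma(S^4)$ of twistor lines inside the Grassmannian $G(2,4)$ of lines of $\mathbb{CP}^3$. "Zariski" topologies on $S^4$ are real: the Zariski closed sets are the common zero sets in $S^4$ of real polynomials on $\mathbb{R}^5$. For a surface $X=\{F=0\}\subset\mathbb{CP}^3$ of degree $d$ and a line $L\not\subset X$, let $\alpha(L\cap X)$ be the partition of $d$ formed by the multiplicities of the scheme $L\cap X$ at its points. Let $d\ge 4$ and let $X=\{F=0\}$ be a general surface of degree $d$. Here "general" means: $F$ lies off the zero set of a suitable nonzero real polynomial (depending only on $d$) in the real and imaginary parts of the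 coefficients of a form of degree $d$. Then: 1. $X$ contains no twistor line. 2. For every twistor line $L$, the partition $\alpha(L\cap X)$ is one of $(1,\dots,1)$, $(2,1,\dots,1)$, $(2,2,1,\dots,1)$, $(3,1,\dots,1)$. 3. The set of $q\in S^4$ with $\alpha(\sigma(q)\cap X)=(1,\dots,1)$ is a nonempty Zariski open subset of $S^4$. 4. The set of $q\in S^4$ with $\alpha(\sigma(q)\cap X)=(2,1,\dots,1)$ is a nonempty Zariski locally closed subset of $S^4$ of pure real dimension $2$; more precisely it is an embedded smooth submanifold of dimension $2$. 5. There are only finitely many twistor lines $L$ with $\alpha(L\cap X)=(2,2,1,\dots,1)$, and only finitely many with $\alpha(L\cap X)=(3,1,\dots,1)$. -/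

import Mathlib

open scoped Quaternion ContDiff

namespace Twistor

noncomputable section

/-! ### The twistor fibration -/

/-- The complex projective space `ℂℙ³`. -/
abbrev CP3 : Type := Projectivization ℂ (Fin 4 → ℂ)

/-- The left quaternionic projective line `ℍℙ¹`: nonzero pairs of quaternions modulo
left multiplication by nonzero quaternions. -/
abbrev HP1 : Type := Projectivization ℍ[ℝ] (Fin 2 → ℍ[ℝ])

/-- The unit sphere `S⁴` of `ℝ⁵`. -/
abbrev S4 : Type := Metric.sphere (0 : EuclideanSpace ℝ (Fin 5)) 1

/-- The quaternion `z + w j`, where `z, w` are complex numbers (and `i j = k`). -/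
def quat (z w : ℂ) : ℍ[ℝ] := ⟨z.re, z.im, w.re, w.im⟩

/-- The identification `(z₀, z₁, z₂, z₃) ↦ (z₀ + z₁ j, z₂ + z₃ j)` of `ℂ⁴` with `ℍ²`. -/
def toQuat (z : Fin 4 → ℂ) : Fin 2 → ℍ[ℝ] := ![quat (z 0) (z 1), quat (z 2) (z 3)]

theorem quat_add (a b c d : ℂ) : quat (a + b) (c + d) = quat a c + quat b d := by
  ext
  · exact Complex.add_re a b
  · exact Complex.add_im a b
  · exact Complex.add_re c d
  · exact Complex.add_im c d

theorem quat_mul (c a b : ℂ) : quat (c * a) (c * b) = quat c 0 * quat a b := by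
  ext
  · rw [Quaternion.re_mul]; simp [quat]
  · rw [Quaternion.imI_mul]; simp [quat]
  · rw [Quaternion.imJ_mul]; simp [quat]
  · rw [Quaternion.imK_mul]; simp [quat]

theorem quat_inj {a b c d : ℂ} (h : quat a b = quat c d) : a = c ∧ b = d :=
  ⟨Complex.ext (congrArg (fun q : ℍ[ℝ] => q.re) h) (congrArg (fun q : ℍ[ℝ] => q.imI) h),
    Complex.ext (congrArg (fun q : ℍ[ℝ] => q.imJ) h) (congrArg (fun q : ℍ[ℝ] => q.imK) h)⟩

theorem toQuat_add (v w : Fin 4 → ℂ) : toQuat (v + w) = toQuat v + toQuat w := by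
  funext i; fin_cases i <;> exact quat_add _ _ _ _

theorem toQuat_zero : toQuat 0 = 0 := by
  have h := toQuat_add 0 0
  rwa [add_zero, left_eq_add] at h

theorem toQuat_smul (c : ℂ) (v : Fin 4 → ℂ) : toQuat (c • v) = quat c 0 • toQuat v := by
  funext i; fin_cases i <;> exact quat_mul _ _ _

theorem toQuat_injective : Function.Injective toQuat := by
  intro v w h
  obtain ⟨h0, h1⟩ := quat_inj (congrFun h 0)
  obtain ⟨h2, h3⟩ := quat_inj (congrFun h 1)
  funext i
  fin_cases i <;> assumption

theorem toQuat_ne_zero {v : Fin 4 → ℂ} (hv : v ≠ 0) : toQuat v ≠ 0 := fun h =>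
  hv (toQuat_injective (h.trans toQuat_zero.symm))

/-- The twistor fibration `[z₀, z₁, z₂, z₃] ↦ [z₀ + z₁ j, z₂ + z₃ j]` with values in `ℍℙ¹`. -/
def projHP1 : CP3 → HP1 :=
  Projectivization.lift (fun v => Projectivization.mk ℍ[ℝ] (toQuat v.1) (toQuat_ne_zero v.2)) <| by
    rintro ⟨a, ha⟩ ⟨b, hb⟩ t h
    refine (Projectivization.mk_eq_mk_iff' _ _ _ _ _).2 ⟨quat t 0, ?_⟩
    have h' : a = t • b := h
    change quat t 0 • toQuat b = toQuat a
    rw [h', toQuat_smul]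

/-- The point `(2 p̄₀ p₁, |p₀|² - |p₁|²) / (|p₀|² + |p₁|²)` of `ℍ × ℝ = ℝ⁵`. For `p₀ = 1` this is
inverse stereographic projection from the point `(0, -1)`. -/
def sphereVec (p : Fin 2 → ℍ[ℝ]) : EuclideanSpace ℝ (Fin 5) :=
  (Quaternion.normSq (p 0) + Quaternion.normSq (p 1))⁻¹ •
    !₂[2 * (star (p 0) * p 1).re, 2 * (star (p 0) * p 1).imI, 2 * (star (p 0) * p 1).imJ,
      2 * (star (p 0) * p 1).imK, Quaternion.normSq (p 0) - Quaternion.normSq (p 1)]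

theorem normSq_add_pos {p : Fin 2 → ℍ[ℝ]} (hp : p ≠ 0) :
    0 < Quaternion.normSq (p 0) + Quaternion.normSq (p 1) := by
  have h0 := Quaternion.normSq_nonneg (a := p 0)
  have h1 := Quaternion.normSq_nonneg (a := p 1)
  refine lt_of_le_of_ne (by positivity) fun h => hp ?_
  have e0 : Quaternion.normSq (p 0) = 0 := by linarith
  have e1 : Quaternion.normSq (p 1) = 0 := by linarith
  funext i
  fin_cases i
  · exact Quaternion.normSq_eq_zero.1 e0
  · exact Quaternion.normSq_eq_zero.1 e1

theorem sphereVec_mem {p : Fin 2 → ℍ[ℝ]} (hp : p ≠ 0) :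
    sphereVec p ∈ Metric.sphere (0 : EuclideanSpace ℝ (Fin 5)) 1 := by
  have hn := (normSq_add_pos hp).ne'
  rw [mem_sphere_zero_iff_norm, ← sq_eq_sq₀ (norm_nonneg _) zero_le_one,
    EuclideanSpace.real_norm_sq_eq]
  have hc : Quaternion.normSq (star (p 0) * p 1) =
      Quaternion.normSq (p 0) * Quaternion.normSq (p 1) := by
    rw [map_mul, Quaternion.normSq_star]
  rw [Quaternion.normSq_def'] at hc
  generalize hq : star (p 0) * p 1 = c at hc
  simp only [sphereVec, hq, Fin.sum_univ_five, PiLp.smul_apply, smul_eq_mul]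
  simp
  field_simp
  linear_combination 4 * hc

theorem sphereVec_smul {c : ℍ[ℝ]} (hc : c ≠ 0) (p : Fin 2 → ℍ[ℝ]) :
    sphereVec (c • p) = sphereVec p := by
  have hn : Quaternion.normSq c ≠ 0 := fun h => hc (Quaternion.normSq_eq_zero.1 h)
  have e : star ((c • p) 0) * (c • p) 1 = Quaternion.normSq c • (star (p 0) * p 1) := by
    simp only [Pi.smul_apply, smul_eq_mul, star_mul]
    rw [mul_assoc, ← mul_assoc (star c), Quaternion.star_mul_self, Quaternion.coe_mul_eq_smul,
      mul_smul_comm]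
  simp only [sphereVec, e]
  ext i
  fin_cases i <;>
    simp only [PiLp.smul_apply, Pi.smul_apply, smul_eq_mul, map_mul, Quaternion.re_smul,
      Quaternion.imI_smul, Quaternion.imJ_smul, Quaternion.imK_smul, Fin.zero_eta, Fin.mk_one,
      Fin.reduceFinMk] <;> simp <;> field_simp

/-- The map `ℍℙ¹ → S⁴`, `[p₀, p₁] ↦ (2 p̄₀ p₁, |p₀|² - |p₁|²) / (|p₀|² + |p₁|²)`. -/
def toSphere : HP1 → S4 :=
  Projectivization.lift (fun p : {v : Fin 2 → ℍ[ℝ] // v ≠ 0} => (⟨sphereVec p.1, sphereVec_mem p.2⟩ : S4)) <| by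
    rintro ⟨a, ha⟩ ⟨b, hb⟩ t h
    have h' : a = t • b := h
    have ht : t ≠ 0 := by
      rintro rfl
      exact ha (by rw [h', zero_smul])
    apply Subtype.ext
    change sphereVec a = sphereVec b
    rw [h', sphereVec_smul ht]

theorem toSphere_injective : Function.Injective toSphere := by
  intro x y
  induction x using Projectivization.ind with | h a ha
  induction y using Projectivization.ind with | h b hb
  intro h
  have h' : sphereVec a = sphereVec b := congrArg Subtype.val h
  have ha' := (normSq_add_pos ha).ne'
  have hb' := (normSq_add_pos hb).ne'
  have e (i : Fin 5) : sphereVec a i = sphereVec b i := by rw [h']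
  have e0 := e 0
  have e1 := e 1
  have e2 := e 2
  have e3 := e 3
  have e4 := e 4
  clear e
  rw [Projectivization.mk_eq_mk_iff']
  generalize hqa : star (a 0) * a 1 = ca at *
  generalize hqb : star (b 0) * b 1 = cb at *
  simp only [sphereVec, hqa, hqb, PiLp.smul_apply, smul_eq_mul] at e0 e1 e2 e3 e4
  simp at e0 e1 e2 e3 e4
  have inv (x : ℍ[ℝ]) : x⁻¹ = (Quaternion.normSq x)⁻¹ • star x := rfl
  have hnz (x : ℍ[ℝ]) : Quaternion.normSq x = 0 ↔ x = 0 := Quaternion.normSq_eq_zero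
  generalize hna : Quaternion.normSq (a 0) = na at *
  generalize hnb : Quaternion.normSq (b 0) = nb at *
  generalize Quaternion.normSq (a 1) = ma at *
  generalize Quaternion.normSq (b 1) = mb at *
  field_simp at e0 e1 e2 e3 e4
  have k : (nb + mb) * na = (na + ma) * nb := by linarith
  have kc : (nb + mb) • ca = (na + ma) • cb := by
    ext <;> simp <;> linarith
  by_cases ha0 : a 0 = 0
  · have hna0 : na = 0 := by rw [← hna, ha0, map_zero]
    have hb0 : b 0 = 0 := by
      rw [← hnz, hnb]
      have : (na + ma) * nb = 0 := by rw [← k, hna0, mul_zero]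
      exact (mul_eq_zero.1 this).resolve_left ha'
    have hb1 : b 1 ≠ 0 := fun h1 => hb (by funext i; fin_cases i <;> assumption)
    refine ⟨a 1 * (b 1)⁻¹, ?_⟩
    funext i
    fin_cases i
    · simp [ha0, hb0]
    · simp [mul_assoc, inv_mul_cancel₀ hb1]
  · have hna0 : na ≠ 0 := fun h0 => ha0 ((hnz _).1 (hna.trans h0))
    have hnb0 : nb ≠ 0 := fun h0 => mul_ne_zero hb' hna0 (by rw [k, h0, mul_zero])
    have hb0 : b 0 ≠ 0 := fun h0 => hnb0 (by rw [← hnb, h0, map_zero])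
    refine ⟨a 0 * (b 0)⁻¹, ?_⟩
    have key : (b 0)⁻¹ * b 1 = (a 0)⁻¹ * a 1 := by
      rw [inv, inv, hna, hnb, smul_mul_assoc, smul_mul_assoc, hqa, hqb]
      have : cb = ((na + ma)⁻¹ * (nb + mb)) • ca := by
        rw [mul_smul, kc, smul_smul, inv_mul_cancel₀ ha', one_smul]
      rw [this, smul_smul]
      congr 1
      field_simp
      linarith
    funext i
    fin_cases i
    · simp [mul_assoc, inv_mul_cancel₀ hb0]
    · simp [mul_assoc, key, mul_inv_cancel_left₀ ha0]

theorem toSphere_surjective : Function.Surjective toSphere := by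
  rintro ⟨x, hx⟩
  have hx2 := hx
  rw [mem_sphere_zero_iff_norm, ← sq_eq_sq₀ (norm_nonneg _) zero_le_one,
    EuclideanSpace.real_norm_sq_eq, Fin.sum_univ_five] at hx2
  suffices h : ∃ p : Fin 2 → ℍ[ℝ], p ≠ 0 ∧ sphereVec p = x by
    obtain ⟨p, hp, h⟩ := h
    exact ⟨Projectivization.mk _ p hp, Subtype.ext h⟩
  by_cases h4 : x 4 = -1
  · refine ⟨![0, 1], fun h => one_ne_zero (congrFun h 1), ?_⟩
    rw [h4] at hx2
    have z0 : x 0 = 0 := by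
      nlinarith [sq_nonneg (x 0), sq_nonneg (x 1), sq_nonneg (x 2), sq_nonneg (x 3)]
    have z1 : x 1 = 0 := by
      nlinarith [sq_nonneg (x 0), sq_nonneg (x 1), sq_nonneg (x 2), sq_nonneg (x 3)]
    have z2 : x 2 = 0 := by
      nlinarith [sq_nonneg (x 0), sq_nonneg (x 1), sq_nonneg (x 2), sq_nonneg (x 3)]
    have z3 : x 3 = 0 := by
      nlinarith [sq_nonneg (x 0), sq_nonneg (x 1), sq_nonneg (x 2), sq_nonneg (x 3)]
    ext i
    fin_cases i <;> simp [sphereVec, z0, z1, z2, z3, h4]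
  · have h5 : 1 + x 4 ≠ 0 := fun h => h4 (by linarith)
    obtain ⟨r, r0, r1, r2, r3⟩ : ∃ r : ℍ[ℝ], r.re = x 0 / (1 + x 4) ∧ r.imI = x 1 / (1 + x 4) ∧
        r.imJ = x 2 / (1 + x 4) ∧ r.imK = x 3 / (1 + x 4) := ⟨⟨_, _, _, _⟩, rfl, rfl, rfl, rfl⟩
    refine ⟨![1, r], fun h => one_ne_zero (congrFun h 0), ?_⟩
    have hm : Quaternion.normSq r = (1 - x 4) / (1 + x 4) := by
      rw [Quaternion.normSq_def', r0, r1, r2, r3]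
      field_simp
      linarith
    have hn : (1 + (1 - x 4) / (1 + x 4))⁻¹ = (1 + x 4) / 2 := by
      field_simp
      norm_num
    ext i
    fin_cases i <;> simp [sphereVec, hm, hn, r0, r1, r2, r3] <;> field_simp
    ring

/-- The standard identification of `ℍℙ¹` with `S⁴`. -/
def hopf : HP1 ≃ S4 := Equiv.ofBijective toSphere ⟨toSphere_injective, toSphere_surjective⟩

/-- The twistor fibration `π : ℂℙ³ → S⁴`. -/
def proj (p : CP3) : S4 := hopf (projHP1 p)

/-- The twistor line `σ(q) = π⁻¹(q)` over `q ∈ S⁴`, as a plane in `ℂ⁴`. -/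
def twistorLine (q : S4) : Submodule ℂ (Fin 4 → ℂ) where
  carrier := {v | toQuat v ∈ (hopf.symm q).submodule}
  zero_mem' := by simp [toQuat_zero]
  add_mem' {v w} hv hw := by
    have h := (hopf.symm q).submodule.add_mem hv hw
    rwa [← toQuat_add] at h
  smul_mem' c v hv := by
    have h := (hopf.symm q).submodule.smul_mem (quat c 0) hv
    rwa [← toQuat_smul] at h

/-- The points of `ℂℙ³` on `twistorLine q` are exactly those of the fibre of `π` over `q`. -/
theorem submodule_le_twistorLine_iff (p : CP3) (q : S4) :
    p.submodule ≤ twistorLine q ↔ proj p = q := by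
  induction p using Projectivization.ind with | h v hv
  rw [Projectivization.submodule_mk, Submodule.span_singleton_le_iff_mem]
  change toQuat v ∈ (hopf.symm q).submodule ↔ hopf (Projectivization.mk _ (toQuat v) _) = q
  rw [← Equiv.eq_symm_apply]
  generalize hopf.symm q = x
  induction x using Projectivization.ind with | h w hw
  rw [Projectivization.submodule_mk, Submodule.mem_span_singleton, Projectivization.mk_eq_mk_iff']

/-! ### Surfaces and their intersections with lines -/

/-- Forms of degree `d` in the homogeneous coordinates of `ℂℙ³`. -/
abbrev Form (d : ℕ) : Type := MvPolynomial.homogeneousSubmodule (Fin 4) ℂ d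

/-- The points of the surface `F = 0`. -/
def surface {d : ℕ} (F : Form d) : Set CP3 := {p | MvPolynomial.eval p.rep F.1 = 0}

/-- The points of `ℂℙ³` on the line given by a plane `L` in `ℂ⁴`. -/
def points (L : Submodule ℂ (Fin 4 → ℂ)) : Set CP3 := {p | p.submodule ≤ L}

/-- The order of vanishing at `t = 0` of the polynomial `F(v + t w)`. -/
def contactOrder {d : ℕ} (F : Form d) (v w : Fin 4 → ℂ) : ℕ :=
  (MvPolynomial.aeval (fun i => Polynomial.C (v i) + Polynomial.C (w i) * Polynomial.X)
    F.1 : Polynomial ℂ).rootMultiplicity 0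

open Classical in
/-- The multiplicity at `p = [v] ∈ L` of the scheme `L ∩ {F = 0}`, i.e. the order of vanishing
at `t = 0` of `F(v + t w)` where `L` is spanned by `v` and `w` (it does not depend on `w`). -/
def multiplicity {d : ℕ} (F : Form d) (L : Submodule ℂ (Fin 4 → ℂ)) (p : CP3) : ℕ :=
  if h : ∃ w : Fin 4 → ℂ, w ∈ L ∧ w ∉ p.submodule then contactOrder F p.rep h.choose else 0

open Classical in
/-- The partition `α(L ∩ X)`, for `X = {F = 0}` and a line `L` not contained in `X`: the multiset
of multiplicities of the scheme `L ∩ X` at its points. -/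
def alpha {d : ℕ} (F : Form d) (L : Submodule ℂ (Fin 4 → ℂ)) : Multiset ℕ :=
  if h : (points L ∩ surface F).Finite then h.toFinset.val.map (multiplicity F L) else 0

/-- The set of the `q ∈ S⁴` for which `α(σ(q) ∩ X)` is the given partition. -/
def locus {d : ℕ} (F : Form d) (μ : Multiset ℕ) : Set S4 := {q | alpha F (twistorLine q) = μ}

/-! ### Real algebraic geometry of `S⁴`, and generality -/

/-- Real algebraic (that is, real Zariski closed) subsets of `S⁴ ⊆ ℝ⁵`. -/
def IsZariskiClosed (Z : Set S4) : Prop :=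
  ∃ I : Set (MvPolynomial (Fin 5) ℝ), Z = {x | ∀ f ∈ I, MvPolynomial.eval (fun i => x.1 i) f = 0}

def IsZariskiOpen (U : Set S4) : Prop := IsZariskiClosed Uᶜ

def IsZariskiLocallyClosed (A : Set S4) : Prop :=
  ∃ U Z : Set S4, IsZariskiOpen U ∧ IsZariskiClosed Z ∧ A = U ∩ Z

/-- `A` is an embedded smooth submanifold of `ℝⁿ` of pure dimension `k`: near each of its points it
is the zero set of a smooth submersion to `ℝᶜ`, where `k + c = n`. -/
def IsSmoothSubmanifold {n : ℕ} (k : ℕ) (A : Set (EuclideanSpace ℝ (Fin n))) : Prop :=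
  ∀ x ∈ A, ∃ c : ℕ, k + c = n ∧ ∃ (U : Set (EuclideanSpace ℝ (Fin n)))
    (f : EuclideanSpace ℝ (Fin n) → EuclideanSpace ℝ (Fin c)),
    IsOpen U ∧ x ∈ U ∧ ContDiffOn ℝ ∞ f U ∧
      (∀ y ∈ U, Function.Surjective (fderiv ℝ f y)) ∧ ∀ y ∈ U, y ∈ A ↔ f y = 0

/-- The monomials of degree `d` in four variables. -/
abbrev Exponent (d : ℕ) : Type := {m : Fin 4 →₀ ℕ // m.degree = d}

/-- The real coordinates of a form: the real and the imaginary parts of its coefficients. -/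
def realCoord {d : ℕ} (F : Form d) : Exponent d ⊕ Exponent d → ℝ :=
  Sum.elim (fun m => (MvPolynomial.coeff m.1 F.1).re) (fun m => (MvPolynomial.coeff m.1 F.1).im)

/-- `Q` holds for a general form of degree `d`: it holds on a nonempty open set of the real Zariski
topology, i.e. off the zero set of a nonzero real polynomial in the real and imaginary parts of
the coefficients. -/
def ForGeneral (d : ℕ) (Q : Form d → Prop) : Prop :=
  ∃ P : MvPolynomial (Exponent d ⊕ Exponent d) ℝ, P ≠ 0 ∧
    ∀ F : Form d, MvPolynomial.eval (realCoord F) P ≠ 0 → Q F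

end

end Twistor

/-! ### Generic fibres of polynomial maps -/

/-! Genericity is a real dimension count. The twistor lines form a family of real dimension 4.
Prescribing zeros of multiplicities `e₁, …, eₛ` at `s` movable points of a movable twistor line
introduces `4 + 2s` real parameters and imposes `e = ∑ eᵢ` complex linear conditions, that is `2e`
real ones, on the coefficients of `F`. If `4 + 2s < 2e` a general `F` never shows the pattern, which
excludes (4), (3,2) and (2,2,2); if `4 + 2s = 2e` it does so for finitely many parameters, which
settles (3) and (2,2). Over the single point at infinity of `S⁴` only the `2s` parameters remain, so
that even (2) is excluded there.

The count is made rigorous by elimination. The conditions say that the restriction of `F` to the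
line has zero remainder modulo `∏ (X - αᵢ)^eᵢ`. They are linear in `F`, polynomial in the parameters
and in reduced echelon form, so they can be solved for `e` coefficients, and the incidence set is
covered by a polynomial map from an affine space (`exists_param`). Such a map misses the general
point, or has finite general fibres, by algebraic dependence
(`MvPolynomial.exists_ne_zero_forall_fiber_empty`,
`MvPolynomial.exists_ne_zero_forall_fiber_finite`). The same count, with four conditions on the
three complex coordinates of a point, makes the surface nonsingular. The outcome is collected in
`IsGeneral`; everything afterwards holds for each `F` with these properties.

Transversality is the nonvanishing of a discriminant, which depends polynomially on the point of
`S⁴`; this gives the Zariski open set. The stratum (2,1,…,1) is the closed complement minus a finite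
set.

Smoothness: at a polynomial with exactly one double root `a` and no other multiple root, the
differential of the discriminant is a nonzero multiple of evaluation at `a`
(`exists_hasDerivAt_disc`). Hence its derivative along a moving line is a multiple of `dF` at the
point of tangency, applied to the velocity of that point. There `dF` is nonzero but kills the
directions of the line, while moving the line realises all transverse directions; so the
discriminant is a submersion `S⁴ → ℂ` (`exists_direction`).

Nonemptiness is topological. The twistor line through `z` is spanned by `z` and its antipode `jz`,
so tangency at `z` means `F(z) = 0` and `dF_z(jz) = 0`. If the stratum were empty, only finitely
many points of the surface would be tangency points, and some plane would avoid them all. Projecting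
the plane curve from a point off the surface and multiplying the values `dF_z(jz)` over the `d`
points of each fibre gives a nowhere zero continuous function on `ℂ`. On the unit circle it is a
constant times `c^((d-2)d)`, since `jz` is antilinear in `z`; its winding number is positive, a
contradiction (`exists_tangency_eq_zero`). -/

theorem MvPolynomial.exists_ne_zero_aeval_eq_zero {K τ κ : Type*} [Field K] [Fintype τ] [Fintype κ]
    (a : κ → MvPolynomial τ K) (h : Fintype.card τ < Fintype.card κ) :
    ∃ P : MvPolynomial κ K, P ≠ 0 ∧ MvPolynomial.aeval a P = 0 := by
  -- Without a relation the `a j` would be algebraically independent, and there are more of them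
  -- than the transcendence degree allows.
  by_contra! hc
  have hi : AlgebraicIndependent K a := by
    rw [algebraicIndependent_iff]
    intro p hp
    by_contra hp0
    exact hc p hp0 hp
  have h1 := hi.lift_cardinalMk_le_trdeg
  rw [MvPolynomial.trdeg_of_isDomain] at h1
  simp only [Cardinal.mk_fintype, Cardinal.lift_natCast, Nat.cast_le] at h1
  omega

/-- A polynomial map to an affine space of larger dimension misses the general point. -/
theorem MvPolynomial.exists_ne_zero_forall_fiber_empty {K τ κ : Type*} [Field K] [Fintype τ]
    [Fintype κ] (a : κ → MvPolynomial τ K) (h : Fintype.card τ < Fintype.card κ) :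
    ∃ P : MvPolynomial κ K, P ≠ 0 ∧ ∀ y : κ → K, MvPolynomial.eval y P ≠ 0 →
      ∀ x : τ → K, ¬ ∀ j, MvPolynomial.eval x (a j) = y j := by
  obtain ⟨P, hP, h0⟩ := MvPolynomial.exists_ne_zero_aeval_eq_zero a h
  refine ⟨P, hP, fun y hy x hx => hy ?_⟩
  have h1 := congrArg (MvPolynomial.eval x) h0
  rw [map_zero, MvPolynomial.aeval_def, MvPolynomial.hom_eval₂] at h1
  rw [← h1, MvPolynomial.eval, MvPolynomial.coe_eval₂Hom]
  congr 1
  · ext; simp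
  · funext j; exact (hx j).symm

/-- A polynomial map to an affine space of at least the same dimension has finite fibres over the
general point. -/
theorem MvPolynomial.exists_ne_zero_forall_fiber_finite {K τ κ : Type*} [Field K] [Fintype τ]
    [Fintype κ] (a : κ → MvPolynomial τ K) (h : Fintype.card τ ≤ Fintype.card κ) :
    ∃ P : MvPolynomial κ K, P ≠ 0 ∧ ∀ y : κ → K, MvPolynomial.eval y P ≠ 0 →
      {x : τ → K | ∀ j, MvPolynomial.eval x (a j) = y j}.Finite := by
  classical
  have key : ∀ i : τ, ∃ P : MvPolynomial κ K, P ≠ 0 ∧ ∀ y : κ → K, MvPolynomial.eval y P ≠ 0 →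
      ((fun x : τ → K => x i) '' {x : τ → K | ∀ j, MvPolynomial.eval x (a j) = y j}).Finite := by
    intro i
    -- The coordinate `X i` together with all `a j` is one polynomial more than `κ`, so there is a
    -- relation. Where its leading coefficient in `X i` does not vanish, it leaves finitely many
    -- values for the `i`-th coordinate on the fibre.
    obtain ⟨Q, hQ, h0⟩ := MvPolynomial.exists_ne_zero_aeval_eq_zero
      (fun o : Option κ => o.elim (MvPolynomial.X i) a) (by simp; omega)
    set T := MvPolynomial.optionEquivLeft K κ Q with hT
    have hT0 : T ≠ 0 := by simpa [hT] using hQ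
    refine ⟨T.leadingCoeff, by simpa using hT0, fun y hy => ?_⟩
    have hTy : T.map (MvPolynomial.eval y) ≠ 0 := fun h => hy (by
      have := congrArg (fun p => Polynomial.coeff p T.natDegree) h
      simpa using this)
    refine ((T.map (MvPolynomial.eval y)).roots.toFinset.finite_toSet).subset ?_
    rintro _ ⟨x, hx, rfl⟩
    simp only [Finset.mem_coe, Multiset.mem_toFinset, Polynomial.mem_roots hTy,
      Polynomial.IsRoot.def]
    have h1 : ∀ R : MvPolynomial (Option κ) K,
        ((MvPolynomial.optionEquivLeft K κ R).map (MvPolynomial.eval y)).eval (x i) =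
        MvPolynomial.eval x
          (MvPolynomial.aeval (fun o : Option κ => o.elim (MvPolynomial.X i) a) R) := by
      intro R
      induction R using MvPolynomial.induction_on with
      | C r => simp [MvPolynomial.algebraMap_eq]
      | add p q hp hq => simp only [map_add, Polynomial.map_add, Polynomial.eval_add, hp, hq]
      | mul_X p o hp =>
        simp only [map_mul, Polynomial.map_mul, Polynomial.eval_mul, hp]
        congr 1
        cases o with
        | none => simp
        | some j => simp [hx j]
    rw [h1, h0, map_zero]
  choose P hP hfin using key
  refine ⟨∏ i, P i, Finset.prod_ne_zero_iff.2 fun i _ => hP i, fun y hy => ?_⟩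
  rw [map_prod, Finset.prod_ne_zero_iff] at hy
  refine (Set.Finite.pi fun i => hfin i y (hy i (Finset.mem_univ i))).subset ?_
  intro x hx i _
  exact ⟨x, hx, rfl⟩

theorem MvPolynomial.exists_re_im {σ : Type*} (p : MvPolynomial σ ℂ) :
    ∃ a b : MvPolynomial σ ℝ, ∀ x : σ → ℝ, MvPolynomial.eval (fun i => (x i : ℂ)) p =
      ⟨MvPolynomial.eval x a, MvPolynomial.eval x b⟩ := by
  induction p using MvPolynomial.induction_on with
  | C z => exact ⟨MvPolynomial.C z.re, MvPolynomial.C z.im, fun x => by simp⟩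
  | add p q hp hq =>
    obtain ⟨a, b, h⟩ := hp
    obtain ⟨a', b', h'⟩ := hq
    exact ⟨a + a', b + b', fun x => by simp [h, h', Complex.ext_iff]⟩
  | mul_X p i hp =>
    obtain ⟨a, b, h⟩ := hp
    exact ⟨a * MvPolynomial.X i, b * MvPolynomial.X i, fun x => by simp [h, Complex.ext_iff]⟩

namespace Twistor

/-! ### General forms -/

theorem ForGeneral.mono {d : ℕ} {Q Q' : Form d → Prop} (h : ForGeneral d Q) (hQ : ∀ F, Q F → Q' F) :
    ForGeneral d Q' := by
  obtain ⟨P, hP, h⟩ := h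
  exact ⟨P, hP, fun F hF => hQ F (h F hF)⟩

theorem ForGeneral.and {d : ℕ} {Q Q' : Form d → Prop} (h : ForGeneral d Q) (h' : ForGeneral d Q') :
    ForGeneral d fun F => Q F ∧ Q' F := by
  obtain ⟨P, hP, h⟩ := h
  obtain ⟨P', hP', h'⟩ := h'
  refine ⟨P * P', mul_ne_zero hP hP', fun F hF => ?_⟩
  rw [map_mul, mul_ne_zero_iff] at hF
  exact ⟨h F hF.1, h' F hF.2⟩

theorem ForGeneral.of_forall {d : ℕ} {Q : Form d → Prop} (h : ∀ F, Q F) : ForGeneral d Q :=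
  ⟨1, one_ne_zero, fun F _ => h F⟩

theorem ForGeneral.imp {d : ℕ} {Q : Form d → Prop} {p : Prop} (h : p → ForGeneral d Q) :
    ForGeneral d fun F => p → Q F := by
  by_cases hp : p
  · exact (h hp).mono fun F hF _ => hF
  · exact ForGeneral.of_forall fun F h => absurd h hp

theorem ForGeneral.forall_fin {d n : ℕ} {Q : Fin n → Form d → Prop}
    (h : ∀ i, ForGeneral d (Q i)) : ForGeneral d fun F => ∀ i, Q i F := by
  choose P hP h using h
  refine ⟨∏ i, P i, Finset.prod_ne_zero_iff.2 fun i _ => hP i, fun F hF i => ?_⟩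
  rw [map_prod, Finset.prod_ne_zero_iff] at hF
  exact h i F (hF i (Finset.mem_univ i))

noncomputable instance (d : ℕ) : Fintype (Exponent d) :=
  @Fintype.ofFinite _ (((Finsupp.finite_of_degree_le d).subset
    fun _ h => le_of_eq h : {m : Fin 4 →₀ ℕ | m.degree = d}.Finite).to_subtype)

theorem Form.eq_sum {d : ℕ} (F : Form d) :
    F.1 = ∑ m : Exponent d, MvPolynomial.monomial m.1 (MvPolynomial.coeff m.1 F.1) := by
  ext m
  rw [MvPolynomial.coeff_sum]
  simp only [MvPolynomial.coeff_monomial]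
  by_cases hm : m.degree = d
  · rw [Finset.sum_eq_single (⟨m, hm⟩ : Exponent d)]
    · simp
    · intro b _ hb
      rw [if_neg]
      exact fun h => hb (Subtype.ext h)
    · simp
  · rw [Finset.sum_eq_zero]
    · exact F.2.coeff_eq_zero hm
    · rintro b -
      rw [if_neg]
      rintro rfl
      exact hm b.2

theorem Form.aeval_eq_sum {d : ℕ} (F : Form d) {A : Type*} [CommSemiring A] [Algebra ℂ A]
    (z : Fin 4 → A) : MvPolynomial.aeval z F.1 =
      ∑ m : Exponent d, MvPolynomial.coeff m.1 F.1 • ∏ i, z i ^ m.1 i := by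
  conv_lhs => rw [F.eq_sum]
  rw [map_sum]
  refine Finset.sum_congr rfl fun m _ => ?_
  rw [MvPolynomial.aeval_monomial, Algebra.smul_def, Finsupp.prod_fintype]
  simp

/-- The form with given coefficients. -/
noncomputable def ofCoeff {d : ℕ} (c : Exponent d → ℂ) : Form d :=
  ⟨∑ m : Exponent d, MvPolynomial.monomial m.1 (c m),
    MvPolynomial.IsHomogeneous.sum _ _ _ fun m _ => MvPolynomial.isHomogeneous_monomial _ m.2⟩

theorem coeff_ofCoeff {d : ℕ} (c : Exponent d → ℂ) (m : Exponent d) :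
    MvPolynomial.coeff m.1 (ofCoeff c).1 = c m := by
  change MvPolynomial.coeff m.1 (∑ m : Exponent d, MvPolynomial.monomial m.1 (c m)) = _
  rw [MvPolynomial.coeff_sum, Finset.sum_eq_single m]
  · simp
  · intro b _ hb
    rw [MvPolynomial.coeff_monomial, if_neg]
    exact fun h => hb (Subtype.ext h)
  · simp

theorem Form.ext_coeff {d : ℕ} {F G : Form d}
    (h : ∀ m : Exponent d, MvPolynomial.coeff m.1 F.1 = MvPolynomial.coeff m.1 G.1) : F = G := by
  apply Subtype.ext
  rw [F.eq_sum, G.eq_sum]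
  simp only [h]

theorem realCoord_surjective (d : ℕ) : Function.Surjective (realCoord (d := d)) := by
  intro y
  refine ⟨ofCoeff fun m => ⟨y (.inl m), y (.inr m)⟩, ?_⟩
  funext m
  rcases m with m | m <;> simp [realCoord, coeff_ofCoeff]

/-- Invertible linear substitutions preserve generality. -/
theorem ForGeneral.comp {d : ℕ} {Q : Form d → Prop} (h : ForGeneral d Q) (S : Form d →ₗ[ℂ] Form d)
    (hS : Function.Surjective S) : ForGeneral d fun F => Q (S F) := by
  obtain ⟨P, hP, h⟩ := h
  let A (m k : Exponent d) : ℂ := MvPolynomial.coeff m.1 (S (ofCoeff (Pi.single k 1))).1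
  have hA (F : Form d) (m : Exponent d) : MvPolynomial.coeff m.1 (S F).1 =
      ∑ k, MvPolynomial.coeff k.1 F.1 * A m k := by
    have e : F = ∑ k, MvPolynomial.coeff k.1 F.1 • ofCoeff (Pi.single k 1) := by
      apply Form.ext_coeff
      intro m
      simp only [Submodule.coe_sum, Submodule.coe_smul, MvPolynomial.coeff_sum,
        MvPolynomial.coeff_smul, coeff_ofCoeff]
      simp [Pi.single_apply]
    conv_lhs => rw [e]
    simp only [map_sum, map_smul, Submodule.coe_sum, Submodule.coe_smul, MvPolynomial.coeff_sum,
        MvPolynomial.coeff_smul, smul_eq_mul, A]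
  let L : Exponent d ⊕ Exponent d → MvPolynomial (Exponent d ⊕ Exponent d) ℝ := Sum.elim
    (fun m => ∑ k, (MvPolynomial.X (.inl k) * MvPolynomial.C (A m k).re -
      MvPolynomial.X (.inr k) * MvPolynomial.C (A m k).im))
    (fun m => ∑ k, (MvPolynomial.X (.inl k) * MvPolynomial.C (A m k).im +
      MvPolynomial.X (.inr k) * MvPolynomial.C (A m k).re))
  have hL (F : Form d) (m) : MvPolynomial.eval (realCoord F) (L m) = realCoord (S F) m := by
    rcases m with m | m
    · simp [L, realCoord, hA]
    · simp [L, realCoord, hA]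
  have ev (F : Form d) : MvPolynomial.eval (realCoord F) (MvPolynomial.bind₁ L P) =
      MvPolynomial.eval (realCoord (S F)) P := by
    rw [← MvPolynomial.coe_aeval_eq_eval, ← MvPolynomial.coe_aeval_eq_eval]
    simp only [RingHom.coe_coe, MvPolynomial.aeval_bind₁]
    congr 2
    funext m
    rw [← hL F m, ← MvPolynomial.coe_aeval_eq_eval]
    rfl
  refine ⟨MvPolynomial.bind₁ L P, fun h0 => hP ?_, fun F hF => h _ (by rwa [← ev])⟩
  -- Every real point is the coordinate vector of some `S F`, so vanishing of the pulled back
  -- polynomial forces `P` to vanish everywhere.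
  refine MvPolynomial.funext fun y => ?_
  obtain ⟨G, rfl⟩ := realCoord_surjective d y
  obtain ⟨F, rfl⟩ := hS G
  rw [← ev, h0, map_zero, map_zero]

/-- Linear conditions on forms depending polynomially on real parameters, in reduced echelon form:
if there are enough of them, a general form satisfies them for few parameters only. -/
theorem exists_param {d : ℕ} {σ ε : Type} [Fintype σ] [Fintype ε] [DecidableEq ε]
    (J : ε → Exponent d) (hJ : Function.Injective J)
    (lam : ε → Exponent d → MvPolynomial σ ℂ)
    (hlam : ∀ j j', lam j (J j') = if j = j' then 1 else 0) :
    ∃ (τ : Type) (_ : Fintype τ) (i : σ → τ) (a : Exponent d ⊕ Exponent d → MvPolynomial τ ℝ),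
      Fintype.card τ + 2 * Fintype.card ε =
        Fintype.card σ + Fintype.card (Exponent d ⊕ Exponent d) ∧
      ∀ (F : Form d) (θ : σ → ℝ), (∀ j, ∑ m, MvPolynomial.eval (fun s => (θ s : ℂ)) (lam j m) *
        MvPolynomial.coeff m.1 F.1 = 0) →
        ∃ x : τ → ℝ, x ∘ i = θ ∧ ∀ k, MvPolynomial.eval x (a k) = realCoord F k := by
  classical
  let W := {m : Exponent d // m ∉ Set.range J}
  have hcard : Fintype.card W + Fintype.card ε = Fintype.card (Exponent d) := by
    rw [← Set.card_range_of_injective hJ, add_comm, ← Fintype.card_sum]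
    exact Fintype.card_congr (Equiv.sumCompl fun m => m ∈ Set.range J)
  choose A B hAB using fun j m => MvPolynomial.exists_re_im (lam j m)
  let τ := σ ⊕ (W ⊕ W)
  let u (w : W) : MvPolynomial τ ℝ := MvPolynomial.X (.inr (.inl w))
  let v (w : W) : MvPolynomial τ ℝ := MvPolynomial.X (.inr (.inr w))
  let A' j m : MvPolynomial τ ℝ := MvPolynomial.rename Sum.inl (A j m)
  let B' j m : MvPolynomial τ ℝ := MvPolynomial.rename Sum.inl (B j m)
  let a : Exponent d ⊕ Exponent d → MvPolynomial τ ℝ := Sum.elim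
    (fun m => if h : m ∈ Set.range J then
      - ∑ w : W, (A' h.choose w * u w - B' h.choose w * v w) else u ⟨m, h⟩)
    (fun m => if h : m ∈ Set.range J then
      - ∑ w : W, (A' h.choose w * v w + B' h.choose w * u w) else v ⟨m, h⟩)
  refine ⟨τ, inferInstance, Sum.inl, a, ?_, fun F θ h => ?_⟩
  · simp only [τ, Fintype.card_sum]
    omega
  let x : τ → ℝ := Sum.elim θ (Sum.elim (fun w => (MvPolynomial.coeff w.1.1 F.1).re)
    (fun w => (MvPolynomial.coeff w.1.1 F.1).im))
  have hA' j m : MvPolynomial.eval x (A' j m) = MvPolynomial.eval θ (A j m) := by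
    simp only [A', MvPolynomial.eval_rename]; rfl
  have hB' j m : MvPolynomial.eval x (B' j m) = MvPolynomial.eval θ (B j m) := by
    simp only [B', MvPolynomial.eval_rename]; rfl
  have hu w : MvPolynomial.eval x (u w) = (MvPolynomial.coeff w.1.1 F.1).re := by simp [u, x]
  have hv w : MvPolynomial.eval x (v w) = (MvPolynomial.coeff w.1.1 F.1).im := by simp [v, x]
  have key (j : ε) : MvPolynomial.coeff (J j).1 F.1 = - ∑ w : W,
      MvPolynomial.eval (fun s => (θ s : ℂ)) (lam j w) * MvPolynomial.coeff w.1.1 F.1 := by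
    have h1 := h j
    rw [← Fintype.sum_subtype_add_sum_subtype (fun m => m ∈ Set.range J)] at h1
    rw [eq_neg_iff_add_eq_zero, ← h1]
    congr 1
    have hb : Function.Bijective fun k : ε => (⟨J k, k, rfl⟩ : {m // m ∈ Set.range J}) :=
      ⟨fun k l hkl => hJ (congrArg Subtype.val hkl), fun ⟨m, k, hk⟩ => ⟨k, Subtype.ext hk⟩⟩
    refine Eq.trans ?_ ((hb.sum_comp fun i => MvPolynomial.eval (fun s => (θ s : ℂ)) (lam j i.1) *
      MvPolynomial.coeff i.1.1 F.1).trans (Finset.sum_congr (by ext; simp) fun _ _ => rfl))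
    simp only [hlam]
    rw [Finset.sum_eq_single j]
    · simp
    · intro b _ hb
      simp [hb.symm]
    · simp
  refine ⟨x, rfl, ?_⟩
  rintro (m | m)
  · simp only [a, Sum.elim_inl, realCoord]
    split_ifs with hm
    · conv_rhs => rw [← hm.choose_spec, key]
      simp [hA', hB', hu, hv, hAB]
    · rw [hu]
  · simp only [a, Sum.elim_inr, realCoord]
    split_ifs with hm
    · conv_rhs => rw [← hm.choose_spec, key]
      simp [hA', hB', hu, hv, hAB]
    · rw [hv]

/-- With `N` coefficients, `exists_param` covers the incidence set by `card σ + 2 (N - card ε)` real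
parameters, at most the `2 N` coordinates of the target. Fibres are then generically finite, and `θ`
is part of the parameter. -/
theorem forGeneral_finite_of_linear {d : ℕ} {σ ε : Type} [Fintype σ] [Fintype ε] [DecidableEq ε]
    (J : ε → Exponent d) (hJ : Function.Injective J)
    (lam : ε → Exponent d → MvPolynomial σ ℂ)
    (hlam : ∀ j j', lam j (J j') = if j = j' then 1 else 0)
    (hcard : Fintype.card σ ≤ 2 * Fintype.card ε) :
    ForGeneral d fun F => {θ : σ → ℝ | ∀ j, ∑ m,
      MvPolynomial.eval (fun s => (θ s : ℂ)) (lam j m) * MvPolynomial.coeff m.1 F.1 = 0}.Finite := by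
  obtain ⟨τ, _, i, a, hc, h⟩ := exists_param J hJ lam hlam
  obtain ⟨P, hP, hP'⟩ := MvPolynomial.exists_ne_zero_forall_fiber_finite a (by omega)
  refine ⟨P, hP, fun F hF => ((hP' _ hF).image fun x => x ∘ i).subset fun θ hθ => ?_⟩
  obtain ⟨x, hx, hx'⟩ := h F θ hθ
  exact ⟨x, hx', hx⟩

theorem forGeneral_empty_of_linear {d : ℕ} {σ ε : Type} [Fintype σ] [Fintype ε] [DecidableEq ε]
    (J : ε → Exponent d) (hJ : Function.Injective J)
    (lam : ε → Exponent d → MvPolynomial σ ℂ)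
    (hlam : ∀ j j', lam j (J j') = if j = j' then 1 else 0)
    (hcard : Fintype.card σ < 2 * Fintype.card ε) :
    ForGeneral d fun F => ∀ θ : σ → ℝ, ¬ ∀ j, ∑ m,
      MvPolynomial.eval (fun s => (θ s : ℂ)) (lam j m) * MvPolynomial.coeff m.1 F.1 = 0 := by
  obtain ⟨τ, _, i, a, hc, h⟩ := exists_param J hJ lam hlam
  obtain ⟨P, hP, hP'⟩ := MvPolynomial.exists_ne_zero_forall_fiber_empty a (by omega)
  refine ⟨P, hP, fun F hF θ hθ => ?_⟩
  obtain ⟨x, -, hx'⟩ := h F θ hθ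
  exact hP' _ hF x hx'

end Twistor

/-! ### Parametrised twistor lines and the incidence conditions. -/

namespace Twistor

open Polynomial in
/-- The restriction `F(v + t w)` of a form to a parametrised line. -/
noncomputable def restr {d : ℕ} (F : Form d) (v w : Fin 4 → ℂ) : ℂ[X] :=
  MvPolynomial.aeval (fun i => C (v i) + C (w i) * X) F.1

/-- The linear parametrisation `c ↦ (c p₀, c p₁)` of the twistor line through `p`, where
`c = c₀ + c₁ j`. -/
noncomputable def lineMap (p : Fin 2 → ℍ[ℝ]) : (Fin 2 → ℂ) →ₗ[ℂ] (Fin 4 → ℂ) where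
  toFun c := ![c 0 * ⟨(p 0).re, (p 0).imI⟩ - c 1 * ⟨(p 0).imJ, -(p 0).imK⟩,
    c 0 * ⟨(p 0).imJ, (p 0).imK⟩ + c 1 * ⟨(p 0).re, -(p 0).imI⟩,
    c 0 * ⟨(p 1).re, (p 1).imI⟩ - c 1 * ⟨(p 1).imJ, -(p 1).imK⟩,
    c 0 * ⟨(p 1).imJ, (p 1).imK⟩ + c 1 * ⟨(p 1).re, -(p 1).imI⟩]
  map_add' c c' := by
    funext i
    fin_cases i <;> simp <;> ring
  map_smul' t c := by
    funext i
    fin_cases i <;> simp <;> ring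

theorem toQuat_lineMap (p : Fin 2 → ℍ[ℝ]) (c : Fin 2 → ℂ) :
    toQuat (lineMap p c) = quat (c 0) (c 1) • p := by
  funext i
  fin_cases i
  · change quat _ _ = quat (c 0) (c 1) * p 0
    ext <;> (first | rw [Quaternion.re_mul] | rw [Quaternion.imI_mul] | rw [Quaternion.imJ_mul] |
      rw [Quaternion.imK_mul]) <;> simp [lineMap, quat] <;> ring
  · change quat _ _ = quat (c 0) (c 1) * p 1
    ext <;> (first | rw [Quaternion.re_mul] | rw [Quaternion.imI_mul] | rw [Quaternion.imJ_mul] |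
      rw [Quaternion.imK_mul]) <;> simp [lineMap, quat] <;> ring

/-- The quaternion with given coordinates. -/
def toH (r : Fin 4 → ℝ) : ℍ[ℝ] := ⟨r 0, r 1, r 2, r 3⟩

/-! ### Substitutions -/

theorem Form.map_aeval {d : ℕ} (F : Form d) {A B : Type*} [CommRing A] [Algebra ℂ A] [CommRing B]
    [Algebra ℂ B] (f : A →ₐ[ℂ] B) (z : Fin 4 → A) :
    f (MvPolynomial.aeval z F.1) = MvPolynomial.aeval (fun i => f (z i)) F.1 := by
  rw [← MvPolynomial.comp_aeval_apply]

/-- The shear `(z₀, z₁, z₂, z₃) ↦ (z₀, z₁ + b z₀, z₂, z₃ + b z₂)` acting on forms. -/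
noncomputable def shear {d : ℕ} (b : ℂ) : Form d →ₗ[ℂ] Form d where
  toFun F := ⟨MvPolynomial.aeval (![MvPolynomial.X 0,
      MvPolynomial.X 1 + MvPolynomial.C b * MvPolynomial.X 0, MvPolynomial.X 2,
      MvPolynomial.X 3 + MvPolynomial.C b * MvPolynomial.X 2] : Fin 4 → MvPolynomial (Fin 4) ℂ) F.1,
    by
      rw [MvPolynomial.mem_homogeneousSubmodule]
      convert! MvPolynomial.IsHomogeneous.aeval (n := 1) F.2 _ fun i => ?_ using 1
      · exact (one_mul d).symm
      fin_cases i
      · exact MvPolynomial.isHomogeneous_X _ _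
      · exact (MvPolynomial.isHomogeneous_X _ _).add (MvPolynomial.isHomogeneous_C_mul_X _ _)
      · exact MvPolynomial.isHomogeneous_X _ _
      · exact (MvPolynomial.isHomogeneous_X _ _).add (MvPolynomial.isHomogeneous_C_mul_X _ _)⟩
  map_add' F G := Subtype.ext (map_add _ _ _)
  map_smul' c F := Subtype.ext (map_smul _ _ _)

theorem aeval_shear {d : ℕ} (b : ℂ) (F : Form d) {A : Type*} [CommRing A] [Algebra ℂ A]
    (z : Fin 4 → A) : MvPolynomial.aeval z (shear b F).1 =
      MvPolynomial.aeval ![z 0, z 1 + algebraMap ℂ A b * z 0, z 2,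
        z 3 + algebraMap ℂ A b * z 2] F.1 := by
  change MvPolynomial.aeval z (MvPolynomial.aeval _ F.1) = _
  rw [Form.map_aeval]
  congr 2
  funext i
  fin_cases i <;> simp

theorem shear_surjective {d : ℕ} (b : ℂ) : Function.Surjective (shear (d := d) b) := by
  intro F
  refine ⟨shear (-b) F, Subtype.ext ?_⟩
  rw [← MvPolynomial.aeval_X_left_apply (shear b (shear (-b) F)).1, aeval_shear, aeval_shear]
  conv_rhs => rw [← MvPolynomial.aeval_X_left_apply F.1]
  congr 2
  funext i
  fin_cases i <;> simp

/-! ### Multiple points on lines of a family -/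

open Polynomial in
/-- The coefficients of the remainder of the restriction of a monomial. -/
noncomputable def remCoeff {d e : ℕ} {σ : Type} (z : Fin 4 → (MvPolynomial σ ℂ)[X])
    (q : (MvPolynomial σ ℂ)[X]) (j : Fin e) (m : Exponent d) : MvPolynomial σ ℂ :=
  ((∏ i, z i ^ m.1 i) %ₘ q).coeff j

-- The remainder modulo a monic polynomial is linear and commutes with specialising the parameters,
-- so divisibility of the restriction turns into linear equations for the coefficients of `F`.
open Polynomial in
theorem sum_remCoeff {d e : ℕ} {σ : Type} (z : Fin 4 → (MvPolynomial σ ℂ)[X])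
    {q : (MvPolynomial σ ℂ)[X]} (hq : q.Monic) (F : Form d) (ev : MvPolynomial σ ℂ →ₐ[ℂ] ℂ)
    (h : q.map ev.toRingHom ∣ MvPolynomial.aeval (fun i => (z i).map ev.toRingHom) F.1)
    (j : Fin e) : ∑ m : Exponent d, ev (remCoeff z q j m) * MvPolynomial.coeff m.1 F.1 = 0 := by
  have hqm := hq.map ev.toRingHom
  rw [← modByMonic_eq_zero_iff_dvd hqm, F.aeval_eq_sum, ← modByMonicHom_apply, map_sum] at h
  have h1 := congrArg (fun p => p.coeff j) h
  simp only [finsetSum_coeff, coeff_zero] at h1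
  rw [← h1]
  refine Finset.sum_congr rfl fun m _ => ?_
  rw [map_smul, coeff_smul, smul_eq_mul, mul_comm, modByMonicHom_apply, remCoeff]
  congr 1
  have e : ∏ i, (z i).map ev.toRingHom ^ m.1 i = (∏ i, z i ^ m.1 i).map ev.toRingHom := by
    rw [Polynomial.map_prod]
    simp only [Polynomial.map_pow]
  rw [e, ← map_modByMonic _ hq, coeff_map]
  rfl

/-- The exponent of `zₐ ^ i * z_b ^ (d - i)`. -/
noncomputable def binExponent {d e : ℕ} (a b : Fin 4) (he : e ≤ d + 1) (i : Fin e) : Exponent d :=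
  ⟨Finsupp.single a i.1 + Finsupp.single b (d - i.1), by
    rw [map_add, Finsupp.degree_single, Finsupp.degree_single]; omega⟩

theorem binExponent_injective {d e : ℕ} {a b : Fin 4} (hab : a ≠ b) (he : e ≤ d + 1) :
    Function.Injective (binExponent a b he) := by
  intro i j h
  have h1 := congrArg (fun m : Exponent d => m.1 a) h
  simp only [binExponent, Finsupp.add_apply, Finsupp.single_eq_same] at h1
  rw [Finsupp.single_eq_of_ne hab, Finsupp.single_eq_of_ne hab] at h1
  exact Fin.ext (by simpa using h1)

-- The source of the echelon form: `zₐ ^ i * z_b ^ (d - i)` restricts to `X ^ i`, which for `i < e`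
-- is its own remainder. The bound `e ≤ d + 1` makes all these monomials available.
open Polynomial in
theorem remCoeff_binExponent {d e : ℕ} {σ : Type} {z : Fin 4 → (MvPolynomial σ ℂ)[X]}
    {q : (MvPolynomial σ ℂ)[X]} (hq : q.Monic) (hqe : q.natDegree = e) {a b : Fin 4} (hab : a ≠ b)
    (ha : z a = X) (hb : z b = 1) (he : e ≤ d + 1) (j j' : Fin e) :
    remCoeff z q j (binExponent (d := d) a b he j') = if j = j' then 1 else 0 := by
  have e1 : ∏ i, z i ^ (binExponent (d := d) a b he j').1 i = X ^ j'.1 := by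
    rw [Finset.prod_eq_mul a b hab]
    · simp [ha, hb, binExponent, hab]
    · intro c _ hc
      simp [binExponent, hc.1, hc.2]
    · simp
    · simp
  rw [remCoeff, e1, (modByMonic_eq_self_iff hq).2, coeff_X_pow]
  · simp [Fin.ext_iff]
  · rw [degree_X_pow, degree_eq_natDegree hq.ne_zero, hqe]
    exact_mod_cast j'.2

/-- Evaluation at real parameters. -/
noncomputable def evReal {σ : Type} (θ : σ → ℝ) : MvPolynomial σ ℂ →ₐ[ℂ] ℂ :=
  MvPolynomial.aeval fun s => (θ s : ℂ)

theorem evReal_eq {σ : Type} (θ : σ → ℝ) (p : MvPolynomial σ ℂ) :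
    evReal θ p = MvPolynomial.eval (fun s => (θ s : ℂ)) p := rfl

open Polynomial in
theorem forGeneral_finite_dvd {d e : ℕ} {σ : Type} [Fintype σ] (z : Fin 4 → (MvPolynomial σ ℂ)[X])
    {q : (MvPolynomial σ ℂ)[X]} (hq : q.Monic) (hqe : q.natDegree = e) {a b : Fin 4} (hab : a ≠ b)
    (ha : z a = X) (hb : z b = 1) (he : e ≤ d + 1) (hc : Fintype.card σ ≤ 2 * e) :
    ForGeneral d fun F => {θ : σ → ℝ | q.map (evReal θ).toRingHom ∣
      MvPolynomial.aeval (fun i => (z i).map (evReal θ).toRingHom) F.1}.Finite :=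
  (forGeneral_finite_of_linear (binExponent a b he) (binExponent_injective hab he)
    (remCoeff z q) (remCoeff_binExponent hq hqe hab ha hb he) (by simpa using hc)).mono
    fun F hF => hF.subset fun _ hθ j => sum_remCoeff z hq F _ hθ j

open Polynomial in
theorem forGeneral_not_dvd {d e : ℕ} {σ : Type} [Fintype σ] (z : Fin 4 → (MvPolynomial σ ℂ)[X])
    {q : (MvPolynomial σ ℂ)[X]} (hq : q.Monic) (hqe : q.natDegree = e) {a b : Fin 4} (hab : a ≠ b)
    (ha : z a = X) (hb : z b = 1) (he : e ≤ d + 1) (hc : Fintype.card σ < 2 * e) :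
    ForGeneral d fun F => ∀ θ : σ → ℝ, ¬ q.map (evReal θ).toRingHom ∣
      MvPolynomial.aeval (fun i => (z i).map (evReal θ).toRingHom) F.1 :=
  (forGeneral_empty_of_linear (binExponent a b he) (binExponent_injective hab he)
    (remCoeff z q) (remCoeff_binExponent hq hqe hab ha hb he) (by simpa using hc)).mono
    fun F hF θ hθ => hF θ fun j => sum_remCoeff z hq F _ hθ j

open Polynomial in
/-- `∏ (X - α_{π i})` for indeterminate complex numbers `α`, given by their real and imaginary
parts. -/
noncomputable def univRoots {σ : Type} {e s : ℕ} (re im : Fin s → σ) (π : Fin e → Fin s) :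
    (MvPolynomial σ ℂ)[X] :=
  ∏ i, (X - C (MvPolynomial.X (re (π i)) + MvPolynomial.C Complex.I * MvPolynomial.X (im (π i))))

theorem univRoots_monic {σ : Type} {e s : ℕ} (re im : Fin s → σ) (π : Fin e → Fin s) :
    (univRoots re im π).Monic :=
  Polynomial.monic_prod_of_monic _ _ fun _ _ => Polynomial.monic_X_sub_C _

theorem univRoots_natDegree {σ : Type} {e s : ℕ} (re im : Fin s → σ) (π : Fin e → Fin s) :
    (univRoots re im π).natDegree = e := by
  rw [univRoots, Polynomial.natDegree_prod_of_monic _ _ fun _ _ => Polynomial.monic_X_sub_C _]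
  simp only [Polynomial.natDegree_X_sub_C]
  simp

open Polynomial in
theorem univRoots_map {σ : Type} {e s : ℕ} (re im : Fin s → σ) (π : Fin e → Fin s) (θ : σ → ℝ)
    (α : Fin s → ℂ) (hre : ∀ i, θ (re i) = (α i).re) (him : ∀ i, θ (im i) = (α i).im) :
    (univRoots re im π).map (evReal θ).toRingHom = ∏ i, (X - C (α (π i))) := by
  rw [univRoots, Polynomial.map_prod]
  refine Finset.prod_congr rfl fun i _ => ?_
  rw [Polynomial.map_sub, map_X, map_C]
  congr 2
  change evReal θ _ = _
  simp only [evReal_eq, map_add, map_mul, MvPolynomial.eval_X, MvPolynomial.eval_C, hre, him]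
  rw [mul_comm, Complex.re_add_im]

/-- The polynomial `F(v + t w)` for the chart of the line over `r` (resp. over infinity) in which
the points are `c = (t, 1 + b t)`. -/
noncomputable def chart {d : ℕ} (F : Form d) (p : Fin 2 → ℍ[ℝ]) (b : ℂ) : Polynomial ℂ :=
  restr F (lineMap p ![0, 1]) (lineMap p ![1, b])

open Polynomial in
/-- The generic twistor line in the coordinates where the shear is undone. -/
noncomputable def univLine {s : ℕ} (b : ℂ) :
    Fin 4 → (MvPolynomial (Fin 4 ⊕ (Fin s ⊕ Fin s)) ℂ)[X] :=
  let x (i : Fin 4) : (MvPolynomial (Fin 4 ⊕ (Fin s ⊕ Fin s)) ℂ)[X] := C (MvPolynomial.X (.inl i))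
  let I : (MvPolynomial (Fin 4 ⊕ (Fin s ⊕ Fin s)) ℂ)[X] := C (MvPolynomial.C Complex.I)
  let b' : (MvPolynomial (Fin 4 ⊕ (Fin s ⊕ Fin s)) ℂ)[X] := C (MvPolynomial.C b)
  let z₂ := X * (x 0 + I * x 1) - (1 + b' * X) * (x 2 - I * x 3)
  let z₃ := X * (x 2 + I * x 3) + (1 + b' * X) * (x 0 - I * x 1)
  -- The inverse shear takes the first two coordinates `(X, 1 + b X)` to `(X, 1)`, as the echelon
  -- form requires.
  ![X, 1, z₂, z₃ - b' * z₂]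

open Polynomial in
theorem aeval_univLine {d s : ℕ} (b : ℂ) (F : Form d) (r : Fin 4 → ℝ)
    (θ : Fin 4 ⊕ (Fin s ⊕ Fin s) → ℝ) (hθ : ∀ i, θ (.inl i) = r i) :
    MvPolynomial.aeval (fun i => (univLine (s := s) b i).map (evReal θ).toRingHom) (shear b F).1 =
      chart F ![1, toH r] b := by
  rw [aeval_shear, chart, restr]
  congr 2
  have hX (i : Fin 4) : evReal θ (MvPolynomial.X (.inl i)) = (r i : ℂ) := by
    rw [← hθ]; exact MvPolynomial.aeval_X _ _
  have mk (x y : ℝ) : (⟨x, y⟩ : ℂ) = x + Complex.I * y := by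
    rw [mul_comm]; exact Complex.mk_eq_add_mul_I x y
  funext i
  fin_cases i
  · simp [univLine, lineMap]
    simp [mk]
  · simp [univLine, lineMap]
    simp [mk]
  · simp [univLine, lineMap, hX, toH]
    simp only [mk, map_add, map_mul, Complex.ofReal_neg, map_neg]
    ring
  · simp [univLine, lineMap, hX, toH]
    simp only [mk, map_add, map_mul, Complex.ofReal_neg, map_neg]
    ring

-- Four real parameters for the line and two for each of the `s` roots, against `e` complex
-- conditions.
open Polynomial in
theorem forGeneral_finite_pattern {d e s : ℕ} (b : ℂ) (π : Fin e → Fin s) (he : e ≤ d + 1)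
    (hc : 4 + 2 * s ≤ 2 * e) :
    ForGeneral d fun F => {x : (Fin 4 → ℝ) × (Fin s → ℂ) |
      ∏ i, (X - C (x.2 (π i))) ∣ chart F ![1, toH x.1] b}.Finite := by
  refine ((forGeneral_finite_dvd (univLine b)
    (univRoots_monic (Sum.inr ∘ Sum.inl) (Sum.inr ∘ Sum.inr) π) (univRoots_natDegree _ _ π)
    (by decide : (0 : Fin 4) ≠ 1) rfl rfl he (by simp; omega)).comp (shear b)
    (shear_surjective b)).mono fun F hF => ?_
  refine (hF.image fun θ => (fun i => θ (.inl i),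
    fun j => ⟨θ (.inr (.inl j)), θ (.inr (.inr j))⟩)).subset ?_
  rintro ⟨r, α⟩ h
  refine ⟨Sum.elim r (Sum.elim (fun j => (α j).re) (fun j => (α j).im)), ?_, rfl⟩
  rw [Set.mem_ofPred_eq, aeval_univLine b F r _ fun _ => rfl,
    univRoots_map (α := α)]
  exacts [h, fun _ => rfl, fun _ => rfl]

open Polynomial in
theorem forGeneral_no_pattern {d e s : ℕ} (b : ℂ) (π : Fin e → Fin s) (he : e ≤ d + 1)
    (hc : 4 + 2 * s < 2 * e) :
    ForGeneral d fun F => ∀ (r : Fin 4 → ℝ) (α : Fin s → ℂ),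
      ¬ ∏ i, (X - C (α (π i))) ∣ chart F ![1, toH r] b := by
  refine ((forGeneral_not_dvd (univLine b)
    (univRoots_monic (Sum.inr ∘ Sum.inl) (Sum.inr ∘ Sum.inr) π) (univRoots_natDegree _ _ π)
    (by decide : (0 : Fin 4) ≠ 1) rfl rfl he (by simp; omega)).comp (shear b)
    (shear_surjective b)).mono fun F hF r α h => ?_
  refine hF (Sum.elim r (Sum.elim (fun j => (α j).re) (fun j => (α j).im))) ?_
  rw [aeval_univLine b F r _ fun _ => rfl,
    univRoots_map (α := α)]
  exacts [h, fun _ => rfl, fun _ => rfl]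

-- The line over infinity is fixed, so only the `2 s` real parameters of the roots are counted.
open Polynomial in
theorem forGeneral_no_pattern_infinity {d e s : ℕ} (b : ℂ) (π : Fin e → Fin s) (he : e ≤ d + 1)
    (hc : s < e) :
    ForGeneral d fun F => ∀ (α : Fin s → ℂ), ¬ ∏ i, (X - C (α (π i))) ∣ chart F ![0, 1] b := by
  refine ((forGeneral_not_dvd ![0, 0, X, 1]
    (univRoots_monic (Sum.inl) (Sum.inr) π) (univRoots_natDegree _ _ π)
    (by decide : (2 : Fin 4) ≠ 3) rfl rfl he (by simp; omega)).comp (shear b)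
    (shear_surjective b)).mono fun F hF α h => ?_
  refine hF (Sum.elim (fun j => (α j).re) (fun j => (α j).im)) ?_
  rw [univRoots_map (α := α)]
  rotate_left
  · exact fun _ => rfl
  · exact fun _ => rfl
  convert! h
  rw [aeval_shear, chart, restr]
  congr 2
  have h1 : (⟨1, 0⟩ : ℂ) = 1 := rfl
  have h0 : (⟨0, 0⟩ : ℂ) = 0 := rfl
  funext i
  fin_cases i <;> simp [lineMap, h1, h0]

end Twistor

namespace Twistor

/-! ### Restriction of forms to lines -/

theorem Form.eval_eq_sum {d : ℕ} (F : Form d) (z : Fin 4 → ℂ) : MvPolynomial.eval z F.1 =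
    ∑ m : Exponent d, MvPolynomial.coeff m.1 F.1 * ∏ i, z i ^ m.1 i :=
  F.aeval_eq_sum z

theorem Exponent.sum_eq {d : ℕ} (m : Exponent d) : ∑ i, m.1 i = d := by
  rw [← Finsupp.degree_eq_sum, m.2]

theorem Form.eval_smul {d : ℕ} (F : Form d) (c : ℂ) (z : Fin 4 → ℂ) :
    MvPolynomial.eval (c • z) F.1 = c ^ d * MvPolynomial.eval z F.1 := by
  rw [F.eval_eq_sum, F.eval_eq_sum, Finset.mul_sum]
  refine Finset.sum_congr rfl fun m _ => ?_
  simp only [Pi.smul_apply, smul_eq_mul, mul_pow, Finset.prod_mul_distrib,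
    Finset.prod_pow_eq_pow_sum, m.sum_eq]
  ring

theorem eval_restr {d : ℕ} (F : Form d) (v w : Fin 4 → ℂ) (t : ℂ) :
    (restr F v w).eval t = MvPolynomial.eval (v + t • w) F.1 := by
  refine (F.map_aeval (Polynomial.aeval t) _).trans ?_
  change _ = MvPolynomial.aeval (v + t • w) F.1
  congr 2
  funext i
  rw [map_add, map_mul, Polynomial.aeval_C, Polynomial.aeval_C, Polynomial.aeval_X, mul_comm]
  rfl

theorem restr_coeff_zero {d : ℕ} (F : Form d) (v w : Fin 4 → ℂ) :
    (restr F v w).coeff 0 = MvPolynomial.eval v F.1 := by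
  rw [Polynomial.coeff_zero_eq_eval_zero, eval_restr, zero_smul, add_zero]

open Polynomial in
theorem natDegree_restr_le {d : ℕ} (F : Form d) (v w : Fin 4 → ℂ) :
    (restr F v w).natDegree ≤ d := by
  rw [restr, F.aeval_eq_sum]
  refine natDegree_sum_le_of_forall_le _ _ fun m _ => (natDegree_smul_le _ _).trans ?_
  refine (natDegree_prod_le _ _).trans ?_
  conv_rhs => rw [← m.sum_eq]
  refine Finset.sum_le_sum fun i _ => (natDegree_pow_le).trans ?_
  have : (C (v i) + C (w i) * X).natDegree ≤ 1 := by compute_degree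
  nlinarith

open Polynomial in
theorem restr_coeff_degree {d : ℕ} (F : Form d) (v w : Fin 4 → ℂ) :
    (restr F v w).coeff d = MvPolynomial.eval w F.1 := by
  rw [restr, F.aeval_eq_sum, F.eval_eq_sum, finsetSum_coeff]
  refine Finset.sum_congr rfl fun m _ => ?_
  rw [coeff_smul, smul_eq_mul]
  congr 1
  have h1 (i : Fin 4) : (C (v i) + C (w i) * X).natDegree ≤ 1 := by compute_degree
  have h2 (i : Fin 4) : ((C (v i) + C (w i) * X) ^ m.1 i).natDegree ≤ m.1 i :=
    natDegree_pow_le.trans (by have := h1 i; nlinarith)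
  have h3 (i : Fin 4) : ((C (v i) + C (w i) * X) ^ m.1 i).coeff (m.1 i) = w i ^ m.1 i := by
    have := coeff_pow_of_natDegree_le (m := m.1 i) (h1 i)
    rw [mul_one] at this
    rw [this]
    simp
  have hd := m.sum_eq
  rw [Fin.sum_univ_four] at hd
  rw [Fin.prod_univ_four, Fin.prod_univ_four]
  refine (congrArg _ hd.symm).trans ?_
  rw [coeff_mul_add_eq_of_natDegree_le _ (h2 3), coeff_mul_add_eq_of_natDegree_le _ (h2 2),
    coeff_mul_add_eq_of_natDegree_le (h2 0) (h2 1), h3, h3, h3, h3]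
  · exact natDegree_mul_le_of_le (h2 0) (h2 1)
  · exact natDegree_mul_le_of_le (natDegree_mul_le_of_le (h2 0) (h2 1)) (h2 2)

theorem natDegree_restr {d : ℕ} {F : Form d} {v w : Fin 4 → ℂ} (hw : MvPolynomial.eval w F.1 ≠ 0) :
    (restr F v w).natDegree = d :=
  le_antisymm (natDegree_restr_le F v w)
    (Polynomial.le_natDegree_of_ne_zero (by rwa [restr_coeff_degree]))

theorem restr_ne_zero {d : ℕ} {F : Form d} {v w : Fin 4 → ℂ} (hw : MvPolynomial.eval w F.1 ≠ 0) :
    restr F v w ≠ 0 := fun h => hw (by rw [← restr_coeff_degree F v w, h, Polynomial.coeff_zero])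

theorem card_roots_restr {d : ℕ} {F : Form d} {v w : Fin 4 → ℂ}
    (hw : MvPolynomial.eval w F.1 ≠ 0) : (restr F v w).roots.card = d := by
  rw [IsAlgClosed.card_roots_eq_natDegree, natDegree_restr hw]

/-- The factorisation of a form on a line. -/
theorem eval_eq_prod_roots {d : ℕ} {F : Form d} {v w : Fin 4 → ℂ}
    (hw : MvPolynomial.eval w F.1 ≠ 0) (s t : ℂ) : MvPolynomial.eval (s • v + t • w) F.1 =
      MvPolynomial.eval w F.1 * ((restr F v w).roots.map fun β => t - β * s).prod := by
  by_cases hs : s = 0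
  · subst hs
    simp [Form.eval_smul, card_roots_restr hw, mul_comm]
  · have e : s • v + t • w = s • (v + (t / s) • w) := by
      rw [smul_add, smul_smul, mul_div_cancel₀ _ hs]
    have h1 := (IsAlgClosed.splits (restr F v w)).eq_prod_roots
    have h2 := congrArg (Polynomial.eval (t / s)) h1
    rw [eval_restr, Polynomial.eval_mul, Polynomial.eval_C, Polynomial.eval_multiset_prod,
      Multiset.map_map, Polynomial.leadingCoeff, natDegree_restr hw, restr_coeff_degree] at h2
    rw [e, Form.eval_smul, h2, mul_left_comm]
    congr 1
    have h3 : s ^ d = ((restr F v w).roots.map fun _ => s).prod := by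
      simp [card_roots_restr hw]
    rw [h3, ← Multiset.prod_map_mul]
    congr 1
    refine Multiset.map_congr rfl fun β _ => ?_
    simp only [Function.comp_apply, Polynomial.eval_sub, Polynomial.eval_X, Polynomial.eval_C]
    field_simp

-- A factor vanishes at `0` only for `γ = β`, and then equals `(b - β a) X`, a simple zero.
open Polynomial in
theorem rootMultiplicity_prod_linear (S : Multiset ℂ) (β c a b : ℂ) (hc : c ≠ 0)
    (h : b - β * a ≠ 0) :
    (S.map fun γ => C (c * (β - γ)) + C (b - γ * a) * X).prod ≠ 0 ∧
    (S.map fun γ => C (c * (β - γ)) + C (b - γ * a) * X).prod.rootMultiplicity 0 = S.count β := by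
  classical
  induction S using Multiset.induction_on with
  | empty => simp
  | cons γ S ih =>
    rw [Multiset.map_cons, Multiset.prod_cons]
    have h0 : C (c * (β - γ)) + C (b - γ * a) * X ≠ 0 := by
      intro h0
      have e0 := congrArg (fun p => p.coeff 0) h0
      have e1 := congrArg (fun p => p.coeff 1) h0
      simp [hc] at e0 e1
      rw [sub_eq_zero] at e0
      subst e0
      exact h e1
    refine ⟨mul_ne_zero h0 ih.1, ?_⟩
    rw [rootMultiplicity_mul (mul_ne_zero h0 ih.1), ih.2, Multiset.count_cons, add_comm]
    congr 1
    split_ifs with hβ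
    · subst hβ
      rw [sub_self, mul_zero, C_0, zero_add, ← sub_zero X, ← C_0,
        rootMultiplicity_mul (mul_ne_zero (C_ne_zero.2 h) (X_sub_C_ne_zero 0)), rootMultiplicity_X_sub_C_self,
        rootMultiplicity_C]
    · rw [rootMultiplicity_eq_zero]
      simp [hc, sub_eq_zero, hβ]

theorem restr_eq_prod {d : ℕ} {F : Form d} {v w : Fin 4 → ℂ} (hw : MvPolynomial.eval w F.1 ≠ 0)
    (c β a b : ℂ) : restr F (c • (v + β • w)) (a • v + b • w) =
      Polynomial.C (MvPolynomial.eval w F.1) * ((restr F v w).roots.map fun γ =>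
        Polynomial.C (c * (β - γ)) + Polynomial.C (b - γ * a) * Polynomial.X).prod := by
  refine Polynomial.funext fun t => ?_
  have e : c • (v + β • w) + t • (a • v + b • w) = (c + t * a) • v + (c * β + t * b) • w := by
    module
  rw [eval_restr, e, eval_eq_prod_roots hw, Polynomial.eval_mul, Polynomial.eval_C,
    Polynomial.eval_multiset_prod, Multiset.map_map]
  congr 3
  funext γ
  simp
  ring

/-- Neither the scaling `c` of the representative nor the second spanning vector `a • v + b • w`
matters. This neutralises the choices in `multiplicity` and `Projectivization.rep`. -/
theorem contactOrder_eq_count {d : ℕ} {F : Form d} {v w : Fin 4 → ℂ}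
    (hw : MvPolynomial.eval w F.1 ≠ 0) {c β a b : ℂ} (hc : c ≠ 0) (h : b - β * a ≠ 0) :
    contactOrder F (c • (v + β • w)) (a • v + b • w) = (restr F v w).roots.count β := by
  obtain ⟨h0, h1⟩ := rootMultiplicity_prod_linear (restr F v w).roots β c a b hc h
  change (restr F _ _).rootMultiplicity 0 = _
  rw [restr_eq_prod hw, Polynomial.rootMultiplicity_mul (mul_ne_zero (by simpa using hw) h0), h1,
    Polynomial.rootMultiplicity_C, zero_add]

/-! ### The partition of a line section -/

open Classical in
/-- The multiset of multiplicities of the elements of a multiset. -/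
noncomputable def multiplicities (S : Multiset ℂ) : Multiset ℕ := S.toFinset.val.map fun β => S.count β

theorem mem_surface_mk {d : ℕ} (F : Form d) {z : Fin 4 → ℂ} (hz : z ≠ 0) :
    Projectivization.mk ℂ z hz ∈ surface F ↔ MvPolynomial.eval z F.1 = 0 := by
  obtain ⟨a, ha⟩ := Projectivization.exists_smul_eq_mk_rep ℂ z hz
  change MvPolynomial.eval (Projectivization.mk ℂ z hz).rep F.1 = 0 ↔ _
  rw [← ha]
  change MvPolynomial.eval ((a : ℂ) • z) F.1 = 0 ↔ _
  rw [Form.eval_smul]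
  simp

theorem ne_zero_of_linearIndependent {v w : Fin 4 → ℂ} (hvw : LinearIndependent ℂ ![v, w]) (β : ℂ) :
    v + β • w ≠ 0 := by
  intro h
  have := (LinearIndependent.pair_iff.1 hvw) 1 β (by rwa [one_smul])
  exact one_ne_zero this.1

theorem linePoint_injective {v w : Fin 4 → ℂ} (hvw : LinearIndependent ℂ ![v, w]) :
    Function.Injective fun β : ℂ =>
      Projectivization.mk ℂ (v + β • w) (ne_zero_of_linearIndependent hvw β) := by
  intro β γ h
  simp only [Projectivization.mk_eq_mk_iff'] at h
  obtain ⟨a, ha⟩ := h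
  have := (LinearIndependent.pair_iff.1 hvw) (a - 1) (a * γ - β)
    (by rw [← sub_eq_zero] at ha; rw [← ha]; module)
  have h1 : a = 1 := by linear_combination this.1
  subst h1
  linear_combination -this.2

theorem points_inter_surface {d : ℕ} {F : Form d} {L : Submodule ℂ (Fin 4 → ℂ)} {v w : Fin 4 → ℂ}
    (hvw : LinearIndependent ℂ ![v, w]) (hL : L = Submodule.span ℂ {v, w})
    (hw : MvPolynomial.eval w F.1 ≠ 0) : points L ∩ surface F =
      (fun β : ℂ => Projectivization.mk ℂ (v + β • w) (ne_zero_of_linearIndependent hvw β)) ''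
        ((restr F v w).roots.toFinset : Set ℂ) := by
  ext p
  induction p using Projectivization.ind with | h z hz
  have hp : Projectivization.mk ℂ z hz ∈ points L ↔ z ∈ L := by
    change (Projectivization.mk ℂ z hz).submodule ≤ L ↔ _
    rw [Projectivization.submodule_mk, Submodule.span_singleton_le_iff_mem]
  rw [Set.mem_inter_iff, hp, mem_surface_mk, hL, Submodule.mem_span_pair]
  constructor
  · rintro ⟨⟨a, b, rfl⟩, hF⟩
    have ha : a ≠ 0 := by
      rintro rfl
      rw [zero_smul, zero_add, Form.eval_smul] at hF
      refine (mul_ne_zero (pow_ne_zero _ ?_) hw) hF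
      rintro rfl
      simp at hz
    refine ⟨b / a, ?_, ?_⟩
    · simp only [Finset.mem_coe, Multiset.mem_toFinset]
      rw [Polynomial.mem_roots (restr_ne_zero hw), Polynomial.IsRoot.def, eval_restr]
      have e : a • v + b • w = a • (v + (b / a) • w) := by
        rw [smul_add, smul_smul, mul_div_cancel₀ _ ha]
      rw [e, Form.eval_smul] at hF
      exact (mul_eq_zero.1 hF).resolve_left (pow_ne_zero _ ha)
    · simp only [Projectivization.mk_eq_mk_iff']
      refine ⟨a⁻¹, ?_⟩
      rw [smul_add, smul_smul, smul_smul, inv_mul_cancel₀ ha, one_smul, div_eq_inv_mul]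
  · rintro ⟨β, hβ, h⟩
    simp only [Finset.mem_coe, Multiset.mem_toFinset] at hβ
    rw [Polynomial.mem_roots (restr_ne_zero hw), Polynomial.IsRoot.def, eval_restr] at hβ
    obtain ⟨a, ha⟩ := (Projectivization.mk_eq_mk_iff' _ _ _ _ _).1 h.symm
    rw [← ha]
    refine ⟨⟨a, a * β, by rw [smul_add, smul_smul]⟩, ?_⟩
    rw [Form.eval_smul, hβ, mul_zero]

theorem alpha_eq {d : ℕ} {F : Form d} {L : Submodule ℂ (Fin 4 → ℂ)} {v w : Fin 4 → ℂ}
    (hvw : LinearIndependent ℂ ![v, w]) (hL : L = Submodule.span ℂ {v, w})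
    (hw : MvPolynomial.eval w F.1 ≠ 0) : alpha F L = multiplicities (restr F v w).roots := by
  classical
  have hS := points_inter_surface hvw hL hw
  have hfin : (points L ∩ surface F).Finite := hS ▸ ((Finset.finite_toSet _).image _)
  rw [alpha, dif_pos hfin]
  have e : hfin.toFinset = (restr F v w).roots.toFinset.map ⟨_, linePoint_injective hvw⟩ := by
    apply Finset.coe_injective
    rw [Set.Finite.coe_toFinset, hS, Finset.coe_map]
    rfl
  rw [e, Finset.map_val, Multiset.map_map, multiplicities]
  refine Multiset.map_congr (by congr!) fun β _ => ?_
  simp only [Function.comp_apply, Function.Embedding.coeFn_mk]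
  set p := Projectivization.mk ℂ (v + β • w) (ne_zero_of_linearIndependent hvw β) with hp
  -- The vector `w` is not proportional to `v + β w`, so `multiplicity` does not take its default
  -- value `0`.
  have hex : ∃ w' : Fin 4 → ℂ, w' ∈ L ∧ w' ∉ p.submodule := by
    refine ⟨w, hL ▸ Submodule.subset_span (by simp), fun h => ?_⟩
    rw [hp, Projectivization.submodule_mk, Submodule.mem_span_singleton] at h
    obtain ⟨a, ha⟩ := h
    have := (LinearIndependent.pair_iff.1 hvw) a (a * β - 1)
      (by rw [← sub_eq_zero] at ha; rw [← ha]; module)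
    rw [this.1] at this
    simp at this
  rw [multiplicity, dif_pos hex]
  obtain ⟨h1, h2⟩ := hex.choose_spec
  obtain ⟨a, b, hab⟩ := Submodule.mem_span_pair.1 (hL.le h1)
  obtain ⟨c, hc⟩ := Projectivization.exists_smul_eq_mk_rep ℂ (v + β • w)
    (ne_zero_of_linearIndependent hvw β)
  rw [← hp] at hc
  rw [← hab, ← hc]
  have hmem (x : Fin 4 → ℂ) : x ∈ p.submodule ↔ ∃ a : ℂ, a • (v + β • w) = x := by
    rw [hp, Projectivization.submodule_mk, Submodule.mem_span_singleton]
  have hba : b - β * a ≠ 0 := by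
    refine fun h => h2 ((hmem _).2 ⟨a, ?_⟩)
    rw [← hab, sub_eq_zero.1 h]
    module
  exact contactOrder_eq_count hw c.ne_zero hba

end Twistor

namespace Twistor

/-! ### Partitions with small excess -/

section multiplicities

open Classical

/-- The multiple elements of a multiset. -/
noncomputable def multiple (S : Multiset ℂ) : Finset ℂ := S.toFinset.filter fun a => 2 ≤ S.count a

theorem mem_multiple {S : Multiset ℂ} {a : ℂ} : a ∈ multiple S ↔ 2 ≤ S.count a := by
  rw [multiple, Finset.mem_filter, Multiset.mem_toFinset, ← Multiset.count_pos]
  exact ⟨fun h => h.2, fun h => ⟨by omega, h⟩⟩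

/-- Elements that are not multiple contribute ones, and the cardinality determines how many. -/
theorem multiplicities_eq (S : Multiset ℂ) : multiplicities S =
    (multiple S).val.map (fun a => S.count a) +
      Multiset.replicate (S.card - ∑ a ∈ multiple S, S.count a) 1 := by
  set T := S.toFinset.filter fun a => ¬ 2 ≤ S.count a with hT
  have hT1 (a : ℂ) (ha : a ∈ T) : S.count a = 1 := by
    rw [hT, Finset.mem_filter, Multiset.mem_toFinset, ← Multiset.count_pos] at ha
    omega
  have h1 : multiplicities S = (multiple S).val.map (fun a => S.count a) +
      T.val.map (fun a => S.count a) := by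
    rw [multiplicities, ← Multiset.map_add, multiple, hT, Finset.filter_val, Finset.filter_val,
      Multiset.filter_add_not]
  have h2 : T.val.map (fun a => S.count a) = Multiset.replicate T.card 1 := by
    rw [Multiset.eq_replicate]
    refine ⟨by simp, fun n hn => ?_⟩
    obtain ⟨a, ha, rfl⟩ := Multiset.mem_map.1 hn
    exact hT1 a ha
  have h3 : S.card = (∑ a ∈ multiple S, S.count a) + T.card := by
    rw [← Multiset.toFinset_sum_count_eq, ← Finset.sum_filter_add_sum_filter_not _
      (fun a => 2 ≤ S.count a), ← hT, Finset.sum_congr rfl hT1]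
    simp [multiple]
  rw [h1, h2, h3, Nat.add_sub_cancel_left]

theorem card_multiple (S : Multiset ℂ) :
    (multiple S).card = (multiplicities S).countP (fun n => 2 ≤ n) := by
  rw [multiplicities, Multiset.countP_map, multiple, Finset.card_def, Finset.filter_val]

theorem nodup_iff_multiple_eq_empty {S : Multiset ℂ} : S.Nodup ↔ multiple S = ∅ := by
  rw [Multiset.nodup_iff_count_le_one, Finset.eq_empty_iff_forall_notMem]
  refine forall_congr' fun a => ?_
  rw [mem_multiple]
  omega

theorem multiplicities_eq_replicate_iff {S : Multiset ℂ} {d : ℕ} (hS : S.card = d) :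
    multiplicities S = Multiset.replicate d 1 ↔ S.Nodup := by
  rw [nodup_iff_multiple_eq_empty]
  constructor
  · intro h
    rw [← Finset.card_eq_zero, card_multiple, h]
    simp [Multiset.countP_eq_zero, Multiset.mem_replicate]
  · intro h
    rw [multiplicities_eq, h]
    simp [hS]

theorem exists_of_multiplicities_eq_two {S : Multiset ℂ} {k : ℕ}
    (h : multiplicities S = {2} + Multiset.replicate k 1) :
    ∃ a, S.count a = 2 ∧ ∀ b, b ≠ a → S.count b ≤ 1 := by
  have h1 : (multiple S).card = 1 := by
    rw [card_multiple, h, Multiset.countP_add]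
    have : Multiset.countP (fun n => 2 ≤ n) (Multiset.replicate k 1) = 0 := by
      simp [Multiset.countP_eq_zero, Multiset.mem_replicate]
    rw [this]
    rfl
  obtain ⟨a, ha⟩ := Finset.card_eq_one.1 h1
  have h2 : 2 ∈ multiplicities S := by rw [h]; simp
  rw [multiplicities, Multiset.mem_map] at h2
  obtain ⟨c, -, hc⟩ := h2
  have hca : c ∈ multiple S := mem_multiple.2 hc.ge
  rw [ha, Finset.mem_singleton] at hca
  subst hca
  refine ⟨c, hc, fun b hb => ?_⟩
  by_contra! hlt
  have : b ∈ multiple S := mem_multiple.2 hlt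
  rw [ha, Finset.mem_singleton] at this
  exact hb this

theorem exists_of_multiplicities_eq_two_two {S : Multiset ℂ} {k : ℕ}
    (h : multiplicities S = {2, 2} + Multiset.replicate k 1) :
    ∃ a b, a ≠ b ∧ 2 ≤ S.count a ∧ 2 ≤ S.count b := by
  have h1 : (multiple S).card = 2 := by
    rw [card_multiple, h, Multiset.countP_add]
    have : Multiset.countP (fun n => 2 ≤ n) (Multiset.replicate k 1) = 0 := by
      simp [Multiset.countP_eq_zero, Multiset.mem_replicate]
    rw [this]
    rfl
  obtain ⟨a, b, hab, h2⟩ := Finset.card_eq_two.1 h1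
  exact ⟨a, b, hab, mem_multiple.1 (by simp [h2]), mem_multiple.1 (by simp [h2])⟩

theorem exists_of_multiplicities_eq_three {S : Multiset ℂ} {k : ℕ}
    (h : multiplicities S = {3} + Multiset.replicate k 1) : ∃ a, 3 ≤ S.count a := by
  have h2 : 3 ∈ multiplicities S := by rw [h]; simp
  rw [multiplicities, Multiset.mem_map] at h2
  obtain ⟨c, -, hc⟩ := h2
  exact ⟨c, hc.ge⟩

theorem multiplicities_cases {S : Multiset ℂ} {d : ℕ} (hS : S.card = d)
    (h4 : ∀ a, S.count a < 4) (h32 : ∀ a b, a ≠ b → 3 ≤ S.count a → ¬ 2 ≤ S.count b)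
    (h222 : ∀ a b c, a ≠ b → a ≠ c → b ≠ c → 2 ≤ S.count a → 2 ≤ S.count b → ¬ 2 ≤ S.count c) :
    multiplicities S = Multiset.replicate d 1 ∨
    multiplicities S = {2} + Multiset.replicate (d - 2) 1 ∨
    multiplicities S = {2, 2} + Multiset.replicate (d - 4) 1 ∨
    multiplicities S = {3} + Multiset.replicate (d - 3) 1 := by
  have hle : (multiple S).card ≤ 2 := by
    by_contra! hlt
    obtain ⟨a, ha, b, hb, c, hc, hab, hac, hbc⟩ := Finset.two_lt_card.1 hlt
    exact h222 a b c hab hac hbc (mem_multiple.1 ha) (mem_multiple.1 hb) (mem_multiple.1 hc)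
  have hcases : (multiple S).card = 0 ∨ (multiple S).card = 1 ∨ (multiple S).card = 2 := by omega
  rcases hcases with h | h | h
  · left
    rw [multiplicities_eq_replicate_iff hS, nodup_iff_multiple_eq_empty]
    exact Finset.card_eq_zero.1 h
  · obtain ⟨a, ha⟩ := Finset.card_eq_one.1 h
    have h2 : 2 ≤ S.count a := mem_multiple.1 (by simp [ha])
    have := h4 a
    have e := multiplicities_eq S
    rw [ha] at e
    simp only [Finset.singleton_val, Multiset.map_singleton, Finset.sum_singleton, hS] at e
    have h23 : S.count a = 2 ∨ S.count a = 3 := by omega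
    rcases h23 with h2 | h3
    · rw [h2] at e; exact Or.inr (Or.inl e)
    · rw [h3] at e; exact Or.inr (Or.inr (Or.inr e))
  · obtain ⟨a, b, hab, hS2⟩ := Finset.card_eq_two.1 h
    have ha : 2 ≤ S.count a := mem_multiple.1 (by simp [hS2])
    have hb : 2 ≤ S.count b := mem_multiple.1 (by simp [hS2])
    have ha' : S.count a = 2 := by
      by_contra! h3
      exact h32 a b hab (by omega) hb
    have hb' : S.count b = 2 := by
      by_contra! h3
      exact h32 b a hab.symm (by omega) ha
    have e := multiplicities_eq S
    rw [hS2] at e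
    rw [Finset.sum_pair hab, ha', hb', hS] at e
    right; right; left
    rw [e]
    congr 1
    rw [Finset.insert_val_of_notMem (by simpa using hab)]
    simp [ha', hb']

end multiplicities

/-! ### Twistor lines -/

theorem lineMap_injective {p : Fin 2 → ℍ[ℝ]} (hp : p ≠ 0) : Function.Injective (lineMap p) := by
  rw [← LinearMap.ker_eq_bot, LinearMap.ker_eq_bot']
  intro c hc
  have h1 := toQuat_lineMap p c
  rw [hc, toQuat_zero, eq_comm, smul_eq_zero] at h1
  have h2 : quat (c 0) (c 1) = quat 0 0 := (h1.resolve_right hp).trans (by ext <;> simp [quat])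
  obtain ⟨h3, h4⟩ := quat_inj h2
  funext i
  fin_cases i <;> assumption

theorem linearIndependent_lineMap {p : Fin 2 → ℍ[ℝ]} (hp : p ≠ 0) (b : ℂ) :
    LinearIndependent ℂ ![lineMap p ![0, 1], lineMap p ![1, b]] := by
  rw [LinearIndependent.pair_iff]
  intro s t h
  rw [← map_smul, ← map_smul, ← map_add, ← map_zero (lineMap p)] at h
  have h1 := lineMap_injective hp h
  have e0 := congrFun h1 0
  have e1 := congrFun h1 1
  simp at e0 e1
  subst e0
  simpa using e1

theorem hopf_symm_eq {p : Fin 2 → ℍ[ℝ]} (hp : p ≠ 0) {q : S4} (h : sphereVec p = q.1) :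
    hopf.symm q = Projectivization.mk ℍ[ℝ] p hp := by
  rw [Equiv.symm_apply_eq]
  exact Subtype.ext h.symm

theorem mem_twistorLine_iff {p : Fin 2 → ℍ[ℝ]} (hp : p ≠ 0) {q : S4} (h : sphereVec p = q.1)
    (z : Fin 4 → ℂ) : z ∈ twistorLine q ↔ ∃ c, lineMap p c = z := by
  change toQuat z ∈ (hopf.symm q).submodule ↔ _
  rw [hopf_symm_eq hp h, Projectivization.submodule_mk, Submodule.mem_span_singleton]
  constructor
  · rintro ⟨a, ha⟩
    refine ⟨![⟨a.re, a.imI⟩, ⟨a.imJ, a.imK⟩], toQuat_injective ?_⟩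
    rw [toQuat_lineMap, ← ha]
    congr 1
  · rintro ⟨c, rfl⟩
    exact ⟨_, (toQuat_lineMap p c).symm⟩

theorem lineMap_eq_smul_add (p : Fin 2 → ℍ[ℝ]) (b : ℂ) (c : Fin 2 → ℂ) : lineMap p c =
    (c 1 - b * c 0) • lineMap p ![0, 1] + c 0 • lineMap p ![1, b] := by
  rw [← map_smul, ← map_smul, ← map_add]
  congr 1
  funext i
  fin_cases i
  · simp
  · simp; ring

theorem twistorLine_eq_span {p : Fin 2 → ℍ[ℝ]} (hp : p ≠ 0) {q : S4} (h : sphereVec p = q.1)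
    (b : ℂ) : twistorLine q = Submodule.span ℂ {lineMap p ![0, 1], lineMap p ![1, b]} := by
  ext z
  rw [mem_twistorLine_iff hp h, Submodule.mem_span_pair]
  constructor
  · rintro ⟨c, rfl⟩
    exact ⟨_, _, (lineMap_eq_smul_add p b c).symm⟩
  · rintro ⟨s, t, rfl⟩
    exact ⟨s • ![0, 1] + t • ![1, b], by rw [map_add, map_smul, map_smul]⟩

theorem infinity_ne_zero : (![0, 1] : Fin 2 → ℍ[ℝ]) ≠ 0 := fun h => one_ne_zero (congrFun h 1)

theorem affine_ne_zero (r : ℍ[ℝ]) : (![1, r] : Fin 2 → ℍ[ℝ]) ≠ 0 :=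
  fun h => one_ne_zero (congrFun h 0)

theorem sphereVec_cases (q : S4) :
    (∃ r, sphereVec ![1, toH r] = q.1) ∨ sphereVec ![0, 1] = q.1 := by
  obtain ⟨x, rfl⟩ := toSphere_surjective q
  induction x using Projectivization.ind with | h p hp
  change (∃ r, sphereVec ![1, toH r] = sphereVec p) ∨ sphereVec ![0, 1] = sphereVec p
  by_cases h0 : p 0 = 0
  · right
    have h1 : p 1 ≠ 0 := fun h1 => hp (by funext i; fin_cases i <;> assumption)
    rw [← sphereVec_smul (inv_ne_zero h1) p]
    congr 1
    funext i
    fin_cases i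
    · simp [h0]
    · simp [h1]
  · left
    have e : ∃ r, toH r = (p 0)⁻¹ * p 1 :=
      ⟨![((p 0)⁻¹ * p 1).re, ((p 0)⁻¹ * p 1).imI, ((p 0)⁻¹ * p 1).imJ, ((p 0)⁻¹ * p 1).imK], by
        ext <;> simp [toH]⟩
    obtain ⟨r, hr⟩ := e
    refine ⟨r, ?_⟩
    rw [← sphereVec_smul (inv_ne_zero h0) p, hr]
    congr 1
    funext i
    fin_cases i
    · simp [h0]
    · simp

theorem alpha_twistorLine {d : ℕ} {F : Form d} {p : Fin 2 → ℍ[ℝ]} (hp : p ≠ 0) {q : S4}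
    (h : sphereVec p = q.1) {b : ℂ} (hb : MvPolynomial.eval (lineMap p ![1, b]) F.1 ≠ 0) :
    alpha F (twistorLine q) = multiplicities (chart F p b).roots :=
  alpha_eq (linearIndependent_lineMap hp b) (twistorLine_eq_span hp h b) hb

/-- A binary form of degree `d` with `d + 1` zeros on a projective line is identically zero. Hence
the slopes `0, …, d` always provide a chart whose point at infinity is off the surface, unless the
line lies in it. -/
theorem exists_chart_or_zero {d : ℕ} (F : Form d) (p : Fin 2 → ℍ[ℝ]) :
    (∃ n : Fin (d + 1), MvPolynomial.eval (lineMap p ![1, ((n : ℕ) : ℂ)]) F.1 ≠ 0) ∨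
      ∀ c, MvPolynomial.eval (lineMap p c) F.1 = 0 := by
  by_contra! hcon
  obtain ⟨hn, c, hc⟩ := hcon
  have h0 : restr F (lineMap p ![1, 0]) (lineMap p ![0, 1]) = 0 := by
    by_contra hne
    have hcard : ((Finset.univ : Finset (Fin (d + 1))).image fun n : Fin (d + 1) => ((n : ℕ) : ℂ)).card = d + 1 := by
      rw [Finset.card_image_of_injective]
      · simp
      · intro m n hmn
        exact Fin.ext (Nat.cast_injective (R := ℂ) hmn)
    have hle : ((Finset.univ : Finset (Fin (d + 1))).image fun n : Fin (d + 1) => ((n : ℕ) : ℂ)).card ≤ d := by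
      refine (Polynomial.card_le_degree_of_subset_roots (p := restr F (lineMap p ![1, 0])
        (lineMap p ![0, 1])) ?_).trans (natDegree_restr_le _ _ _)
      intro x hx
      obtain ⟨n, -, rfl⟩ := Finset.mem_image.1 (Finset.mem_def.2 hx)
      rw [Polynomial.mem_roots hne, Polynomial.IsRoot.def, eval_restr]
      refine Eq.trans ?_ (hn n)
      rw [← map_smul, ← map_add]
      congr 2
      simp
    omega
  refine hc ?_
  by_cases hc0 : c 0 = 0
  · have e : lineMap p c = c 1 • lineMap p ![0, 1] := by
      rw [lineMap_eq_smul_add p 0 c, hc0]; simp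
    rw [e, Form.eval_smul, ← restr_coeff_degree F (lineMap p ![1, 0]), h0]
    simp
  · have e : lineMap p c = c 0 • (lineMap p ![1, 0] + (c 1 / c 0) • lineMap p ![0, 1]) := by
      rw [← map_smul, ← map_add, ← map_smul]
      congr 1
      funext i
      fin_cases i
      · simp
      · simp [mul_div_cancel₀ _ hc0]
    rw [e, Form.eval_smul, ← eval_restr, h0]
    simp

theorem chart_eq_zero {d : ℕ} {F : Form d} {p : Fin 2 → ℍ[ℝ]}
    (h : ∀ c, MvPolynomial.eval (lineMap p c) F.1 = 0) (b : ℂ) : chart F p b = 0 := by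
  refine Polynomial.funext fun t => ?_
  rw [chart, eval_restr, ← map_smul, ← map_add, h, Polynomial.eval_zero]

/-! ### Singular points -/

theorem prod_pow_single {A : Type*} [CommSemiring A] (f : Fin 4 → A) (k l : Fin 4) (n : ℕ) :
    ∏ i, f i ^ (Finsupp.single k n + Finsupp.single l 1 : Fin 4 →₀ ℕ) i = f k ^ n * f l := by
  simp only [Finsupp.add_apply, pow_add, Finset.prod_mul_distrib]
  rw [Finset.prod_eq_single k, Finset.prod_eq_single l]
  · simp
  · intro i _ hi; simp [hi]
  · simp
  · intro i _ hi; simp [hi]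
  · simp

open Polynomial in
/-- The derivative of a form in the direction `h` vanishes at `z`. -/
theorem restr_coeff_one {d : ℕ} (F : Form d) (z h : Fin 4 → ℂ) : (restr F z h).coeff 1 =
    ∑ m : Exponent d, (∏ i, (C (z i) + C (h i) * X) ^ m.1 i).coeff 1 * MvPolynomial.coeff m.1 F.1 := by
  rw [restr, F.aeval_eq_sum, finsetSum_coeff]
  refine Finset.sum_congr rfl fun m _ => ?_
  rw [coeff_smul, smul_eq_mul, mul_comm]

theorem restr_shear {d : ℕ} (b : ℂ) (F : Form d) (z h : Fin 4 → ℂ) : restr (shear b F) z h =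
    restr F ![z 0, z 1 + b * z 0, z 2, z 3 + b * z 2] ![h 0, h 1 + b * h 0, h 2, h 3 + b * h 2] := by
  rw [restr, aeval_shear, restr]
  congr 2
  funext i
  fin_cases i <;> simp <;> ring

theorem restr_smul {d : ℕ} (F : Form d) (c : ℂ) (z h : Fin 4 → ℂ) :
    restr F (c • z) (c • h) = Polynomial.C (c ^ d) * restr F z h := by
  refine Polynomial.funext fun t => ?_
  have e : c • z + t • c • h = c • (z + t • h) := by module
  rw [eval_restr, Polynomial.eval_mul, eval_restr, Polynomial.eval_C, e, Form.eval_smul]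

/-- The generic point of the affine chart `z₁ = 1`. -/
noncomputable def univPoint : Fin 4 → MvPolynomial (Fin 3 ⊕ Fin 3) ℂ :=
  let t (i : Fin 3) : MvPolynomial (Fin 3 ⊕ Fin 3) ℂ :=
    MvPolynomial.X (.inl i) + MvPolynomial.C Complex.I * MvPolynomial.X (.inr i)
  ![t 0, 1, t 1, t 2]

open Polynomial in
/-- The partial derivatives of a monomial at the generic point. -/
noncomputable def univDeriv {d : ℕ} (l : Fin 4) (m : Exponent d) : MvPolynomial (Fin 3 ⊕ Fin 3) ℂ :=
  (∏ i, (C (univPoint i) + C ((Pi.single l 1 : Fin 4 → MvPolynomial (Fin 3 ⊕ Fin 3) ℂ) i) * X :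
    (MvPolynomial (Fin 3 ⊕ Fin 3) ℂ)[X]) ^ m.1 i).coeff 1

/-- Three complex parameters for the point, after a shear and scaling to `z₁ = 1`, against four
complex conditions. The open set `z₁ ≠ b z₀` suffices, since tangency points seen in the chart of
slope `b` lie in it. -/
theorem forGeneral_nonsingular {d : ℕ} (hd : 1 ≤ d) (b : ℂ) : ForGeneral d fun F =>
    ∀ z : Fin 4 → ℂ, z 1 - b * z 0 ≠ 0 → MvPolynomial.eval z F.1 = 0 →
      ∃ h, (restr F z h).coeff 1 ≠ 0 := by
  let J (k : Fin 4) : Exponent d := ⟨Finsupp.single 1 (d - 1) + Finsupp.single k 1, by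
    rw [map_add, Finsupp.degree_single, Finsupp.degree_single]; omega⟩
  have hJ : Function.Injective J := by
    intro k l hkl
    have h1 : (Finsupp.single 1 (d - 1) + Finsupp.single k 1 : Fin 4 →₀ ℕ) =
      Finsupp.single 1 (d - 1) + Finsupp.single l 1 := congrArg Subtype.val hkl
    exact Finsupp.single_left_injective one_ne_zero (add_left_cancel h1)
  -- The conditions are the derivatives `∂₀, ∂₂, ∂₃` and, in place of `∂₁`, the combination `F -
  -- z₀∂₀F - z₂∂₂F - z₃∂₃F`. On the monomials `z₁ ^ (d - 1) * z_k` at `z₁ = 1` these four give the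
  -- identity matrix.
  let lam (l : Fin 4) (m : Exponent d) : MvPolynomial (Fin 3 ⊕ Fin 3) ℂ :=
    if l = 1 then ∏ i, univPoint i ^ m.1 i - (univPoint 0 * univDeriv 0 m +
      univPoint 2 * univDeriv 2 m + univPoint 3 * univDeriv 3 m) else univDeriv l m
  have hD (l k : Fin 4) (hl : l ≠ 1) : univDeriv l (J k) = if l = k then 1 else 0 := by
    rw [univDeriv]
    change (∏ i, (Polynomial.C (univPoint i) + Polynomial.C
      ((Pi.single l 1 : Fin 4 → MvPolynomial (Fin 3 ⊕ Fin 3) ℂ) i) * Polynomial.X :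
        Polynomial (MvPolynomial (Fin 3 ⊕ Fin 3) ℂ)) ^ (Finsupp.single 1 (d - 1) + Finsupp.single k 1 : Fin 4 →₀ ℕ) i).coeff 1 = _
    rw [prod_pow_single]
    have h1 : univPoint 1 = 1 := rfl
    rw [h1, Pi.single_eq_of_ne hl.symm]
    simp only [map_one, map_zero, zero_mul, add_zero, one_pow, one_mul, Polynomial.coeff_add,
      Polynomial.coeff_C_mul, Polynomial.coeff_X_one, mul_one]
    rw [Polynomial.coeff_C_of_ne_zero one_ne_zero, zero_add, Pi.single_apply]
    simp only [eq_comm]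
  have hlam (l k : Fin 4) : lam l (J k) = if l = k then 1 else 0 := by
    by_cases hl : l = 1
    · simp only [lam, if_pos hl]
      change ∏ i, univPoint i ^ (Finsupp.single 1 (d - 1) + Finsupp.single k 1 : Fin 4 →₀ ℕ) i - _
        = _
      rw [prod_pow_single, hD 0 k (by decide), hD 2 k (by decide), hD 3 k (by decide), hl]
      have h1 : univPoint 1 = 1 := rfl
      rw [h1]
      fin_cases k <;> simp [h1]
    · simp only [lam, if_neg hl, hD l k hl]
  refine ((forGeneral_empty_of_linear J hJ lam hlam (by simp)).comp (shear b)
    (shear_surjective b)).mono fun F hF z hz hFz => ?_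
  by_contra! hsing
  set c := z 1 - b * z 0 with hc
  set y : Fin 4 → ℂ := ![z 0 / c, 1, z 2 / c, (z 3 - b * z 2) / c] with hy
  have hyz : c • ![y 0, y 1 + b * y 0, y 2, y 3 + b * y 2] = z := by
    funext i
    fin_cases i <;> simp [hy] <;> field_simp
    · rw [hc]; ring
    · ring
  have hG0 : MvPolynomial.eval y (shear b F).1 = 0 := by
    rw [← restr_coeff_zero _ y 0, restr_shear, restr_coeff_zero]
    rw [← hyz, Form.eval_smul] at hFz
    exact (mul_eq_zero.1 hFz).resolve_left (pow_ne_zero _ hz)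
  have hG1 (h : Fin 4 → ℂ) : (restr (shear b F) y h).coeff 1 = 0 := by
    have h1 := hsing (c • ![h 0, h 1 + b * h 0, h 2, h 3 + b * h 2])
    rw [← hyz, restr_smul, Polynomial.coeff_C_mul] at h1
    rw [restr_shear]
    exact (mul_eq_zero.1 h1).resolve_left (pow_ne_zero _ hz)
  set θ : Fin 3 ⊕ Fin 3 → ℝ := Sum.elim ![(y 0).re, (y 2).re, (y 3).re]
    ![(y 0).im, (y 2).im, (y 3).im] with hθ
  have hpt (i : Fin 4) : evReal θ (univPoint i) = y i := by
    have hX (s) : evReal θ (MvPolynomial.X s) = θ s := MvPolynomial.aeval_X _ _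
    have hC (x : ℂ) : evReal θ (MvPolynomial.C x) = x := (evReal θ).commutes x
    have hri (x : ℂ) : (x.re : ℂ) + Complex.I * x.im = x := by
      rw [mul_comm]; exact Complex.re_add_im x
    fin_cases i
    · simp only [univPoint]
      simp [hX, hC]
      simp [hθ, hri]
    · simp [univPoint, hy]
    · simp only [univPoint]
      simp [hX, hC]
      simp [hθ, hri]
    · simp only [univPoint]
      simp [hX, hC]
      simp [hθ, hri]
  have hDz (l : Fin 4) : ∑ m : Exponent d, evReal θ (univDeriv l m) *
      MvPolynomial.coeff m.1 (shear b F).1 = 0 := by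
    rw [← hG1 (Pi.single l 1), restr_coeff_one]
    refine Finset.sum_congr rfl fun m _ => ?_
    congr 1
    rw [univDeriv]
    refine (Polynomial.coeff_map (evReal θ).toRingHom 1).symm.trans ?_
    rw [Polynomial.map_prod]
    refine congrArg (fun P : Polynomial ℂ => P.coeff 1) ?_
    refine Finset.prod_congr rfl fun i _ => ?_
    simp [hpt]
    congr 4
    by_cases hil : i = l
    · subst hil; simp
    · simp [hil]
  refine hF θ fun l => ?_
  simp only [← evReal_eq, lam]
  split_ifs with hl
  · have e (m : Exponent d) : evReal θ (∏ i, univPoint i ^ m.1 i - (univPoint 0 * univDeriv 0 m +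
        univPoint 2 * univDeriv 2 m + univPoint 3 * univDeriv 3 m)) *
        MvPolynomial.coeff m.1 (shear b F).1 =
        MvPolynomial.coeff m.1 (shear b F).1 * ∏ i, y i ^ m.1 i -
        (y 0 * (evReal θ (univDeriv 0 m) * MvPolynomial.coeff m.1 (shear b F).1) +
        y 2 * (evReal θ (univDeriv 2 m) * MvPolynomial.coeff m.1 (shear b F).1) +
        y 3 * (evReal θ (univDeriv 3 m) * MvPolynomial.coeff m.1 (shear b F).1)) := by
      rw [map_sub, map_add, map_add, map_mul, map_mul, map_mul, map_prod]
      simp only [map_pow, hpt]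
      ring
    rw [Finset.sum_congr rfl fun m _ => e m, Finset.sum_sub_distrib, Finset.sum_add_distrib,
      Finset.sum_add_distrib, ← Finset.mul_sum, ← Finset.mul_sum, ← Finset.mul_sum, hDz, hDz, hDz,
      ← Form.eval_eq_sum, hG0]
    ring
  · exact hDz l

end Twistor

namespace Twistor

open Polynomial

/-! ### The discriminant of polynomials of bounded degree -/

/-- Multiplicativity of the resultant, with `m` and `n` only upper bounds for the degrees: the
polynomials used below may have a vanishing top coefficient. -/
theorem resultant_X_sub_C_mul {R : Type*} [CommRing R] [Nontrivial R] (a : R) (k g : R[X]) {m n : ℕ}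
    (hk : k.natDegree ≤ m) (hg : g.natDegree ≤ n) :
    resultant ((X - C a) * k) g (m + 1) n = g.eval a * resultant k g m n := by
  by_cases hk0 : k = 0
  · subst hk0
    rw [mul_zero, resultant_zero_left, resultant_zero_left]
    cases n with
    | zero =>
      rw [eq_C_of_natDegree_le_zero hg]
      simp
      ring
    | succ n => simp
  obtain ⟨j, rfl⟩ := Nat.exists_eq_add_of_le hk
  have h1 := resultant_mul_left (X - C a) k g n hg
  rw [natDegree_X_sub_C, resultant_X_sub_C_left _ _ _ hg] at h1
  have h2 : ((X - C a) * k).natDegree = 1 + k.natDegree := by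
    rw [(monic_X_sub_C a).natDegree_mul' hk0, natDegree_X_sub_C]
  rw [show k.natDegree + j + 1 = 1 + k.natDegree + j by ring,
    resultant_add_left_deg _ _ _ _ _ h2.le, h1, resultant_add_left_deg _ _ _ _ _ le_rfl]
  ring

/-- The resultant of a polynomial of degree at most `d` and its derivative. -/
noncomputable def disc {R : Type*} [CommRing R] (d : ℕ) (p : R[X]) : R :=
  resultant p (derivative p) d (d - 1)

theorem disc_map {R S : Type*} [CommRing R] [CommRing S] (f : R →+* S) (d : ℕ) (p : R[X]) :
    disc d (p.map f) = f (disc d p) := by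
  rw [disc, derivative_map, resultant_map_map, disc]

/-- Both formal leading coefficients vanish. So `disc` also vanishes when the point at infinity of a
chart lies on the surface, and a nonzero value certifies a usable chart. -/
theorem disc_eq_zero_of_lt {d : ℕ} {p : ℂ[X]} (hd : 2 ≤ d) (hp : p.natDegree < d) :
    disc d p = 0 := by
  refine resultant_eq_zero_of_lt_lt _ _ _ _ hp ?_
  have := natDegree_derivative_le p
  omega

theorem disc_eq_zero_iff {d : ℕ} {p : ℂ[X]} (hd : 1 ≤ d) (hp : p.natDegree = d) :
    disc d p = 0 ↔ ¬ p.roots.Nodup := by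
  have hp0 : p ≠ 0 := by rintro rfl; simp at hp; omega
  have h1 : (derivative p).natDegree = d - 1 := by rw [natDegree_derivative, hp]
  rw [disc, ← h1, ← hp, resultant_eq_zero_iff, nodup_roots_iff_of_splits hp0
    (IsAlgClosed.splits p)]
  exact ⟨fun h => h.2, fun h => ⟨Or.inl hp0, h⟩⟩

/-- The pencil `p + Y q`. -/
noncomputable def pencil (p q : ℂ[X]) : ℂ[X][X] := p.map C + C X * q.map C

theorem natDegree_pencil_le {p q : ℂ[X]} {d : ℕ} (hp : p.natDegree ≤ d) (hq : q.natDegree ≤ d) :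
    (pencil p q).natDegree ≤ d := by
  refine (natDegree_add_le _ _).trans (max_le ?_ ?_)
  · exact natDegree_map_le.trans hp
  · refine (natDegree_C_mul_le _ _).trans (natDegree_map_le.trans hq)

theorem pencil_X_sub_C_mul (a : ℂ) (p q : ℂ[X]) : pencil ((X - C a) * p) ((X - C a) * q) =
    (X - C (C a)) * pencil p q := by
  simp only [pencil, Polynomial.map_mul, Polynomial.map_sub, map_X, map_C]
  ring

theorem map_eval_zero_pencil (p q : ℂ[X]) : (pencil p q).map (evalRingHom 0) = p := by
  rw [pencil, Polynomial.map_add, Polynomial.map_mul, map_map, map_map, map_C]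
  have : (evalRingHom (0 : ℂ)).comp C = RingHom.id ℂ := by ext; simp
  rw [this]
  simp

/-- Factor `P = (X - a) P₁`. The resultant of `P` and `P'` is `P'(a) = Y q(a)` times the resultant
of `P₁` and `P'`. The second factor vanishes at `Y = 0`, where both polynomials have the root `a`;
so the product is divisible by `Y²`. -/
theorem coeff_one_disc_pencil_of_root {d : ℕ} (hd : 2 ≤ d) {a : ℂ} {h q : ℂ[X]}
    (hh : ((X - C a) * ((X - C a) * h)).natDegree ≤ d) (hq : ((X - C a) * q).natDegree ≤ d) :
    (disc d (pencil ((X - C a) * ((X - C a) * h)) ((X - C a) * q))).coeff 1 = 0 := by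
  have key (f : ℂ[X]) (e : ℕ) (hf : ((X - C a) * f).natDegree ≤ e + 1) : f.natDegree ≤ e := by
    by_cases hf0 : f = 0
    · simp [hf0]
    · rw [(monic_X_sub_C a).natDegree_mul' hf0, natDegree_X_sub_C] at hf
      omega
  obtain ⟨e, rfl⟩ := Nat.exists_eq_add_of_le' hd
  have h1 := key _ (e + 1) hh
  have h2 := key _ e h1
  have h3 := key _ (e + 1) hq
  set P := pencil ((X - C a) * ((X - C a) * h)) ((X - C a) * q) with hP
  have hPn : (derivative P).natDegree ≤ e + 1 :=
    (natDegree_derivative_le P).trans (by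
      have : P.natDegree ≤ e + 2 := natDegree_pencil_le hh hq
      omega)
  have hPe : (derivative P).eval (C a) = X * C (q.eval a) := by
    rw [hP, pencil_X_sub_C_mul, derivative_mul, derivative_sub, derivative_X, derivative_C]
    simp [pencil, eval_map]
  have hP0 : (derivative P).map (evalRingHom 0) = derivative ((X - C a) * ((X - C a) * h)) := by
    rw [← derivative_map, hP, map_eval_zero_pencil]
  have h0 : (resultant (pencil ((X - C a) * h) q) (derivative P) (e + 1) (e + 1)).eval 0 = 0 := by
    rw [← coe_evalRingHom, ← resultant_map_map, map_eval_zero_pencil, hP0,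
      resultant_X_sub_C_mul a h _ h2]
    · simp [derivative_mul]
    · exact (natDegree_derivative_le _).trans (by omega)
  have hPk : P = (X - C (C a)) * pencil ((X - C a) * h) q := pencil_X_sub_C_mul _ _ _
  rw [disc]
  generalize derivative P = P' at *
  rw [hPk, show e + 2 - 1 = e + 1 by omega, show e + 2 = e + 1 + 1 by omega,
    resultant_X_sub_C_mul _ _ _ (natDegree_pencil_le h1 h3) hPn, hPe, mul_assoc, coeff_X_mul,
    coeff_C_mul, coeff_zero_eq_eval_zero, h0, mul_zero]

/-- Write `p' = (X - a) k`. Since `a` is the only multiple root of `p`, and is double, `k` is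
coprime to `p`. The derivative of `p + Y` is still `p'`, so up to sign the discriminant is `(p +
Y)(a) = Y` times a resultant whose value at `Y = 0` is that of `p` and `k`, up to sign, which is
nonzero. -/
theorem coeff_one_disc_pencil_one {p : ℂ[X]} {d : ℕ} (hp : p.natDegree = d) {a : ℂ}
    (ha : p.roots.count a = 2) (hb : ∀ b, b ≠ a → p.roots.count b ≤ 1) :
    (disc d (pencil p 1)).coeff 1 ≠ 0 := by
  have hp0 : p ≠ 0 := by rintro rfl; simp at ha
  have hd : 2 ≤ d := by
    rw [← hp, ← ha]
    exact (Multiset.count_le_card _ _).trans (card_roots' p)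
  obtain ⟨e, rfl⟩ := Nat.exists_eq_add_of_le' hd
  have hroot : p.IsRoot a := by
    rw [← mem_roots hp0, ← Multiset.count_pos]; omega
  have hm2 : (derivative p).rootMultiplicity a = 1 := by
    rw [derivative_rootMultiplicity_of_root hroot, ← count_roots, ha]
  have hp'0 : derivative p ≠ 0 := by intro h; rw [h] at hm2; simp at hm2
  obtain ⟨k, hk, hka⟩ := exists_eq_pow_rootMultiplicity_mul_and_not_dvd (derivative p) hp'0 a
  rw [hm2, pow_one] at hk
  rw [dvd_iff_isRoot, IsRoot.def] at hka
  have hk0 : k ≠ 0 := by rintro rfl; simp at hka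
  have hk' : k.natDegree = e := by
    have h1 : (derivative p).natDegree = e + 1 := by rw [natDegree_derivative, hp]; rfl
    rw [hk, (monic_X_sub_C a).natDegree_mul' hk0, natDegree_X_sub_C] at h1
    omega
  have hcop : IsCoprime p k := by
    rw [isCoprime_iff_aeval_ne_zero_of_isAlgClosed ℂ ℂ]
    intro b
    by_contra! h
    simp only [coe_aeval_eq_eval] at h
    have hbr : p.IsRoot b := h.1
    have hba : b ≠ a := by rintro rfl; exact hka h.2
    have h1 : (derivative p).rootMultiplicity b = p.rootMultiplicity b - 1 :=
      derivative_rootMultiplicity_of_root hbr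
    have h2 : 0 < (derivative p).rootMultiplicity b := by
      rw [rootMultiplicity_pos hp'0, hk, IsRoot.def, eval_mul, h.2, mul_zero]
    have h3 := hb b hba
    rw [count_roots] at h3
    omega
  have hres : resultant p k (e + 2) e ≠ 0 := by
    have := resultant_ne_zero p k hcop
    rwa [hp, hk'] at this
  have hder : derivative (pencil p 1) = (X - C (C a)) * k.map C := by
    rw [pencil, derivative_add, derivative_map, hk]
    simp
  have hdeg : (pencil p 1).natDegree ≤ e + 2 := natDegree_pencil_le hp.le (by simp)
  have hev : (pencil p 1).eval (C a) = X := by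
    rw [pencil, eval_add, eval_map, eval₂_at_apply, hroot.eq_zero]
    simp
  rw [disc, hder, resultant_comm, show e + 2 - 1 = e + 1 by omega,
    resultant_X_sub_C_mul _ _ _ (natDegree_map_le.trans hk'.le) hdeg, hev, resultant_comm,
    mul_left_comm, coeff_X_mul, coeff_zero_eq_eval_zero, eval_mul, eval_mul]
  have h1 : (resultant (pencil p 1) (k.map C) (e + 2) e).eval 0 = resultant p k (e + 2) e := by
    rw [← coe_evalRingHom, ← resultant_map_map, map_eval_zero_pencil, map_map]
    have : (evalRingHom (0 : ℂ)).comp C = RingHom.id ℂ := by ext; simp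
    rw [this, map_id]
  rw [h1]
  exact mul_ne_zero (by simp) (mul_ne_zero (by simp) hres)

/-- The first order term of a polynomial function on a line. -/
theorem coeff_one_aeval {σ : Type*} [Fintype σ] (z h : σ → ℂ) (F : MvPolynomial σ ℂ) :
    (MvPolynomial.aeval (fun i => C (z i) + C (h i) * X) F : ℂ[X]).coeff 0 = MvPolynomial.eval z F ∧
    (MvPolynomial.aeval (fun i => C (z i) + C (h i) * X) F : ℂ[X]).coeff 1 =
      ∑ i, h i * MvPolynomial.eval z (MvPolynomial.pderiv i F) := by
  classical
  induction F using MvPolynomial.induction_on with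
  | C r => simp [algebraMap_eq, coeff_C]
  | add p q hp hq =>
    rw [map_add, coeff_add, coeff_add, hp.1, hp.2, hq.1, hq.2]
    simp only [map_add, mul_add, Finset.sum_add_distrib, and_self]
  | mul_X p j hp =>
    rw [map_mul, MvPolynomial.aeval_X, mul_coeff_zero, mul_coeff_one, hp.1, hp.2]
    refine ⟨by simp, ?_⟩
    have e (i : σ) : h i * MvPolynomial.eval z (MvPolynomial.pderiv i (p * MvPolynomial.X j)) =
        h i * MvPolynomial.eval z (MvPolynomial.pderiv i p) * z j +
          if i = j then MvPolynomial.eval z p * h j else 0 := by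
      rw [MvPolynomial.pderiv_mul, MvPolynomial.pderiv_X, map_add, map_mul, map_mul,
        MvPolynomial.eval_X]
      split_ifs with hij
      · subst hij; simp; ring
      · rw [Pi.single_eq_of_ne (Ne.symm hij)]; simp; ring
    simp only [e, Finset.sum_add_distrib, Finset.sum_ite_eq', Finset.mem_univ, if_true,
      ← Finset.sum_mul]
    simp [coeff_C]
    ring

theorem hasDerivAt_mvPolynomial_eval {σ : Type*} [Fintype σ] (c : ℝ → σ → ℂ) (c' : σ → ℂ) (t : ℝ)
    (hc : ∀ i, HasDerivAt (fun s => c s i) (c' i) t) (F : MvPolynomial σ ℂ) :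
    HasDerivAt (fun s => MvPolynomial.eval (c s) F)
      (∑ i, c' i * MvPolynomial.eval (c t) (MvPolynomial.pderiv i F)) t := by
  classical
  induction F using MvPolynomial.induction_on with
  | C r => simpa using hasDerivAt_const t r
  | add p q hp hq =>
    simpa only [map_add, mul_add, Finset.sum_add_distrib] using! hp.add hq
  | mul_X p j hp =>
    have := hp.mul (hc j)
    simp only [map_mul, MvPolynomial.eval_X]
    convert! this using 1
    simp only [MvPolynomial.pderiv_mul, MvPolynomial.pderiv_X, map_add, map_mul,
      MvPolynomial.eval_X, mul_add, Finset.sum_add_distrib, Finset.sum_mul]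
    simp [Pi.single_apply, mul_comm, mul_left_comm, apply_ite]

/-- The discriminant as a polynomial in the coefficients. -/
noncomputable def univDisc (d : ℕ) : MvPolynomial (Fin (d + 1)) ℂ :=
  disc d (∑ i : Fin (d + 1), C (MvPolynomial.X i) * X ^ (i : ℕ))

/-- Needed over `ℂ[Y]` for pencils and over `ℂ` for curves of polynomials, hence a general algebra
`R`. -/
theorem disc_map_sum {d : ℕ} {R : Type*} [CommRing R] [Algebra ℂ R] {p : R[X]}
    (hp : p.natDegree ≤ d) :
    disc d p = MvPolynomial.aeval (fun i : Fin (d + 1) => p.coeff i) (univDisc d) := by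
  rw [univDisc]
  refine Eq.trans ?_ (disc_map (MvPolynomial.aeval fun i : Fin (d + 1) => p.coeff i :
    MvPolynomial (Fin (d + 1)) ℂ →ₐ[ℂ] R).toRingHom d _)
  congr 1
  conv_lhs => rw [p.as_sum_range_C_mul_X_pow' (Nat.lt_succ_of_le hp)]
  rw [← Fin.sum_univ_eq_sum_range fun i => C (p.coeff i) * X ^ i]
  simp [Polynomial.map_sum]

/-- The derivative of the discriminant at a polynomial with exactly one multiple root `a`, which is
double, is a nonzero multiple of the evaluation at `a`. -/
theorem exists_hasDerivAt_disc {d : ℕ} {p : ℂ[X]} (hp : p.natDegree = d) {a : ℂ}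
    (ha : p.roots.count a = 2) (hb : ∀ b, b ≠ a → p.roots.count b ≤ 1) :
    ∃ K : ℂ, K ≠ 0 ∧ ∀ (P : ℝ → ℂ[X]) (c' : Fin (d + 1) → ℂ), (∀ s, (P s).natDegree ≤ d) → P 0 = p →
      (∀ i : Fin (d + 1), HasDerivAt (fun s => (P s).coeff i) (c' i) 0) →
      HasDerivAt (fun s => disc d (P s)) (K * ∑ i, c' i * a ^ (i : ℕ)) 0 := by
  have hp0 : p ≠ 0 := by rintro rfl; simp at ha
  have hd : 2 ≤ d := by
    rw [← hp, ← ha]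
    exact (Multiset.count_le_card _ _).trans (card_roots' p)
  let D (i : Fin (d + 1)) : ℂ :=
    MvPolynomial.eval (fun i : Fin (d + 1) => p.coeff i) (MvPolynomial.pderiv i (univDisc d))
  -- The differential of the discriminant at `p`; on polynomials of degree at most `d` it is the
  -- linear coefficient of the discriminant of a pencil.
  let Λ (q : ℂ[X]) : ℂ := ∑ i : Fin (d + 1), q.coeff i * D i
  have hΛ (q : ℂ[X]) (hq : q.natDegree ≤ d) : (disc d (pencil p q)).coeff 1 = Λ q := by
    rw [disc_map_sum (natDegree_pencil_le hp.le hq)]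
    have h1 := (coeff_one_aeval (fun i : Fin (d + 1) => p.coeff i)
      (fun i : Fin (d + 1) => q.coeff i) (univDisc d)).2
    refine Eq.trans ?_ h1
    congr 3
    funext i
    rw [pencil, coeff_add, coeff_map, coeff_C_mul, coeff_map, mul_comm]
  have hK : Λ 1 ≠ 0 := by
    rw [← hΛ 1 (by simp)]
    exact coeff_one_disc_pencil_one hp ha hb
  obtain ⟨h, hh⟩ : (X - C a) ^ 2 ∣ p := (le_rootMultiplicity_iff hp0).1 (by rw [← count_roots, ha])
  have hh' : p = (X - C a) * ((X - C a) * h) := by rw [hh]; ring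
  have hadd (q r : ℂ[X]) : Λ (q + r) = Λ q + Λ r := by
    simp only [Λ, coeff_add, add_mul, Finset.sum_add_distrib]
  -- A linear functional that kills the polynomials vanishing at `a` is a multiple of evaluation at
  -- `a`.
  have hmain (q : ℂ[X]) (hq : q.natDegree ≤ d) : Λ q = Λ 1 * q.eval a := by
    obtain ⟨r, hr⟩ := X_sub_C_dvd_sub_C_eval (a := a) (p := q)
    have e : q = (X - C a) * r + C (q.eval a) := by rw [← hr]; ring
    have hdeg : ((X - C a) * r).natDegree ≤ d := by
      rw [← hr]
      exact (natDegree_sub_le _ _).trans (by simpa using hq)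
    have h1 : Λ ((X - C a) * r) = 0 := by
      rw [← hΛ _ hdeg, hh']
      exact coeff_one_disc_pencil_of_root hd (by rw [← hh', hp]) hdeg
    have h2 : Λ (C (q.eval a)) = q.eval a * Λ 1 := by
      simp only [Λ, Finset.mul_sum, ← mul_assoc]
      refine Finset.sum_congr rfl fun i _ => ?_
      congr 1
      rw [← coeff_C_mul, mul_one]
    conv_lhs => rw [e]
    rw [hadd, h1, h2, zero_add, mul_comm]
  refine ⟨Λ 1, hK, fun P c' hP hP0 hc => ?_⟩
  have h1 := hasDerivAt_mvPolynomial_eval (fun s (i : Fin (d + 1)) => (P s).coeff i) c' 0 hc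
    (univDisc d)
  have h2 : (fun s => disc d (P s)) =
      fun s => MvPolynomial.eval (fun i : Fin (d + 1) => (P s).coeff i) (univDisc d) := by
    funext s
    rw [disc_map_sum (hP s)]
    rfl
  rw [h2]
  convert! h1 using 1
  set q : ℂ[X] := ∑ i : Fin (d + 1), C (c' i) * X ^ (i : ℕ) with hq
  have hqc (i : Fin (d + 1)) : q.coeff i = c' i := by
    rw [hq, finsetSum_coeff]
    simp only [coeff_C_mul, coeff_X_pow, mul_ite, mul_one, mul_zero]
    rw [Finset.sum_eq_single i]
    · simp
    · intro j _ hj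
      rw [if_neg]
      exact fun h => hj (Fin.ext h.symm)
    · simp
  have hqd : q.natDegree ≤ d := by
    refine natDegree_sum_le_of_forall_le _ _ fun i _ => ?_
    refine (natDegree_C_mul_X_pow_le _ _).trans ?_
    omega
  have h3 := hmain q hqd
  simp only [Λ, hqc, D] at h3
  rw [hP0]
  rw [h3, hq, eval_finsetSum]
  simp [Λ, D]

end Twistor

namespace Twistor

/-! ### General surfaces -/

open Polynomial in
/-- The genericity conditions on a surface used below. They are imposed on the restrictions of `F`
to the twistor lines, in finitely many charts. -/
structure IsGeneral {d : ℕ} (F : Form d) : Prop where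
  infinity : ∀ (n : Fin (d + 1)) (a : ℂ), ¬ (X - C a) ^ 2 ∣ chart F ![0, 1] ((n : ℕ) : ℂ)
  four : ∀ (n : Fin (d + 1)) (r : Fin 4 → ℝ) (a : ℂ),
    ¬ (X - C a) ^ 4 ∣ chart F ![1, toH r] ((n : ℕ) : ℂ)
  three_two : ∀ (n : Fin (d + 1)) (r : Fin 4 → ℝ) (a b : ℂ),
    ¬ (X - C a) ^ 3 * (X - C b) ^ 2 ∣ chart F ![1, toH r] ((n : ℕ) : ℂ)
  two_two_two : 5 ≤ d → ∀ (n : Fin (d + 1)) (r : Fin 4 → ℝ) (a b c : ℂ),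
    ¬ (X - C a) ^ 2 * (X - C b) ^ 2 * (X - C c) ^ 2 ∣ chart F ![1, toH r] ((n : ℕ) : ℂ)
  three : ∀ n : Fin (d + 1),
    {r : Fin 4 → ℝ | ∃ a, (X - C a) ^ 3 ∣ chart F ![1, toH r] ((n : ℕ) : ℂ)}.Finite
  two_two : ∀ n : Fin (d + 1),
    {r : Fin 4 → ℝ | ∃ a b, (X - C a) ^ 2 * (X - C b) ^ 2 ∣
      chart F ![1, toH r] ((n : ℕ) : ℂ)}.Finite
  nonsingular : ∀ (n : Fin (d + 1)) (z : Fin 4 → ℂ), z 1 - ((n : ℕ) : ℂ) * z 0 ≠ 0 →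
    MvPolynomial.eval z F.1 = 0 → ∃ h, (restr F z h).coeff 1 ≠ 0

theorem prod_two_two_two {R : Type*} [CommRing R] (f : Fin 3 → R) :
    ∏ i, f ((![0, 0, 1, 1, 2, 2] : Fin 6 → Fin 3) i) = f 0 ^ 2 * f 1 ^ 2 * f 2 ^ 2 := by
  rw [Fin.prod_univ_six]
  change f 0 * f 0 * f 1 * f 1 * f 2 * f 2 = _
  ring

theorem prod_three_two {R : Type*} [CommRing R] (f : Fin 2 → R) :
    ∏ i, f ((![0, 0, 0, 1, 1] : Fin 5 → Fin 2) i) = f 0 ^ 3 * f 1 ^ 2 := by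
  rw [Fin.prod_univ_five]
  change f 0 * f 0 * f 0 * f 1 * f 1 = _
  ring

theorem prod_two_two {R : Type*} [CommRing R] (f : Fin 2 → R) :
    ∏ i, f ((![0, 0, 1, 1] : Fin 4 → Fin 2) i) = f 0 ^ 2 * f 1 ^ 2 := by
  rw [Fin.prod_univ_four]
  change f 0 * f 0 * f 1 * f 1 = _
  ring

open Polynomial in
theorem forGeneral_isGeneral {d : ℕ} (hd : 4 ≤ d) : ForGeneral d fun F => IsGeneral F := by
  -- Parameters against real conditions: (2) at infinity 2 < 4, then (4) 6 < 8, (3,2) 8 < 10,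
  -- (2,2,2) 10 < 12, (3) 6 = 6, (2,2) 8 = 8. For (2,2,2) the requirement `6 ≤ d + 1` forces `5 ≤
  -- d`.
  have h1 := ForGeneral.forall_fin fun n : Fin (d + 1) => forGeneral_no_pattern_infinity (d := d)
    ((n : ℕ) : ℂ) (![0, 0] : Fin 2 → Fin 1) (by omega) (by omega)
  have h2 := ForGeneral.forall_fin fun n : Fin (d + 1) => forGeneral_no_pattern (d := d)
    ((n : ℕ) : ℂ) (![0, 0, 0, 0] : Fin 4 → Fin 1) (by omega) (by omega)
  have h3 := ForGeneral.forall_fin fun n : Fin (d + 1) => forGeneral_no_pattern (d := d)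
    ((n : ℕ) : ℂ) (![0, 0, 0, 1, 1] : Fin 5 → Fin 2) (by omega) (by omega)
  have h4 := ForGeneral.imp (d := d) fun h5 : 5 ≤ d => ForGeneral.forall_fin
    fun n : Fin (d + 1) => forGeneral_no_pattern (d := d)
      ((n : ℕ) : ℂ) (![0, 0, 1, 1, 2, 2] : Fin 6 → Fin 3) (by omega) (by omega)
  have h5 := ForGeneral.forall_fin fun n : Fin (d + 1) => forGeneral_finite_pattern (d := d)
    ((n : ℕ) : ℂ) (![0, 0, 0] : Fin 3 → Fin 1) (by omega) (by omega)
  have h6 := ForGeneral.forall_fin fun n : Fin (d + 1) => forGeneral_finite_pattern (d := d)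
    ((n : ℕ) : ℂ) (![0, 0, 1, 1] : Fin 4 → Fin 2) (by omega) (by omega)
  have h7 := ForGeneral.forall_fin fun n : Fin (d + 1) =>
    forGeneral_nonsingular (d := d) (by omega) ((n : ℕ) : ℂ)
  refine ((((((h1.and h2).and h3).and h4).and h5).and h6).and h7).mono ?_
  rintro F ⟨⟨⟨⟨⟨⟨g1, g2⟩, g3⟩, g4⟩, g5⟩, g6⟩, g7⟩
  refine ⟨fun n a h => g1 n (fun _ => a) ?_, fun n r a h => g2 n r (fun _ => a) ?_,
    fun n r a b h => g3 n r ![a, b] ?_, fun hd5 n r a b c h => g4 hd5 n r ![a, b, c] ?_,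
    fun n => ((g5 n).image Prod.fst).subset ?_, fun n => ((g6 n).image Prod.fst).subset ?_, g7⟩
  · convert! h using 1
    simp
  · convert! h using 1
    simp
  · rw [prod_three_two fun j => X - C ((![a, b] : Fin 2 → ℂ) j)]
    exact h
  · rw [prod_two_two_two fun j => X - C ((![a, b, c] : Fin 3 → ℂ) j)]
    exact h
  · rintro r ⟨a, h⟩
    refine ⟨(r, fun _ => a), ?_, rfl⟩
    rw [Set.mem_ofPred_eq]
    convert! h using 1
    simp
  · rintro r ⟨a, b, h⟩
    refine ⟨(r, ![a, b]), ?_, rfl⟩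
    rw [Set.mem_ofPred_eq, prod_two_two fun j => X - C ((![a, b] : Fin 2 → ℂ) j)]
    exact h

/-! ### Multiple roots as divisibility. -/

section roots

open Polynomial

theorem pow_dvd_of_le_count {p : ℂ[X]} {a : ℂ} {k : ℕ} (h : k ≤ p.roots.count a) :
    (X - C a) ^ k ∣ p := by
  rw [count_roots] at h
  exact (pow_dvd_pow _ h).trans (pow_rootMultiplicity_dvd p a)

theorem isCoprime_pow_X_sub_C {a b : ℂ} (h : a ≠ b) (k l : ℕ) :
    IsCoprime ((X - C a) ^ k) ((X - C b) ^ l : ℂ[X]) :=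
  (isCoprime_X_sub_C_of_isUnit_sub (sub_ne_zero.2 h).isUnit).pow

theorem pow_mul_pow_dvd_of_le_count {p : ℂ[X]} {a b : ℂ} (hab : a ≠ b) {k l : ℕ}
    (ha : k ≤ p.roots.count a) (hb : l ≤ p.roots.count b) :
    (X - C a) ^ k * (X - C b) ^ l ∣ p :=
  (isCoprime_pow_X_sub_C hab k l).mul_dvd (pow_dvd_of_le_count ha) (pow_dvd_of_le_count hb)

theorem pow_mul_pow_mul_pow_dvd_of_le_count {p : ℂ[X]} {a b c : ℂ} (hab : a ≠ b) (hac : a ≠ c)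
    (hbc : b ≠ c) {k l m : ℕ} (ha : k ≤ p.roots.count a) (hb : l ≤ p.roots.count b)
    (hc : m ≤ p.roots.count c) : (X - C a) ^ k * (X - C b) ^ l * (X - C c) ^ m ∣ p :=
  ((isCoprime_pow_X_sub_C hac k m).mul_left (isCoprime_pow_X_sub_C hbc l m)).mul_dvd
    (pow_mul_pow_dvd_of_le_count hab ha hb) (pow_dvd_of_le_count hc)

end roots

variable {d : ℕ} {F : Form d}

theorem card_roots_chart {p : Fin 2 → ℍ[ℝ]} {b : ℂ}
    (hb : MvPolynomial.eval (lineMap p ![1, b]) F.1 ≠ 0) : (chart F p b).roots.card = d :=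
  card_roots_restr hb

/-- A point of `S⁴` has a representative in one of two charts, and the twistor line over it is not
contained in a general surface. -/
theorem IsGeneral.exists_chart (hF : IsGeneral F) {p : Fin 2 → ℍ[ℝ]}
    (hp : (∃ r, p = ![1, toH r]) ∨ p = ![0, 1]) :
    ∃ n : Fin (d + 1), MvPolynomial.eval (lineMap p ![1, ((n : ℕ) : ℂ)]) F.1 ≠ 0 := by
  refine (exists_chart_or_zero F p).resolve_right fun h => ?_
  -- On a line inside the surface the chart polynomial is zero, hence divisible by every excluded
  -- power.
  rcases hp with ⟨r, rfl⟩ | rfl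
  · exact hF.four 0 r 0 (by rw [chart_eq_zero h]; exact dvd_zero _)
  · exact hF.infinity 0 0 (by rw [chart_eq_zero h]; exact dvd_zero _)

theorem IsGeneral.alpha_infinity (hF : IsGeneral F) {q : S4} (hq : sphereVec ![0, 1] = q.1) :
    alpha F (twistorLine q) = Multiset.replicate d 1 := by
  obtain ⟨n, hn⟩ := hF.exists_chart (Or.inr rfl)
  rw [alpha_twistorLine infinity_ne_zero hq hn, multiplicities_eq_replicate_iff (card_roots_chart hn),
    Multiset.nodup_iff_count_le_one]
  intro a
  by_contra! h
  exact hF.infinity n a (pow_dvd_of_le_count h)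

theorem IsGeneral.alpha_cases (hF : IsGeneral F) (hd : 4 ≤ d) (q : S4) :
    alpha F (twistorLine q) = Multiset.replicate d 1 ∨
    alpha F (twistorLine q) = {2} + Multiset.replicate (d - 2) 1 ∨
    alpha F (twistorLine q) = {2, 2} + Multiset.replicate (d - 4) 1 ∨
    alpha F (twistorLine q) = {3} + Multiset.replicate (d - 3) 1 := by
  obtain ⟨r, hr⟩ | hq := sphereVec_cases q
  · obtain ⟨n, hn⟩ := hF.exists_chart (Or.inl ⟨r, rfl⟩)
    have hcard := card_roots_chart hn
    rw [alpha_twistorLine (affine_ne_zero _) hr hn]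
    refine multiplicities_cases hcard (fun a => ?_) (fun a b hab ha hb => ?_)
      (fun a b c hab hac hbc ha hb hc => ?_)
    · by_contra! h
      exact hF.four n r a (pow_dvd_of_le_count h)
    · exact hF.three_two n r a b (pow_mul_pow_dvd_of_le_count hab ha hb)
    · have hdvd := pow_mul_pow_mul_pow_dvd_of_le_count hab hac hbc ha hb hc
      by_cases h5 : 5 ≤ d
      · exact hF.two_two_two h5 n r a b c hdvd
      -- For `d = 4` a divisor of degree 6 is too large.
      · have h1 := Polynomial.natDegree_le_of_dvd hdvd (restr_ne_zero hn)
        rw [chart, natDegree_restr hn, Polynomial.natDegree_mul, Polynomial.natDegree_mul] at h1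
        · simp at h1
          omega
        all_goals simp [Polynomial.X_sub_C_ne_zero]
  · exact Or.inl (hF.alpha_infinity hq)

theorem IsGeneral.not_subset (hF : IsGeneral F) (q : S4) :
    ¬ points (twistorLine q) ⊆ surface F := by
  intro h
  have key (p : Fin 2 → ℍ[ℝ]) (hp : p ≠ 0) (hpq : sphereVec p = q.1)
      (hp' : (∃ r, p = ![1, toH r]) ∨ p = ![0, 1]) : False := by
    obtain ⟨n, hn⟩ := hF.exists_chart hp'
    have h0 : lineMap p ![1, ((n : ℕ) : ℂ)] ≠ 0 := by
      intro h0
      have := lineMap_injective hp (h0.trans (map_zero _).symm)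
      exact one_ne_zero (congrFun this 0)
    refine hn ((mem_surface_mk F h0).1 (h ?_))
    change (Projectivization.mk ℂ _ h0).submodule ≤ _
    rw [Projectivization.submodule_mk, Submodule.span_singleton_le_iff_mem]
    exact (mem_twistorLine_iff hp hpq _).2 ⟨_, rfl⟩
  obtain ⟨r, hr⟩ | hq := sphereVec_cases q
  · exact key _ (affine_ne_zero _) hr (Or.inl ⟨r, rfl⟩)
  · exact key _ infinity_ne_zero hq (Or.inr rfl)

theorem finite_of_chart {A : Set S4} {B : Fin (d + 1) → Set (Fin 4 → ℝ)} (hB : ∀ n, (B n).Finite)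
    (hA : ∀ q ∈ A, ∃ r n, sphereVec ![1, toH r] = q.1 ∧ r ∈ B n) : A.Finite := by
  refine ((Set.finite_iUnion hB).image fun r => (⟨sphereVec ![1, toH r],
    sphereVec_mem (affine_ne_zero _)⟩ : S4)).subset fun q hq => ?_
  obtain ⟨r, n, h1, h2⟩ := hA q hq
  exact ⟨r, Set.mem_iUnion.2 ⟨n, h2⟩, Subtype.ext h1⟩

theorem two_two_ne {k : ℕ} : ({2, 2} + Multiset.replicate k 1 : Multiset ℕ) ≠
    Multiset.replicate d 1 := by
  intro h
  have : 2 ∈ Multiset.replicate d 1 := by rw [← h]; simp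
  simp [Multiset.mem_replicate] at this

theorem three_ne {k : ℕ} : ({3} + Multiset.replicate k 1 : Multiset ℕ) ≠
    Multiset.replicate d 1 := by
  intro h
  have : 3 ∈ Multiset.replicate d 1 := by rw [← h]; simp
  simp [Multiset.mem_replicate] at this

theorem two_ne {k : ℕ} : ({2} + Multiset.replicate k 1 : Multiset ℕ) ≠
    Multiset.replicate d 1 := by
  intro h
  have : 2 ∈ Multiset.replicate d 1 := by rw [← h]; simp
  simp [Multiset.mem_replicate] at this

theorem IsGeneral.finite_locus_two_two (hF : IsGeneral F) {k : ℕ} :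
    (locus F ({2, 2} + Multiset.replicate k 1)).Finite := by
  refine finite_of_chart hF.two_two fun q hq => ?_
  change alpha F (twistorLine q) = _ at hq
  obtain ⟨r, hr⟩ | hq' := sphereVec_cases q
  · obtain ⟨n, hn⟩ := hF.exists_chart (Or.inl ⟨r, rfl⟩)
    rw [alpha_twistorLine (affine_ne_zero _) hr hn] at hq
    obtain ⟨a, b, hab, ha, hb⟩ := exists_of_multiplicities_eq_two_two hq
    exact ⟨r, n, hr, a, b, pow_mul_pow_dvd_of_le_count hab ha hb⟩
  · exact absurd (hq.symm.trans (hF.alpha_infinity hq')) two_two_ne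

theorem IsGeneral.finite_locus_three (hF : IsGeneral F) {k : ℕ} :
    (locus F ({3} + Multiset.replicate k 1)).Finite := by
  refine finite_of_chart hF.three fun q hq => ?_
  change alpha F (twistorLine q) = _ at hq
  obtain ⟨r, hr⟩ | hq' := sphereVec_cases q
  · obtain ⟨n, hn⟩ := hF.exists_chart (Or.inl ⟨r, rfl⟩)
    rw [alpha_twistorLine (affine_ne_zero _) hr hn] at hq
    obtain ⟨a, ha⟩ := exists_of_multiplicities_eq_three hq
    exact ⟨r, n, hr, a, pow_dvd_of_le_count ha⟩
  · exact absurd (hq.symm.trans (hF.alpha_infinity hq')) three_ne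

theorem IsGeneral.nonempty_locus_one (hF : IsGeneral F) :
    (locus F (Multiset.replicate d 1)).Nonempty :=
  ⟨⟨sphereVec ![0, 1], sphereVec_mem infinity_ne_zero⟩, hF.alpha_infinity rfl⟩

/-! ### Zariski closed sets -/

theorem isZariskiClosed_singleton (q : S4) : IsZariskiClosed {q} := by
  refine ⟨Set.range fun i => MvPolynomial.X i - MvPolynomial.C (q.1 i), ?_⟩
  ext x
  rw [Set.mem_singleton_iff, Set.mem_ofPred_eq, Set.forall_mem_range]
  simp only [map_sub, MvPolynomial.eval_X, MvPolynomial.eval_C, sub_eq_zero]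
  exact ⟨by rintro rfl i; rfl, fun h => Subtype.ext (by ext i; exact h i)⟩

theorem isZariskiClosed_empty : IsZariskiClosed ∅ := ⟨{1}, by ext x; simp⟩

theorem IsZariskiClosed.union {A B : Set S4} (hA : IsZariskiClosed A) (hB : IsZariskiClosed B) :
    IsZariskiClosed (A ∪ B) := by
  obtain ⟨I, rfl⟩ := hA
  obtain ⟨J, rfl⟩ := hB
  refine ⟨{h | ∃ f ∈ I, ∃ g ∈ J, h = f * g}, ?_⟩
  ext x
  simp only [Set.mem_union, Set.mem_ofPred_eq]
  constructor
  · rintro (h | h) _ ⟨f, hf, g, hg, rfl⟩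
    · rw [map_mul, h f hf, zero_mul]
    · rw [map_mul, h g hg, mul_zero]
  · intro h
    by_contra! hcon
    obtain ⟨⟨f, hf, hf'⟩, ⟨g, hg, hg'⟩⟩ := hcon
    have := h _ ⟨f, hf, g, hg, rfl⟩
    rw [map_mul] at this
    exact mul_ne_zero hf' hg' this

theorem isZariskiClosed_of_finite {A : Set S4} (hA : A.Finite) : IsZariskiClosed A := by
  induction A, hA using Set.Finite.induction_on with
  | empty => exact isZariskiClosed_empty
  | insert _ _ ih => exact (isZariskiClosed_singleton _).union ih

/-- At real points a complex polynomial vanishes exactly when its real and imaginary parts, which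
are real polynomials, both do. -/
theorem isZariskiClosed_complex {ι : Type*} (f : ι → MvPolynomial (Fin 5) ℂ) :
    IsZariskiClosed {x | ∀ i, MvPolynomial.eval (fun j => ((x.1 j : ℝ) : ℂ)) (f i) = 0} := by
  choose a b hab using fun i => MvPolynomial.exists_re_im (f i)
  refine ⟨Set.range a ∪ Set.range b, ?_⟩
  ext x
  simp only [Set.mem_ofPred_eq, Set.mem_union, or_imp, forall_and, Set.forall_mem_range]
  rw [← forall_and]
  refine forall_congr' fun i => ?_
  rw [hab]
  exact Complex.ext_iff

/-! ### The locus of twistor lines that are not transverse -/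

/-- Homogeneous coordinates of a point of `S⁴` other than `(0, -1)`. -/
def southChart (x : Fin 5 → ℝ) : Fin 2 → ℍ[ℝ] := ![⟨1 + x 4, 0, 0, 0⟩, ⟨x 0, x 1, x 2, x 3⟩]

/-- Homogeneous coordinates of a point of `S⁴` other than `(0, 1)`. -/
def northChart (x : Fin 5 → ℝ) : Fin 2 → ℍ[ℝ] := ![⟨x 0, -x 1, -x 2, -x 3⟩, ⟨1 - x 4, 0, 0, 0⟩]

theorem sum_sq_eq_one (x : S4) :
    x.1 0 ^ 2 + x.1 1 ^ 2 + x.1 2 ^ 2 + x.1 3 ^ 2 + x.1 4 ^ 2 = 1 := by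
  have := x.2
  rwa [mem_sphere_zero_iff_norm, ← sq_eq_sq₀ (norm_nonneg _) zero_le_one,
    EuclideanSpace.real_norm_sq_eq, Fin.sum_univ_five, one_pow] at this

theorem sphereVec_southChart (x : S4) (h : 1 + x.1 4 ≠ 0) : sphereVec (southChart x.1) = x.1 := by
  have hs := sum_sq_eq_one x
  have hn : Quaternion.normSq (southChart x.1 0) + Quaternion.normSq (southChart x.1 1) =
      2 * (1 + x.1 4) := by
    simp only [southChart, Quaternion.normSq_def']
    simp
    linarith
  have hn' : Quaternion.normSq (southChart x.1 0) - Quaternion.normSq (southChart x.1 1) =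
      2 * (1 + x.1 4) * x.1 4 := by
    simp only [southChart, Quaternion.normSq_def']
    simp
    linarith
  have hm : star (southChart x.1 0) * southChart x.1 1 = ⟨(1 + x.1 4) * x.1 0,
      (1 + x.1 4) * x.1 1, (1 + x.1 4) * x.1 2, (1 + x.1 4) * x.1 3⟩ := by
    ext <;> (first | rw [Quaternion.re_mul] | rw [Quaternion.imI_mul] | rw [Quaternion.imJ_mul] |
      rw [Quaternion.imK_mul]) <;>
      simp only [Quaternion.re_star, Quaternion.imI_star, Quaternion.imJ_star,
        Quaternion.imK_star] <;> simp [southChart]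
  rw [sphereVec, hn, hn', hm]
  ext i
  fin_cases i <;> simp <;> field_simp

theorem sphereVec_northChart (x : S4) (h : 1 - x.1 4 ≠ 0) : sphereVec (northChart x.1) = x.1 := by
  have hs := sum_sq_eq_one x
  have hn : Quaternion.normSq (northChart x.1 0) + Quaternion.normSq (northChart x.1 1) =
      2 * (1 - x.1 4) := by
    simp only [northChart, Quaternion.normSq_def']
    simp
    linarith
  have hn' : Quaternion.normSq (northChart x.1 0) - Quaternion.normSq (northChart x.1 1) =
      2 * (1 - x.1 4) * x.1 4 := by
    simp only [northChart, Quaternion.normSq_def']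
    simp
    linarith
  have hm : star (northChart x.1 0) * northChart x.1 1 = ⟨(1 - x.1 4) * x.1 0,
      (1 - x.1 4) * x.1 1, (1 - x.1 4) * x.1 2, (1 - x.1 4) * x.1 3⟩ := by
    ext <;> (first | rw [Quaternion.re_mul] | rw [Quaternion.imI_mul] | rw [Quaternion.imJ_mul] |
      rw [Quaternion.imK_mul]) <;>
      simp only [Quaternion.re_star, Quaternion.imI_star, Quaternion.imJ_star,
        Quaternion.imK_star] <;> simp [northChart] <;> ring
  rw [sphereVec, hn, hn', hm]
  ext i
  fin_cases i <;> simp <;> field_simp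

theorem exists_lineMap_eq_eval (P : (Fin 5 → ℝ) → Fin 2 → ℍ[ℝ])
    (A : Fin 8 → MvPolynomial (Fin 5) ℂ) (hA : ∀ x k, MvPolynomial.eval (fun j => (x j : ℂ)) (A k) =
      ((![(P x 0).re, (P x 0).imI, (P x 0).imJ, (P x 0).imK, (P x 1).re, (P x 1).imI, (P x 1).imJ,
        (P x 1).imK] k : ℝ) : ℂ)) (c : Fin 2 → ℂ) :
    ∃ U : Fin 4 → MvPolynomial (Fin 5) ℂ, ∀ x i,
      MvPolynomial.eval (fun j => (x j : ℂ)) (U i) = lineMap (P x) c i := by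
  let I : MvPolynomial (Fin 5) ℂ := MvPolynomial.C Complex.I
  let c₀ : MvPolynomial (Fin 5) ℂ := MvPolynomial.C (c 0)
  let c₁ : MvPolynomial (Fin 5) ℂ := MvPolynomial.C (c 1)
  refine ⟨![c₀ * (A 0 + I * A 1) - c₁ * (A 2 - I * A 3), c₀ * (A 2 + I * A 3) + c₁ * (A 0 - I * A 1),
    c₀ * (A 4 + I * A 5) - c₁ * (A 6 - I * A 7), c₀ * (A 6 + I * A 7) + c₁ * (A 4 - I * A 5)],
    fun x i => ?_⟩
  have mk (x y : ℝ) : (⟨x, y⟩ : ℂ) = x + Complex.I * y := by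
    rw [mul_comm]; exact Complex.mk_eq_add_mul_I x y
  fin_cases i <;> simp [lineMap, hA, mk, I, c₀, c₁] <;> left <;> ring

-- The discriminant is formed over the ring of polynomials in the point of `ℝ⁵` and then
-- specialised; resultants with fixed formal degrees commute with base change.
open Polynomial in
theorem exists_disc_chart_eq_eval (F : Form d) {P : (Fin 5 → ℝ) → Fin 2 → ℍ[ℝ]}
    (hP : ∀ c, ∃ U : Fin 4 → MvPolynomial (Fin 5) ℂ, ∀ x i,
      MvPolynomial.eval (fun j => ((x j : ℝ) : ℂ)) (U i) = lineMap (P x) c i) (b : ℂ) :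
    ∃ D : MvPolynomial (Fin 5) ℂ, ∀ x, MvPolynomial.eval (fun j => ((x j : ℝ) : ℂ)) D =
      disc d (chart F (P x) b) := by
  obtain ⟨U, hU⟩ := hP ![0, 1]
  obtain ⟨V, hV⟩ := hP ![1, b]
  refine ⟨disc d (MvPolynomial.aeval (fun i => C (U i) + C (V i) * X) F.1), fun x => ?_⟩
  rw [← disc_map]
  congr 1
  refine (F.map_aeval (Polynomial.mapAlgHom (MvPolynomial.aeval fun j => ((x j : ℝ) : ℂ))) _).trans ?_
  rw [chart, restr]
  congr 2
  funext i
  rw [← hU, ← hV]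
  simp

theorem exists_lineMap_southChart (c : Fin 2 → ℂ) : ∃ U : Fin 4 → MvPolynomial (Fin 5) ℂ, ∀ x i,
    MvPolynomial.eval (fun j => ((x j : ℝ) : ℂ)) (U i) = lineMap (southChart x) c i := by
  open MvPolynomial in
  refine exists_lineMap_eq_eval southChart ![1 + X 4, 0, 0, 0, X 0, X 1, X 2, X 3] (fun x k => ?_) c
  fin_cases k <;> simp [southChart]

theorem exists_lineMap_northChart (c : Fin 2 → ℂ) : ∃ U : Fin 4 → MvPolynomial (Fin 5) ℂ, ∀ x i,
    MvPolynomial.eval (fun j => ((x j : ℝ) : ℂ)) (U i) = lineMap (northChart x) c i := by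
  open MvPolynomial in
  refine exists_lineMap_eq_eval northChart ![X 0, -X 1, -X 2, -X 3, 1 - X 4, 0, 0, 0] (fun x k => ?_) c
  fin_cases k <;> simp [northChart]

theorem eval_lineMap_ne_zero_of_disc_ne_zero {p : Fin 2 → ℍ[ℝ]} {b : ℂ}
    (h : disc d (chart F p b) ≠ 0) (hd : 2 ≤ d) : MvPolynomial.eval (lineMap p ![1, b]) F.1 ≠ 0 := by
  intro h0
  refine h (disc_eq_zero_of_lt hd ?_)
  refine lt_of_le_of_ne (natDegree_restr_le _ _ _) fun h1 => ?_
  rw [← restr_coeff_degree F (lineMap p ![0, 1])] at h0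
  have h2 : (chart F p b).leadingCoeff = 0 := (congrArg (chart F p b).coeff h1).trans h0
  rw [Polynomial.leadingCoeff_eq_zero] at h2
  rw [h2] at h1
  simp at h1
  omega

theorem disc_chart_eq_zero_iff (hd : 2 ≤ d) {p : Fin 2 → ℍ[ℝ]} (hp : p ≠ 0) {q : S4}
    (hpq : sphereVec p = q.1) {b : ℂ} (hb : MvPolynomial.eval (lineMap p ![1, b]) F.1 ≠ 0) :
    disc d (chart F p b) = 0 ↔ alpha F (twistorLine q) ≠ Multiset.replicate d 1 := by
  rw [alpha_twistorLine hp hpq hb, Ne, multiplicities_eq_replicate_iff (card_roots_chart hb)]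
  exact disc_eq_zero_iff (by omega) (natDegree_restr hb)

theorem IsGeneral.exists_eval_ne_zero (hF : IsGeneral F) {p : Fin 2 → ℍ[ℝ]} (hp : p ≠ 0) {q : S4}
    (hpq : sphereVec p = q.1) :
    ∃ n : Fin (d + 1), MvPolynomial.eval (lineMap p ![1, ((n : ℕ) : ℂ)]) F.1 ≠ 0 := by
  refine (exists_chart_or_zero F p).resolve_right fun h => hF.not_subset q fun z hz => ?_
  induction z using Projectivization.ind with | h z hz0
  change (Projectivization.mk ℂ z hz0).submodule ≤ _ at hz
  rw [Projectivization.submodule_mk, Submodule.span_singleton_le_iff_mem,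
    mem_twistorLine_iff hp hpq] at hz
  obtain ⟨c, rfl⟩ := hz
  exact (mem_surface_mk F hz0).2 (h c)

/-- Quantifying over all slopes makes the condition independent of which charts are usable at `q`:
unusable ones have discriminant zero, and at least one is usable. -/
theorem forall_disc_eq_zero_iff (hF : IsGeneral F) (hd : 2 ≤ d) {p : Fin 2 → ℍ[ℝ]} (hp : p ≠ 0)
    {q : S4} (hpq : sphereVec p = q.1) :
    (∀ n : Fin (d + 1), disc d (chart F p ((n : ℕ) : ℂ)) = 0) ↔
      alpha F (twistorLine q) ≠ Multiset.replicate d 1 := by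
  constructor
  · intro h
    obtain ⟨n, hn⟩ := hF.exists_eval_ne_zero hp hpq
    exact (disc_chart_eq_zero_iff hd hp hpq hn).1 (h n)
  · intro h n
    by_contra hn
    exact hn ((disc_chart_eq_zero_iff hd hp hpq (eval_lineMap_ne_zero_of_disc_ne_zero hn hd)).2 h)

theorem southChart_ne_zero {x : Fin 5 → ℝ} (h : 1 + x 4 ≠ 0) : southChart x ≠ 0 := fun h0 =>
  h (congrArg (fun q : ℍ[ℝ] => q.re) (congrFun h0 0))

theorem northChart_ne_zero {x : Fin 5 → ℝ} (h : 1 - x 4 ≠ 0) : northChart x ≠ 0 := fun h0 =>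
  h (congrArg (fun q : ℍ[ℝ] => q.re) (congrFun h0 1))

/-- At a pole the homogeneous coordinates of one of the two charts are all zero. Its equations then
hold trivially, and the other chart alone decides. -/
theorem disc_chart_zero (hd : 2 ≤ d) (b : ℂ) : disc d (chart F 0 b) = 0 := by
  by_contra h
  refine eval_lineMap_ne_zero_of_disc_ne_zero h hd ?_
  have e : lineMap 0 ![1, b] = (0 : ℂ) • 0 := by
    have h0 : (⟨0, 0⟩ : ℂ) = 0 := rfl
    funext i
    fin_cases i <;> simp [lineMap, h0]
  rw [e, Form.eval_smul, zero_pow (by omega), zero_mul]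

theorem southChart_eq_zero {x : S4} (h : 1 + x.1 4 = 0) : southChart x.1 = 0 := by
  have hs := sum_sq_eq_one x
  have h4 : x.1 4 = -1 := by linarith
  rw [h4] at hs
  have h0 : x.1 0 = 0 := by
    nlinarith [sq_nonneg (x.1 0), sq_nonneg (x.1 1), sq_nonneg (x.1 2), sq_nonneg (x.1 3)]
  have h1 : x.1 1 = 0 := by
    nlinarith [sq_nonneg (x.1 0), sq_nonneg (x.1 1), sq_nonneg (x.1 2), sq_nonneg (x.1 3)]
  have h2 : x.1 2 = 0 := by
    nlinarith [sq_nonneg (x.1 0), sq_nonneg (x.1 1), sq_nonneg (x.1 2), sq_nonneg (x.1 3)]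
  have h3 : x.1 3 = 0 := by
    nlinarith [sq_nonneg (x.1 0), sq_nonneg (x.1 1), sq_nonneg (x.1 2), sq_nonneg (x.1 3)]
  funext i
  fin_cases i <;> ext <;> simp [southChart, h, h0, h1, h2, h3]

theorem northChart_eq_zero {x : S4} (h : 1 - x.1 4 = 0) : northChart x.1 = 0 := by
  have hs := sum_sq_eq_one x
  have h4 : x.1 4 = 1 := by linarith
  rw [h4] at hs
  have h0 : x.1 0 = 0 := by
    nlinarith [sq_nonneg (x.1 0), sq_nonneg (x.1 1), sq_nonneg (x.1 2), sq_nonneg (x.1 3)]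
  have h1 : x.1 1 = 0 := by
    nlinarith [sq_nonneg (x.1 0), sq_nonneg (x.1 1), sq_nonneg (x.1 2), sq_nonneg (x.1 3)]
  have h2 : x.1 2 = 0 := by
    nlinarith [sq_nonneg (x.1 0), sq_nonneg (x.1 1), sq_nonneg (x.1 2), sq_nonneg (x.1 3)]
  have h3 : x.1 3 = 0 := by
    nlinarith [sq_nonneg (x.1 0), sq_nonneg (x.1 1), sq_nonneg (x.1 2), sq_nonneg (x.1 3)]
  funext i
  fin_cases i <;> ext <;> simp [northChart, h, h0, h1, h2, h3]

theorem IsGeneral.isZariskiOpen_locus_one (hF : IsGeneral F) (hd : 2 ≤ d) :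
    IsZariskiOpen (locus F (Multiset.replicate d 1)) := by
  choose A hA using fun n : Fin (d + 1) =>
    exists_disc_chart_eq_eval F exists_lineMap_southChart ((n : ℕ) : ℂ)
  choose B hB using fun n : Fin (d + 1) =>
    exists_disc_chart_eq_eval F exists_lineMap_northChart ((n : ℕ) : ℂ)
  have h := isZariskiClosed_complex (Sum.elim A B)
  change IsZariskiClosed _
  convert! h using 1
  ext x
  change alpha F (twistorLine x) ≠ _ ↔ ∀ i, _
  rw [Sum.forall]
  simp only [Sum.elim_inl, Sum.elim_inr, hA, hB]
  by_cases h1 : 1 + x.1 4 = 0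
  · have h2 : 1 - x.1 4 ≠ 0 := fun h2 => by linarith
    rw [forall_disc_eq_zero_iff hF hd (northChart_ne_zero h2) (sphereVec_northChart x h2),
      southChart_eq_zero h1]
    simp [disc_chart_zero hd]
  · rw [forall_disc_eq_zero_iff hF hd (southChart_ne_zero h1) (sphereVec_southChart x h1)]
    by_cases h2 : 1 - x.1 4 = 0
    · rw [northChart_eq_zero h2]
      simp [disc_chart_zero hd]
    · rw [forall_disc_eq_zero_iff hF hd (northChart_ne_zero h2) (sphereVec_northChart x h2),
        and_self]

theorem IsGeneral.alpha_eq_two_iff (hF : IsGeneral F) (hd : 4 ≤ d) (q : S4) :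
    alpha F (twistorLine q) = {2} + Multiset.replicate (d - 2) 1 ↔
      alpha F (twistorLine q) ≠ Multiset.replicate d 1 ∧
      q ∉ locus F ({2, 2} + Multiset.replicate (d - 4) 1) ∪
        locus F ({3} + Multiset.replicate (d - 3) 1) := by
  change _ ↔ _ ∧ ¬ (alpha F (twistorLine q) = _ ∨ alpha F (twistorLine q) = _)
  have h1 := hF.alpha_cases hd q
  constructor
  · intro h
    rw [h]
    refine ⟨two_ne, ?_⟩
    rintro (h2 | h2)
    · have := congrArg (Multiset.count 2) h2
      simp [Multiset.count_replicate] at this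
    · have := congrArg (Multiset.count 3) h2
      simp [Multiset.count_replicate] at this
  · rintro ⟨h2, h3⟩
    tauto

theorem IsGeneral.isZariskiLocallyClosed_locus_two (hF : IsGeneral F) (hd : 4 ≤ d) :
    IsZariskiLocallyClosed (locus F ({2} + Multiset.replicate (d - 2) 1)) := by
  refine ⟨(locus F ({2, 2} + Multiset.replicate (d - 4) 1) ∪
    locus F ({3} + Multiset.replicate (d - 3) 1))ᶜ, (locus F (Multiset.replicate d 1))ᶜ, ?_,
    hF.isZariskiOpen_locus_one (by omega), ?_⟩
  · rw [IsZariskiOpen, compl_compl]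
    exact isZariskiClosed_of_finite (hF.finite_locus_two_two.union hF.finite_locus_three)
  · ext q
    exact (hF.alpha_eq_two_iff hd q).trans and_comm

end Twistor

namespace Twistor

/-! ### Smoothness -/

/-- With a right inverse `R` of the derivative at `x`, the composite `f'(y) ∘ R` is the identity at
`y = x`, hence invertible for `y` nearby, as the units are open. -/
theorem exists_isOpen_surjective_fderiv {E E' : Type*} [NormedAddCommGroup E] [NormedSpace ℝ E]
    [NormedAddCommGroup E'] [NormedSpace ℝ E'] [FiniteDimensional ℝ E'] {f : E → E'}
    (hf : ContDiff ℝ ∞ f) {x : E} (hx : Function.Surjective (fderiv ℝ f x)) :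
    ∃ U : Set E, IsOpen U ∧ x ∈ U ∧ ∀ y ∈ U, Function.Surjective (fderiv ℝ f y) := by
  have : CompleteSpace E' := FiniteDimensional.complete ℝ E'
  obtain ⟨R, hR⟩ := (fderiv ℝ f x).toLinearMap.exists_rightInverse_of_surjective
    (LinearMap.range_eq_top.2 hx)
  let R' : E' →L[ℝ] E := LinearMap.toContinuousLinearMap R
  have hcont : Continuous fun y => (fderiv ℝ f y).comp R' :=
    (hf.continuous_fderiv (by simp)).clm_comp continuous_const
  refine ⟨(fun y => (fderiv ℝ f y).comp R') ⁻¹' {u | IsUnit u}, Units.isOpen.preimage hcont, ?_, ?_⟩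
  · have e : (fderiv ℝ f x).comp R' = 1 := by
      ext v
      exact LinearMap.congr_fun hR v
    change IsUnit ((fderiv ℝ f x).comp R')
    rw [e]
    exact isUnit_one
  · rintro y ⟨u, hu⟩ w
    refine ⟨R' ((u⁻¹ : (E' →L[ℝ] E')ˣ).1 w), ?_⟩
    have h1 : (u.1 * (u⁻¹ : (E' →L[ℝ] E')ˣ).1) w = w := by rw [u.mul_inv]; rfl
    rw [hu] at h1
    exact h1

theorem contDiff_mvPolynomial_eval {n : ℕ} (p : MvPolynomial (Fin n) ℝ) :
    ContDiff ℝ ∞ fun x : EuclideanSpace ℝ (Fin n) => MvPolynomial.eval (fun i => x i) p := by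
  induction p using MvPolynomial.induction_on with
  | C r => simpa using contDiff_const
  | add p q hp hq => simpa using hp.add hq
  | mul_X p i hp =>
    simp only [map_mul, MvPolynomial.eval_X]
    exact hp.mul (by fun_prop)

section derivative

open Polynomial

variable {d : ℕ} (F : Form d)

/-- The differential of a form. -/
noncomputable def dform (z : Fin 4 → ℂ) : (Fin 4 → ℂ) →ₗ[ℂ] ℂ where
  toFun h := ∑ i, h i * MvPolynomial.eval z (MvPolynomial.pderiv i F.1)
  map_add' h k := by simp [add_mul, Finset.sum_add_distrib]
  map_smul' c h := by simp [Finset.mul_sum, mul_assoc]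

theorem restr_coeff_one_eq_dform (z h : Fin 4 → ℂ) : (restr F z h).coeff 1 = dform F z h :=
  (coeff_one_aeval z h F.1).2

/-- A form that vanishes at `z` vanishes on all multiples of `z`. -/
theorem dform_self {z : Fin 4 → ℂ} (hz : MvPolynomial.eval z F.1 = 0) : dform F z z = 0 := by
  have h : restr F z z = 0 := by
    refine Polynomial.funext fun t => ?_
    have e : z + t • z = (1 + t) • z := by module
    rw [eval_restr, e, Form.eval_smul, hz, mul_zero, eval_zero]
  rw [← restr_coeff_one_eq_dform, h, coeff_zero]

theorem dform_of_two_le_count {v w : Fin 4 → ℂ} (hw : MvPolynomial.eval w F.1 ≠ 0) {a : ℂ}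
    (ha : 2 ≤ (restr F v w).roots.count a) : dform F (v + a • w) w = 0 := by
  have h := contactOrder_eq_count (v := v) hw (c := 1) (β := a) (a := 0) (b := 1) one_ne_zero
    (by simp)
  simp only [one_smul, zero_smul, zero_add] at h
  rw [← h] at ha
  change 2 ≤ (restr F (v + a • w) w).rootMultiplicity 0 at ha
  rw [← restr_coeff_one_eq_dform]
  have h2 := (pow_dvd_pow _ ha).trans (pow_rootMultiplicity_dvd (restr F (v + a • w) w) 0)
  rw [C_0, sub_zero, X_pow_dvd_iff] at h2
  exact h2 1 one_lt_two

theorem hasDerivAt_eval_coe (p : ℂ[X]) : HasDerivAt (fun s : ℝ => p.eval (s : ℂ)) (p.coeff 1) 0 := by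
  have h := (p.hasDerivAt ((0 : ℝ) : ℂ)).comp_ofReal
  convert! h using 1
  rw [Complex.ofReal_zero, ← coeff_zero_eq_eval_zero, coeff_derivative]
  simp

theorem hasDerivAt_eval_line (z h : Fin 4 → ℂ) :
    HasDerivAt (fun s : ℝ => MvPolynomial.eval (z + (s : ℂ) • h) F.1) (dform F z h) 0 := by
  simp only [← eval_restr, ← restr_coeff_one_eq_dform]
  exact hasDerivAt_eval_coe _

theorem exists_hasDerivAt_coeff_restr (v v' w w' : Fin 4 → ℂ) (k : ℕ) :
    ∃ c, HasDerivAt (fun s : ℝ => (restr F (v + (s : ℂ) • v') (w + (s : ℂ) • w')).coeff k) c 0 := by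
  let Q : ℂ[X][X] := MvPolynomial.aeval (fun i => C (C (v i) + C (v' i) * X) +
    C (C (w i) + C (w' i) * X) * X) F.1
  refine ⟨(Q.coeff k).coeff 1, ?_⟩
  convert! hasDerivAt_eval_coe (Q.coeff k) using 2 with s
  have e : restr F (v + (s : ℂ) • v') (w + (s : ℂ) • w') =
      Polynomial.mapAlgHom (Polynomial.aeval (s : ℂ)) Q := by
    rw [F.map_aeval, restr]
    congr 2
    funext i
    simp
    ring
  rw [e]
  change (Q.map _).coeff k = _
  rw [coeff_map]
  rfl

/-- Up to `K`, the derivative of the discriminant is that of the moving polynomial evaluated at `a`,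
in other words of `F` along the moving point `v + a w`. -/
theorem exists_hasDerivAt_disc_restr {v w : Fin 4 → ℂ} (hw : MvPolynomial.eval w F.1 ≠ 0) {a : ℂ}
    (ha : (restr F v w).roots.count a = 2) (hb : ∀ b, b ≠ a → (restr F v w).roots.count b ≤ 1) :
    ∃ K : ℂ, K ≠ 0 ∧ ∀ v' w' : Fin 4 → ℂ,
      HasDerivAt (fun s : ℝ => disc d (restr F (v + (s : ℂ) • v') (w + (s : ℂ) • w')))
        (K * dform F (v + a • w) (v' + a • w')) 0 := by
  obtain ⟨K, hK, h⟩ := exists_hasDerivAt_disc (natDegree_restr hw) ha hb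
  refine ⟨K, hK, fun v' w' => ?_⟩
  choose c hc using exists_hasDerivAt_coeff_restr F v v' w w'
  have h1 := h (fun s => restr F (v + (s : ℂ) • v') (w + (s : ℂ) • w')) (fun i => c i)
    (fun s => natDegree_restr_le _ _ _) (by simp) fun i => hc i
  convert! h1 using 2
  have h2 : HasDerivAt (fun s : ℝ => ∑ i : Fin (d + 1),
      (restr F (v + (s : ℂ) • v') (w + (s : ℂ) • w')).coeff i * a ^ (i : ℕ))
      (∑ i : Fin (d + 1), c i * a ^ (i : ℕ)) 0 := by
    refine HasDerivAt.fun_sum fun i _ => (hc i).mul_const _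
  refine HasDerivAt.unique ?_ h2
  refine (hasDerivAt_eval_line F (v + a • w) (v' + a • w')).congr_of_eventuallyEq
    (Filter.Eventually.of_forall fun s => ?_)
  have e : v + a • w + (s : ℂ) • (v' + a • w') = v + (s : ℂ) • v' + a • (w + (s : ℂ) • w') := by
    module
  change _ = MvPolynomial.eval (v + a • w + (s : ℂ) • (v' + a • w')) F.1
  rw [e, ← eval_restr, eval_eq_sum_range' (Nat.lt_succ_of_le (natDegree_restr_le F _ _)),
    Finset.sum_range]

end derivative

section submersion

variable {d : ℕ} {F : Form d}

/-- The linear part of `southChart`. -/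
def southLinear (x : Fin 5 → ℝ) : Fin 2 → ℍ[ℝ] := ![⟨x 4, 0, 0, 0⟩, ⟨x 0, x 1, x 2, x 3⟩]

theorem lineMap_southChart_add (x v : Fin 5 → ℝ) (s : ℝ) (c : Fin 2 → ℂ) :
    lineMap (southChart (x + s • v)) c =
      lineMap (southChart x) c + (s : ℂ) • lineMap (southLinear v) c := by
  have mk (x y : ℝ) : (⟨x, y⟩ : ℂ) = x + Complex.I * y := by
    rw [mul_comm]; exact Complex.mk_eq_add_mul_I x y
  funext i
  fin_cases i <;> simp [lineMap, southChart, southLinear, mk] <;> ring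

theorem chart_southChart_add (x v : Fin 5 → ℝ) (s : ℝ) (b : ℂ) :
    chart F (southChart (x + s • v)) b =
      restr F (lineMap (southChart x) ![0, 1] + (s : ℂ) • lineMap (southLinear v) ![0, 1])
        (lineMap (southChart x) ![1, b] + (s : ℂ) • lineMap (southLinear v) ![1, b]) := by
  rw [chart, lineMap_southChart_add, lineMap_southChart_add]

theorem lineMap_zero_one_add (p : Fin 2 → ℍ[ℝ]) (n a : ℂ) :
    lineMap p ![0, 1] + a • lineMap p ![1, n] = lineMap p ![a, 1 + n * a] := by
  rw [← map_smul, ← map_add]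
  congr 1
  funext i
  fin_cases i <;> simp [mul_comm]

theorem lineMap_southChart_zero (x : Fin 5 → ℝ) (c : Fin 2 → ℂ) :
    lineMap (southChart x) c 0 = (1 + x 4) * c 0 := by
  have mk (x y : ℝ) : (⟨x, y⟩ : ℂ) = x + Complex.I * y := by
    rw [mul_comm]; exact Complex.mk_eq_add_mul_I x y
  simp [lineMap, southChart, mk, mul_comm]

theorem lineMap_southChart_one (x : Fin 5 → ℝ) (c : Fin 2 → ℂ) :
    lineMap (southChart x) c 1 = (1 + x 4) * c 1 := by
  have mk (x y : ℝ) : (⟨x, y⟩ : ℂ) = x + Complex.I * y := by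
    rw [mul_comm]; exact Complex.mk_eq_add_mul_I x y
  simp [lineMap, southChart, mk, mul_comm]

/-- The vertical directions are attained by moving the line. -/
theorem exists_southLinear {c : Fin 2 → ℂ} (hc : c ≠ 0) {e : Fin 4 → ℂ} (h0 : e 0 = 0)
    (h1 : e 1 = 0) : ∃ v, lineMap (southLinear v) c = e := by
  have hq : quat (c 0) (c 1) ≠ 0 := by
    intro h
    obtain ⟨h2, h3⟩ := quat_inj (h.trans (show (0 : ℍ[ℝ]) = quat 0 0 by ext <;> simp [quat]))
    exact hc (by funext i; fin_cases i <;> assumption)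
  let r := (quat (c 0) (c 1))⁻¹ * quat (e 2) (e 3)
  refine ⟨![r.re, r.imI, r.imJ, r.imK, 0], toQuat_injective ?_⟩
  rw [toQuat_lineMap]
  funext i
  fin_cases i
  · have e0 : southLinear ![r.re, r.imI, r.imJ, r.imK, 0] 0 = 0 := by
      ext <;> simp [southLinear]
    change quat _ _ * southLinear _ 0 = quat _ _
    rw [e0, h0, h1, mul_zero]
    ext <;> simp [quat]
  · change quat _ _ * r = quat _ _
    rw [mul_inv_cancel_left₀ hq]

/-- At a simple tangency the discriminant is a submersion on the sphere. -/
theorem exists_direction {x : S4} (hx : 1 + x.1 4 ≠ 0) {n a : ℂ}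
    (hns : ∀ z : Fin 4 → ℂ, z 1 - n * z 0 ≠ 0 → MvPolynomial.eval z F.1 = 0 →
      ∃ h, (restr F z h).coeff 1 ≠ 0)
    (hw : MvPolynomial.eval (lineMap (southChart x.1) ![1, n]) F.1 ≠ 0)
    (ha : (chart F (southChart x.1) n).roots.count a = 2)
    (τ : ℝ) (t : ℂ) : ∃ v : Fin 5 → ℝ, ∑ i, x.1 i * v i = τ ∧
      dform F (lineMap (southChart x.1) ![a, 1 + n * a]) (lineMap (southLinear v) ![a, 1 + n * a]) =
        t := by
  have hx' : (1 + (x.1 4 : ℂ)) ≠ 0 := by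
    rw [← Complex.ofReal_one, ← Complex.ofReal_add]
    exact Complex.ofReal_ne_zero.2 hx
  set p := southChart x.1 with hp
  have hz := lineMap_zero_one_add p n a
  set z := lineMap p ![a, 1 + n * a] with hzdef
  have hFz : MvPolynomial.eval z F.1 = 0 := by
    rw [← hz, ← eval_restr]
    have : a ∈ (chart F p n).roots := by rw [← Multiset.count_pos]; omega
    exact (Polynomial.mem_roots'.1 this).2
  have hdz : dform F z z = 0 := dform_self F hFz
  have hdw : dform F z (lineMap p ![1, n]) = 0 := by
    rw [← hz]
    exact dform_of_two_le_count F hw ha.ge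
  obtain ⟨h, hh⟩ := hns z (by
    rw [hzdef, hp, lineMap_southChart_zero, lineMap_southChart_one]
    simpa [mul_add, mul_left_comm] using hx') hFz
  rw [restr_coeff_one_eq_dform] at hh
  -- `dF` kills `z` and, by tangency, the direction of the line. Subtracting suitable multiples of
  -- these from `h` removes its first two coordinates without changing `dF`.
  obtain ⟨e, he0, he1, he⟩ : ∃ e : Fin 4 → ℂ, e 0 = 0 ∧ e 1 = 0 ∧ dform F z e ≠ 0 := by
    let α := (h 1 - n * h 0) / (1 + (x.1 4 : ℂ))
    let β := h 0 / (1 + (x.1 4 : ℂ)) - α * a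
    refine ⟨h - α • z - β • lineMap p ![1, n], ?_, ?_, ?_⟩
    · simp only [Pi.sub_apply, Pi.smul_apply, smul_eq_mul, hzdef, hp, lineMap_southChart_zero]
      simp [β]
      field_simp
      ring
    · simp only [Pi.sub_apply, Pi.smul_apply, smul_eq_mul, hzdef, hp, lineMap_southChart_one]
      simp [β, α]
      field_simp
      ring
    · rwa [map_sub, map_sub, map_smul, map_smul, hdz, hdw, smul_zero, smul_zero, sub_zero, sub_zero]
  have hc : (![a, 1 + n * a] : Fin 2 → ℂ) ≠ 0 := by
    intro h0
    have e0 := congrFun h0 0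
    have e1 := congrFun h0 1
    simp at e0 e1
    rw [e0] at e1
    simp at e1
  obtain ⟨v₁, hv₁⟩ := exists_southLinear hc (e := (t / dform F z e) • e) (by simp [he0])
    (by simp [he1])
  -- Moving along `u` only rescales the homogeneous coordinates, so `z` moves along itself and `dF`
  -- is unaffected, while `x · u = 1 + x₄ ≠ 0`. This adjusts the component normal to the sphere
  -- independently.
  let u : Fin 5 → ℝ := ![x.1 0, x.1 1, x.1 2, x.1 3, 1 + x.1 4]
  have hu1 : ∑ i, x.1 i * u i = 1 + x.1 4 := by
    have := sum_sq_eq_one x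
    simp [Fin.sum_univ_five, u]
    linarith
  have hu2 : southLinear u = p := by
    rw [hp]; rfl
  let l := (τ - ∑ i, x.1 i * v₁ i) / (1 + x.1 4)
  have hlin : lineMap (southLinear (v₁ + l • u)) ![a, 1 + n * a] =
      (t / dform F z e) • e + (l : ℂ) • z := by
    rw [← hv₁, hzdef, ← hu2]
    have mk (x y : ℝ) : (⟨x, y⟩ : ℂ) = x + Complex.I * y := by
      rw [mul_comm]; exact Complex.mk_eq_add_mul_I x y
    generalize u = u
    funext i
    fin_cases i <;> simp [lineMap, southLinear, mk] <;> ring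
  refine ⟨v₁ + l • u, ?_, ?_⟩
  · simp only [Pi.add_apply, Pi.smul_apply, smul_eq_mul, mul_add, Finset.sum_add_distrib]
    have : ∑ i, x.1 i * (l * u i) = l * (1 + x.1 4) := by
      rw [← hu1, Finset.mul_sum]
      exact Finset.sum_congr rfl fun i _ => by ring
    rw [this]
    simp only [l]
    field_simp
    ring
  · rw [hlin, map_add, map_smul, map_smul, hdz, smul_zero, add_zero, smul_eq_mul,
      div_mul_cancel₀ _ he]

theorem exists_hasDerivAt_disc_chart {x : S4} (hx : 1 + x.1 4 ≠ 0) {n a : ℂ}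
    (hns : ∀ z : Fin 4 → ℂ, z 1 - n * z 0 ≠ 0 → MvPolynomial.eval z F.1 = 0 →
      ∃ h, (restr F z h).coeff 1 ≠ 0)
    (hw : MvPolynomial.eval (lineMap (southChart x.1) ![1, n]) F.1 ≠ 0)
    (ha : (chart F (southChart x.1) n).roots.count a = 2)
    (hb : ∀ b, b ≠ a → (chart F (southChart x.1) n).roots.count b ≤ 1) (τ : ℝ) (t : ℂ) :
    ∃ v : Fin 5 → ℝ, ∑ i, x.1 i * v i = τ ∧
      HasDerivAt (fun s : ℝ => disc d (chart F (southChart (x.1.ofLp + s • v)) n)) t 0 := by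
  obtain ⟨K, hK, hder⟩ := exists_hasDerivAt_disc_restr F hw ha hb
  obtain ⟨v, hv1, hv2⟩ := exists_direction hx hns hw ha τ (t / K)
  refine ⟨v, hv1, ?_⟩
  have h := hder (lineMap (southLinear v) ![0, 1]) (lineMap (southLinear v) ![1, n])
  rw [lineMap_zero_one_add, lineMap_zero_one_add, hv2, mul_div_cancel₀ _ hK] at h
  simpa only [chart_southChart_add] using h

end submersion

theorem surjective_of_forall_hasDerivAt {m c : ℕ}
    {f : EuclideanSpace ℝ (Fin m) → EuclideanSpace ℝ (Fin c)} {x : EuclideanSpace ℝ (Fin m)}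
    (hf : DifferentiableAt ℝ f x) (h : ∀ w : Fin c → ℝ, ∃ v : EuclideanSpace ℝ (Fin m), ∀ i,
      HasDerivAt (fun s : ℝ => f (x + s • v) i) (w i) 0) : Function.Surjective (fderiv ℝ f x) := by
  intro w
  obtain ⟨v, hv⟩ := h w
  refine ⟨v, ?_⟩
  ext i
  refine HasDerivAt.unique ?_ (hv i)
  have h1 : HasDerivAt (fun s : ℝ => x + s • v) v 0 := by
    simpa using ((hasDerivAt_id (0 : ℝ)).smul_const v).const_add x
  have h2 : HasFDerivAt f (fderiv ℝ f x) (x + (0 : ℝ) • v) := by simpa using hf.hasFDerivAt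
  have h3 := h2.comp_hasDerivAt (0 : ℝ) h1
  exact (EuclideanSpace.proj i : EuclideanSpace ℝ (Fin c) →L[ℝ] ℝ).hasFDerivAt.comp_hasDerivAt
    (0 : ℝ) h3

variable {d : ℕ} {F : Form d}

theorem IsGeneral.isSmoothSubmanifold_locus_two (hF : IsGeneral F) (hd : 4 ≤ d) :
    IsSmoothSubmanifold 2 (Subtype.val '' locus F ({2} + Multiset.replicate (d - 2) 1)) := by
  rintro _ ⟨x, hx, rfl⟩
  change alpha F (twistorLine x) = _ at hx
  -- Over the pole the line is transverse to the surface, so the stratum lies entirely in the south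
  -- chart.
  have hx4 : 1 + x.1 4 ≠ 0 := by
    intro h
    have h2 : 1 - x.1 4 ≠ 0 := fun h2 => by linarith
    have h0 := sphereVec_northChart x h2
    have e : northChart x.1 = ((1 - x.1 4 : ℝ) : ℍ[ℝ]) • ![0, 1] := by
      have h3 := southChart_eq_zero h
      have h4 := congrFun h3 1
      simp only [southChart] at h4
      have g0 := congrArg (fun q : ℍ[ℝ] => q.re) h4
      have g1 := congrArg (fun q : ℍ[ℝ] => q.imI) h4
      have g2 := congrArg (fun q : ℍ[ℝ] => q.imJ) h4
      have g3 := congrArg (fun q : ℍ[ℝ] => q.imK) h4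
      simp at g0 g1 g2 g3
      funext i
      fin_cases i <;> ext <;> simp [northChart, g0, g1, g2, g3]
    rw [e, sphereVec_smul fun h3 => h2 (congrArg (fun q : ℍ[ℝ] => q.re) h3)] at h0
    exact two_ne (hx.symm.trans (hF.alpha_infinity h0))
  have hp := southChart_ne_zero hx4
  have hpx := sphereVec_southChart x hx4
  obtain ⟨n, hn⟩ := hF.exists_eval_ne_zero hp hpx
  have hx' := hx
  rw [alpha_twistorLine hp hpx hn] at hx'
  obtain ⟨a, ha, hb⟩ := exists_of_multiplicities_eq_two hx'
  obtain ⟨D, hD⟩ := exists_disc_chart_eq_eval F exists_lineMap_southChart ((n : ℕ) : ℂ)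
  obtain ⟨A, B, hAB⟩ := MvPolynomial.exists_re_im D
  obtain ⟨W, hW⟩ := exists_lineMap_southChart ![1, ((n : ℕ) : ℂ)]
  -- Three real equations in `ℝ⁵`: the sphere and the two parts of the discriminant.
  let S : MvPolynomial (Fin 5) ℝ := ∑ i, MvPolynomial.X i ^ 2 - 1
  let f : EuclideanSpace ℝ (Fin 5) → EuclideanSpace ℝ (Fin 3) := fun y =>
    WithLp.toLp 2 fun k => MvPolynomial.eval (fun i => y i) (![S, A, B] k)
  have hf : ContDiff ℝ ∞ f := by
    rw [contDiff_euclidean]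
    exact fun k => contDiff_mvPolynomial_eval _
  have hfD (y : EuclideanSpace ℝ (Fin 5)) : disc d (chart F (southChart y) ((n : ℕ) : ℂ)) =
      ⟨f y 1, f y 2⟩ := by
    rw [← hD, hAB]; rfl
  have hf0 (y : EuclideanSpace ℝ (Fin 5)) : f y 0 = ∑ i, y i ^ 2 - 1 := by
    change MvPolynomial.eval _ S = _
    simp [S]
  have hsurj : Function.Surjective (fderiv ℝ f x.1) := by
    refine surjective_of_forall_hasDerivAt (hf.differentiable (by simp) _) fun w => ?_
    obtain ⟨v, hv1, h1⟩ := exists_hasDerivAt_disc_chart hx4 (hF.nonsingular n) hn ha hb (w 0 / 2)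
      (⟨w 1, w 2⟩ : ℂ)
    have h1' : (fun s : ℝ => disc d (chart F (southChart (x.1.ofLp + s • v)) ((n : ℕ) : ℂ))) =
        fun s : ℝ => ⟨f (x.1 + s • WithLp.toLp 2 v) 1, f (x.1 + s • WithLp.toLp 2 v) 2⟩ :=
      funext fun s => hfD (x.1 + s • WithLp.toLp 2 v)
    rw [h1'] at h1
    refine ⟨WithLp.toLp 2 v, fun i => ?_⟩
    fin_cases i
    · have h2 : HasDerivAt (fun s : ℝ => ∑ i, (x.1 i + s * v i) ^ 2 - 1)
          (∑ i, 2 * (x.1 i * v i)) 0 := by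
        refine HasDerivAt.sub_const _ (HasDerivAt.fun_sum fun i _ => ?_)
        have h3 : HasDerivAt (fun s : ℝ => x.1 i + s * v i) (v i) 0 := by
          simpa using ((hasDerivAt_id (0 : ℝ)).mul_const (v i)).const_add (x.1 i)
        convert! h3.pow 2 using 1
        simp
        ring
      rw [← Finset.mul_sum, hv1, mul_div_cancel₀ _ two_ne_zero] at h2
      exact h2.congr_of_eventuallyEq (Filter.Eventually.of_forall fun s => hf0 _)
    · have h2 := Complex.reCLM.hasFDerivAt.comp_hasDerivAt (0 : ℝ) h1
      exact h2
    · have h2 := Complex.imCLM.hasFDerivAt.comp_hasDerivAt (0 : ℝ) h1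
      exact h2
  obtain ⟨U, hUo, hxU, hU⟩ := exists_isOpen_surjective_fderiv hf hsurj
  obtain ⟨A', B', hAB'⟩ := MvPolynomial.exists_re_im (MvPolynomial.aeval W F.1)
  have hw (y : EuclideanSpace ℝ (Fin 5)) :
      MvPolynomial.eval (lineMap (southChart y) ![1, ((n : ℕ) : ℂ)]) F.1 =
      ⟨MvPolynomial.eval (fun i => y i) A', MvPolynomial.eval (fun i => y i) B'⟩ := by
    rw [← hAB']
    refine Eq.trans ?_ (F.map_aeval (MvPolynomial.aeval fun j => ((y j : ℝ) : ℂ)) W).symm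
    change MvPolynomial.aeval _ _ = _
    congr 2
    funext i
    exact (hW _ _).symm
  have hwo : IsOpen {y : EuclideanSpace ℝ (Fin 5) |
      MvPolynomial.eval (lineMap (southChart y) ![1, ((n : ℕ) : ℂ)]) F.1 ≠ 0} := by
    refine isOpen_ne_fun ?_ continuous_const
    simp only [hw, Complex.mk_eq_add_mul_I]
    have hA' := (contDiff_mvPolynomial_eval A').continuous
    have hB' := (contDiff_mvPolynomial_eval B').continuous
    fun_prop
  have h4o : IsOpen {y : EuclideanSpace ℝ (Fin 5) | 1 + y 4 ≠ 0} :=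
    isOpen_ne_fun (by fun_prop) continuous_const
  -- Away from the finite set `T`, and where the chart is usable, zero discriminant on the sphere
  -- characterises the stratum.
  set T := locus F ({2, 2} + Multiset.replicate (d - 4) 1) ∪
    locus F ({3} + Multiset.replicate (d - 3) 1) with hT
  have hTc : IsClosed (Subtype.val '' T) :=
    ((hF.finite_locus_two_two.union hF.finite_locus_three).image _).isClosed
  refine ⟨3, rfl, U ∩ {y | MvPolynomial.eval (lineMap (southChart y) ![1, ((n : ℕ) : ℂ)]) F.1 ≠ 0} ∩
    {y | 1 + y 4 ≠ 0} ∩ (Subtype.val '' T)ᶜ, f, ((hUo.inter hwo).inter h4o).inter hTc.isOpen_compl,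
    ⟨⟨⟨hxU, hn⟩, hx4⟩, ?_⟩, hf.contDiffOn, fun y hy => hU y hy.1.1.1, ?_⟩
  · rintro ⟨x', hx'T, h⟩
    obtain rfl := Subtype.ext h
    exact ((hF.alpha_eq_two_iff hd _).1 hx).2 hx'T
  · rintro y ⟨⟨⟨-, hyw⟩, hy4⟩, hyT⟩
    have key (q : S4) (hq : q.1 = y) : q ∈ locus F ({2} + Multiset.replicate (d - 2) 1) ↔
        disc d (chart F (southChart y) ((n : ℕ) : ℂ)) = 0 := by
      subst hq
      rw [disc_chart_eq_zero_iff (by omega) (southChart_ne_zero hy4) (sphereVec_southChart q hy4) hyw]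
      refine (hF.alpha_eq_two_iff hd q).trans (and_iff_left fun h => hyT ⟨q, h, rfl⟩)
    constructor
    · rintro ⟨q, hq, rfl⟩
      have h1 := (key q rfl).1 hq
      rw [hfD, Complex.ext_iff] at h1
      have h0 : f q.1 0 = 0 := by
        have := sum_sq_eq_one q
        rw [hf0, Fin.sum_univ_five]
        linarith
      ext i
      fin_cases i
      exacts [h0, h1.1, h1.2]
    · intro h
      have hq : y ∈ Metric.sphere (0 : EuclideanSpace ℝ (Fin 5)) 1 := by
        rw [mem_sphere_zero_iff_norm, ← sq_eq_sq₀ (norm_nonneg _) zero_le_one,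
          EuclideanSpace.real_norm_sq_eq, one_pow]
        have := hf0 y
        rw [h] at this
        exact (sub_eq_zero.1 this.symm)
      refine ⟨⟨y, hq⟩, (key ⟨y, hq⟩ rfl).2 ?_, rfl⟩
      rw [hfD, h]
      rfl

end Twistor

namespace Twistor

/-! ### Existence of tangent twistor lines -/

section roots

open Polynomial

variable {d : ℕ} {F : Form d}

theorem exists_enumeration {w : Fin 4 → ℂ} (hw : MvPolynomial.eval w F.1 ≠ 0) (v : Fin 4 → ℂ) :
    ∃ r : Fin d → ℂ, ∀ Z : ℂ,
      MvPolynomial.eval (v + Z • w) F.1 = MvPolynomial.eval w F.1 * ∏ i, (Z - r i) := by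
  have hc := card_roots_restr (v := v) hw
  obtain ⟨l, hl⟩ : ∃ l : List ℂ, (l : Multiset ℂ) = (restr F v w).roots := Quot.exists_rep _
  have hld : l.length = d := by rw [← hc, ← hl, Multiset.coe_card]
  subst hld
  refine ⟨l.get, fun Z => ?_⟩
  have h := eval_eq_prod_roots (v := v) hw 1 Z
  rw [one_smul] at h
  rw [h, ← hl, Multiset.map_coe, Multiset.prod_coe]
  congr 1
  simp only [mul_one]
  conv_lhs => rw [← List.ofFn_get l]
  rw [List.map_ofFn, List.prod_ofFn]
  rfl

theorem roots_eq_of_eval_eq {v w : Fin 4 → ℂ} (hw : MvPolynomial.eval w F.1 ≠ 0) {r : Fin d → ℂ}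
    (hr : ∀ Z : ℂ, MvPolynomial.eval (v + Z • w) F.1 =
      MvPolynomial.eval w F.1 * ∏ i, (Z - r i)) :
    (restr F v w).roots = Finset.univ.val.map r := by
  have e : restr F v w = C (MvPolynomial.eval w F.1) *
      ((Finset.univ.val.map r).map fun a => X - C a).prod := by
    refine Polynomial.funext fun Z => ?_
    rw [eval_restr, hr, Multiset.map_map, eval_mul, eval_C]
    congr 1
    change _ = (∏ i, (X - C (r i))).eval Z
    rw [eval_prod]
    simp
  rw [e, roots_C_mul _ hw, roots_multiset_prod_X_sub_C]

/-- A symmetric function of the intersection points of a hypersurface with a moving line through a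
fixed point is continuous. -/
theorem continuous_prod_roots {w : Fin 4 → ℂ} (hw : MvPolynomial.eval w F.1 ≠ 0)
    {p : ℂ → Fin 4 → ℂ} (hp : Continuous p) {G : (Fin 4 → ℂ) → ℂ} (hG : Continuous G) :
    Continuous fun b => ((restr F (p b) w).roots.map fun Z => G (p b + Z • w)).prod := by
  have hFc : Continuous fun z : Fin 4 → ℂ => MvPolynomial.eval z F.1 :=
    MvPolynomial.continuous_eval F.1
  -- Parameters together with an ordering of the roots. The symmetric product is visibly continuous
  -- upstairs and descends because the projection to `ℂ` is proper and surjective, hence a quotient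
  -- map.
  let E : Set (ℂ × (Fin d → ℂ)) := {x | ∀ Z : ℂ, MvPolynomial.eval (p x.1 + Z • w) F.1 =
    MvPolynomial.eval w F.1 * ∏ i, (Z - x.2 i)}
  have hE : IsClosed E := by
    simp only [E, Set.ofPred_forall]
    refine isClosed_iInter fun Z => isClosed_eq ?_ ?_
    · exact hFc.comp (by fun_prop)
    · fun_prop
  obtain ⟨ε, hε, hball⟩ := Metric.mem_nhds_iff.1
    ((isOpen_ne_fun hFc continuous_const).mem_nhds hw)
  -- A large root `Z` would give a zero `w + Z⁻¹ p` of `F` in the ball around `w` where `F` has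
  -- none.
  have hbound (x : E) (i : Fin d) : ‖x.1.2 i‖ ≤ ‖p x.1.1‖ / ε := by
    set Z := x.1.2 i with hZ
    by_cases hZ0 : Z = 0
    · rw [hZ0, norm_zero]; positivity
    have h0 : MvPolynomial.eval (p x.1.1 + Z • w) F.1 = 0 := by
      rw [x.2 Z, Finset.prod_eq_zero (Finset.mem_univ i) (by simp [hZ]), mul_zero]
    have h1 : w + Z⁻¹ • p x.1.1 ∉ Metric.ball w ε := by
      intro hmem
      refine hball hmem ?_
      have e : w + Z⁻¹ • p x.1.1 = Z⁻¹ • (p x.1.1 + Z • w) := by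
        rw [smul_add, smul_smul, inv_mul_cancel₀ hZ0, one_smul, add_comm]
      rw [e, Form.eval_smul, h0, mul_zero]
    rw [Metric.mem_ball, not_lt, dist_eq_norm, add_sub_cancel_left, norm_smul, norm_inv] at h1
    have h2 : 0 < ‖Z‖ := norm_pos_iff.2 hZ0
    rw [le_div_iff₀ hε]
    rw [inv_mul_eq_div, le_div_iff₀ h2] at h1
    linarith
  let π : E → ℂ := fun x => x.1.1
  have hπc : Continuous π := continuous_fst.comp continuous_subtype_val
  have hπs : Function.Surjective π := fun b => by
    obtain ⟨r, hr⟩ := exists_enumeration hw (p b)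
    exact ⟨⟨(b, r), hr⟩, rfl⟩
  have hπp : IsProperMap π := by
    rw [isProperMap_iff_isCompact_preimage]
    refine ⟨hπc, fun K hK => ?_⟩
    obtain ⟨R, hR⟩ := hK.exists_bound_of_continuousOn hp.continuousOn
    have hcomp : IsCompact (K ×ˢ (Set.univ.pi fun _ : Fin d => Metric.closedBall (0 : ℂ) (R / ε))) :=
      hK.prod (isCompact_univ_pi fun _ => isCompact_closedBall _ _)
    rw [Subtype.isCompact_iff]
    refine (hcomp.inter_right hE).of_isClosed_subset ?_ ?_
    · have e : Subtype.val '' (π ⁻¹' K) = E ∩ Prod.fst ⁻¹' K := by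
        ext x
        constructor
        · rintro ⟨y, hy, rfl⟩; exact ⟨y.2, hy⟩
        · rintro ⟨h1, h2⟩; exact ⟨⟨x, h1⟩, h2, rfl⟩
      rw [e]
      exact hE.inter (hK.isClosed.preimage continuous_fst)
    · rintro _ ⟨x, hx, rfl⟩
      refine ⟨⟨hx, fun i _ => ?_⟩, x.2⟩
      rw [mem_closedBall_zero_iff]
      refine (hbound x i).trans ?_
      gcongr
      exact hR _ hx
  have hq := hπp.isClosedMap.isQuotientMap hπc hπs
  rw [hq.continuous_iff]
  have e : (fun b => ((restr F (p b) w).roots.map fun Z => G (p b + Z • w)).prod) ∘ π =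
      fun x : E => ∏ i, G (p x.1.1 + x.1.2 i • w) := by
    funext x
    simp only [Function.comp_def, π]
    rw [roots_eq_of_eval_eq hw x.2, Multiset.map_map]
    rfl
  rw [e]
  fun_prop

end roots

/-- A nowhere vanishing continuous function on the plane has winding number zero. -/
theorem eq_zero_of_eq_pow_on_circle {f : ℂ → ℂ} (hf : Continuous f) (h0 : ∀ z, f z ≠ 0) {m : ℕ}
    (hm : ∀ z : ℂ, ‖z‖ = 1 → f z = z ^ m * f 1) : m = 0 := by
  have hsc : IsSimplyConnected (Set.univ : Set ℂ) := by
    have : ContractibleSpace (Set.univ : Set ℂ) :=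
      convex_univ.contractibleSpace ⟨0, Set.mem_univ _⟩
    exact (inferInstance : SimplyConnectedSpace (Set.univ : Set ℂ))
  obtain ⟨g, hg, hgf⟩ := Complex.exists_continuousOn_eqOn_exp_comp hsc isOpen_univ hf.continuousOn
    (by rintro ⟨z, -, hz⟩; exact h0 z hz)
  rw [continuousOn_univ] at hg
  have hexp (z : ℂ) : Complex.exp (g z) = f z := hgf (Set.mem_univ z)
  let e (θ : ℝ) : ℂ := Complex.exp (θ * Complex.I)
  have he : Continuous e := by fun_prop
  -- With `f = exp ∘ g`, the hypothesis on the circle makes `k` integer valued, hence constant by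
  -- continuity. A full turn restores `g (e θ)`, so the change `-m` of `k` is zero.
  let k (θ : ℝ) : ℂ := (g (e θ) - m * (θ * Complex.I) - g 1) / (2 * Real.pi * Complex.I)
  have hk : Continuous k := by fun_prop
  have hkint (θ : ℝ) : ∃ n : ℤ, k θ = n := by
    have h1 : Complex.exp (g (e θ)) = Complex.exp (m * (θ * Complex.I) + g 1) := by
      rw [hexp, hm _ (Complex.norm_exp_ofReal_mul_I θ), Complex.exp_add, hexp, Complex.exp_nat_mul]
    obtain ⟨n, hn⟩ := Complex.exp_eq_exp_iff_exists_int.1 h1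
    refine ⟨n, ?_⟩
    simp only [k]
    rw [hn]
    have := Complex.two_pi_I_ne_zero
    field_simp
    ring
  choose n hn using hkint
  have hncont : Continuous n := by
    rw [Int.isClosedEmbedding_coe_real.isEmbedding.continuous_iff]
    have h : (Int.cast ∘ n : ℝ → ℝ) = fun θ => (k θ).re := by
      funext θ; rw [hn]; simp
    rw [h]
    exact Complex.continuous_re.comp hk
  have hconst : n (2 * Real.pi) = n 0 := (isPreconnected_univ.constant hncont.continuousOn
    (Set.mem_univ _) (Set.mem_univ _))
  have h1 : k (2 * Real.pi) = k 0 := by rw [hn, hn, hconst]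
  have e0 : e 0 = 1 := by simp [e]
  have e1 : e (2 * Real.pi) = 1 := by
    simp only [e]
    push_cast
    exact Complex.exp_two_pi_mul_I
  simp only [k, e0, e1] at h1
  have := Complex.two_pi_I_ne_zero
  push_cast at h1
  field_simp at h1
  simpa using h1

/-! ### Tangency as a continuous function and the winding number argument. -/

section antipode

variable {d : ℕ} {F : Form d}

open ComplexConjugate in
/-- The real structure whose invariant lines are the twistor lines. -/
noncomputable def antipode (z : Fin 4 → ℂ) : Fin 4 → ℂ := ![-conj (z 1), conj (z 0), -conj (z 3), conj (z 2)]

theorem lineMap_toQuat_zero_one (z : Fin 4 → ℂ) : lineMap (toQuat z) ![0, 1] = antipode z := by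
  funext i
  fin_cases i <;> apply Complex.ext <;> simp [lineMap, toQuat, quat, antipode]

theorem lineMap_toQuat_one_zero (z : Fin 4 → ℂ) : lineMap (toQuat z) ![1, 0] = z := by
  funext i
  fin_cases i <;> apply Complex.ext <;> simp [lineMap, toQuat, quat]

theorem continuous_antipode : Continuous antipode := by
  refine continuous_pi fun i => ?_
  fin_cases i <;> simp [antipode] <;> fun_prop

/-- The derivative of a form along the twistor line. -/
noncomputable def tangency (F : Form d) (z : Fin 4 → ℂ) : ℂ := dform F z (antipode z)

theorem continuous_tangency (F : Form d) : Continuous (tangency F) := by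
  change Continuous fun z => ∑ i, antipode z i * MvPolynomial.eval z (MvPolynomial.pderiv i F.1)
  refine continuous_finsetSum _ fun i _ => ?_
  exact ((continuous_apply i).comp continuous_antipode).mul (MvPolynomial.continuous_eval _)

theorem dform_smul_smul (c : ℂ) (z h : Fin 4 → ℂ) : dform F (c • z) (c • h) = c ^ d * dform F z h := by
  rw [← restr_coeff_one_eq_dform, restr_smul, Polynomial.coeff_C_mul, restr_coeff_one_eq_dform]

/-- The antipode is antilinear and `dF` has degree `d - 1` in the point, so the factor is `c ^ (d -
1)` times the conjugate of `c`, which is `c ^ (d - 2)` on the unit circle. -/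
theorem tangency_smul (hd : 2 ≤ d) {c : ℂ} (hc : ‖c‖ = 1) (z : Fin 4 → ℂ) :
    tangency F (c • z) = c ^ (d - 2) * tangency F z := by
  have hc0 : c ≠ 0 := by rintro rfl; simp at hc
  have hcc : c * (starRingEnd ℂ) c = 1 := by
    rw [Complex.mul_conj, Complex.normSq_eq_norm_sq, hc]; simp
  have e : antipode (c • z) = (starRingEnd ℂ) c • antipode z := by
    funext i
    fin_cases i <;> simp [antipode]
  have e2 : (starRingEnd ℂ) c • antipode z = ((starRingEnd ℂ) c) ^ 2 • c • antipode z := by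
    rw [smul_smul]
    congr 1
    linear_combination -(starRingEnd ℂ) c * hcc
  rw [tangency, e, e2, map_smul, dform_smul_smul, smul_eq_mul, tangency, ← mul_assoc]
  congr 1
  obtain ⟨k, rfl⟩ : ∃ k, d = k + 2 := ⟨d - 2, by omega⟩
  rw [Nat.add_sub_cancel, pow_add]
  linear_combination (c * (starRingEnd ℂ) c + 1) * c ^ k * hcc

-- The two conditions say that `F(z + t jz)` has a double zero at `t = 0`, and `z`, `jz` span the
-- twistor line through `z`.
open Polynomial in
theorem alpha_ne_of_tangency (hF : IsGeneral F) {z : Fin 4 → ℂ} (hz : z ≠ 0)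
    (hFz : MvPolynomial.eval z F.1 = 0) (hG : tangency F z = 0) :
    alpha F (twistorLine (proj (Projectivization.mk ℂ z hz))) ≠ Multiset.replicate d 1 := by
  have hp := toQuat_ne_zero hz
  have hpq : sphereVec (toQuat z) = (proj (Projectivization.mk ℂ z hz)).1 := rfl
  obtain ⟨n, hn⟩ := hF.exists_eval_ne_zero hp hpq
  rw [alpha_twistorLine hp hpq hn, Ne, multiplicities_eq_replicate_iff (card_roots_chart hn),
    Multiset.nodup_iff_count_le_one]
  intro hle
  generalize ((n : ℕ) : ℂ) = n at hn hle
  have hw : lineMap (toQuat z) ![1, n] = z + n • antipode z := by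
    rw [← lineMap_toQuat_zero_one]
    conv_rhs => enter [1]; rw [← lineMap_toQuat_one_zero z]
    rw [← map_smul, ← map_add]
    congr 1
    funext i
    fin_cases i <;> simp
  have hn0 : n ≠ 0 := by
    rintro rfl
    rw [hw, zero_smul, add_zero] at hn
    exact hn hFz
  have h := contactOrder_eq_count (v := antipode z) hn (c := -n) (β := -n⁻¹) (a := 1) (b := 0)
    (by simpa using hn0) (by simpa using hn0)
  -- In the chart of slope `n` the point `z` sits at the parameter `-1/n`; here `n ≠ 0` because the
  -- point at infinity of the chart is off the surface.
  have e : -n • (antipode z + -n⁻¹ • lineMap (toQuat z) ![1, n]) = z := by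
    rw [hw, smul_add, smul_smul, neg_mul_neg, mul_inv_cancel₀ hn0]
    module
  rw [e, one_smul, zero_smul, add_zero] at h
  have h1 := hle (-n⁻¹)
  rw [chart, lineMap_toQuat_zero_one, ← h] at h1
  change (restr F z (antipode z)).rootMultiplicity 0 ≤ 1 at h1
  have hne : restr F z (antipode z) ≠ 0 := by
    intro h0
    refine hn ?_
    rw [hw, ← eval_restr, h0, eval_zero]
  have h2 : 2 ≤ (restr F z (antipode z)).rootMultiplicity 0 := by
    rw [le_rootMultiplicity_iff hne, C_0, sub_zero, X_pow_dvd_iff]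
    intro k hk
    interval_cases k
    · rw [restr_coeff_zero, hFz]
    · rw [restr_coeff_one_eq_dform]; exact hG
  omega

theorem IsGeneral.finite_points_inter_surface (hF : IsGeneral F) (q : S4) :
    (points (twistorLine q) ∩ surface F).Finite := by
  have key (p : Fin 2 → ℍ[ℝ]) (hp : p ≠ 0) (hpq : sphereVec p = q.1) :
      (points (twistorLine q) ∩ surface F).Finite := by
    obtain ⟨n, hn⟩ := hF.exists_eval_ne_zero hp hpq
    rw [points_inter_surface (linearIndependent_lineMap hp _) (twistorLine_eq_span hp hpq _) hn]
    exact (Finset.finite_toSet _).image _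
  obtain ⟨r, hr⟩ | hq := sphereVec_cases q
  · exact key _ (affine_ne_zero _) hr
  · exact key _ infinity_ne_zero hq

/-- A form cannot be free of tangent twistor lines along a plane. -/
theorem exists_tangency_eq_zero (hd : 3 ≤ d) {u v w : Fin 4 → ℂ}
    (hw : MvPolynomial.eval w F.1 ≠ 0)
    (hind : ∀ x y Z : ℂ, x • u + y • v + Z • w = 0 → x = 0 ∧ y = 0) :
    ∃ x y Z : ℂ, x • u + y • v + Z • w ≠ 0 ∧ MvPolynomial.eval (x • u + y • v + Z • w) F.1 = 0 ∧
      tangency F (x • u + y • v + Z • w) = 0 := by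
  by_contra! hcon
  -- The lines of the plane through `w`, indexed by `b ∈ ℂ`. On the unit circle the `v` term is gone
  -- and `p c = c u`, so `f` is homogeneous there; inside, this term keeps `p` away from zero.
  let p (b : ℂ) : Fin 4 → ℂ := b • u + ((max 0 (1 - ‖b‖) : ℝ) : ℂ) • v
  have hp : Continuous p := by fun_prop
  let f (b : ℂ) : ℂ := ((restr F (p b) w).roots.map fun Z => tangency F (p b + Z • w)).prod
  have hf : Continuous f := continuous_prod_roots hw hp (continuous_tangency F)
  have hf0 (b : ℂ) : f b ≠ 0 := by
    refine Multiset.prod_ne_zero fun h => ?_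
    obtain ⟨Z, hZ, h0⟩ := Multiset.mem_map.1 h
    refine hcon _ _ Z (fun h1 => ?_) ?_ h0
    · obtain ⟨h2, h3⟩ := hind _ _ _ h1
      rw [h2] at h3
      simp at h3
    · have := (Polynomial.mem_roots'.1 hZ).2
      rwa [Polynomial.IsRoot.def, eval_restr] at this
  have hpc (c : ℂ) (hc : ‖c‖ = 1) : p c = c • u := by simp [p, hc]
  obtain ⟨r, hr⟩ := exists_enumeration hw u
  have hf1 (c : ℂ) (hc : ‖c‖ = 1) : f c = c ^ ((d - 2) * d) * ∏ i, tangency F (u + r i • w) := by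
    have hc0 : c ≠ 0 := by rintro rfl; simp at hc
    have hroots : (restr F (p c) w).roots = Finset.univ.val.map fun i => c * r i := by
      refine roots_eq_of_eval_eq hw fun Z => ?_
      have e : p c + Z • w = c • (u + (c⁻¹ * Z) • w) := by
        rw [hpc c hc, smul_add, smul_smul, mul_inv_cancel_left₀ hc0]
      have e2 : ∏ i, (Z - c * r i) = c ^ d * ∏ i, (c⁻¹ * Z - r i) := by
        have : c ^ d = ∏ _i : Fin d, c := by simp
        rw [this, ← Finset.prod_mul_distrib]
        refine Finset.prod_congr rfl fun i _ => ?_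
        field_simp
      rw [e, Form.eval_smul, hr, e2]
      ring
    simp only [f]
    rw [hroots, Multiset.map_map]
    change ∏ i, tangency F (p c + (c * r i) • w) = _
    have e (i : Fin d) : tangency F (p c + (c * r i) • w) =
        c ^ (d - 2) * tangency F (u + r i • w) := by
      rw [← tangency_smul (by omega) hc, smul_add, smul_smul, hpc c hc]
    rw [Finset.prod_congr rfl fun i _ => e i, Finset.prod_mul_distrib]
    simp [pow_mul]
  -- Each of the `d` roots contributes `c ^ (d - 2)`.
  have hm := eq_zero_of_eq_pow_on_circle hf hf0 (m := (d - 2) * d) fun c hc => by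
    rw [hf1 c hc, hf1 1 (by simp), one_pow, one_mul]
  have : 0 < (d - 2) * d := Nat.mul_pos (by omega) (by omega)
  omega

theorem exists_basis_of_dual (l : Module.Dual ℂ (Fin 4 → ℂ)) (w : Fin 4 → ℂ) :
    ∃ u v : Fin 4 → ℂ, l u = 0 ∧ l v = 0 ∧
      ∀ x y Z : ℂ, x • u + y • v + Z • w = 0 → x = 0 ∧ y = 0 := by
  have hker : 3 ≤ Module.finrank ℂ (LinearMap.ker l) := by
    have h1 := l.finrank_range_add_finrank_ker
    have h2 := (LinearMap.range l).finrank_le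
    simp at h1 h2
    omega
  have key (S : Finset (Fin 4 → ℂ)) (hS : S.card ≤ 2) :
      ∃ u ∈ LinearMap.ker l, u ∉ Submodule.span ℂ (S : Set (Fin 4 → ℂ)) := by
    by_contra! hcon
    have h1 := Submodule.finrank_mono (s := LinearMap.ker l)
      (t := Submodule.span ℂ (S : Set (Fin 4 → ℂ))) hcon
    have h2 := finrank_span_finset_le_card (R := ℂ) S
    rw [Set.finrank] at h2
    omega
  classical
  obtain ⟨u, hu, hu'⟩ := key {w} (by simp)
  obtain ⟨v, hv, hv'⟩ := key {u, w} Finset.card_le_two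
  rw [Finset.coe_singleton, Submodule.mem_span_singleton] at hu'
  rw [Finset.coe_pair, Submodule.mem_span_pair] at hv'
  refine ⟨u, v, hu, hv, fun x y Z h => ?_⟩
  have hy : y = 0 := by
    by_contra hy
    refine hv' ⟨-(y⁻¹ * x), -(y⁻¹ * Z), ?_⟩
    have : y⁻¹ • (x • u + y • v + Z • w) = 0 := by rw [h, smul_zero]
    rw [smul_add, smul_add, smul_smul, smul_smul, smul_smul, inv_mul_cancel₀ hy, one_smul] at this
    rw [← sub_eq_zero, ← neg_eq_zero, ← this]
    module
  refine ⟨?_, hy⟩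
  by_contra hx
  refine hu' ⟨-(x⁻¹ * Z), ?_⟩
  have : x⁻¹ • (x • u + y • v + Z • w) = 0 := by rw [h, smul_zero]
  rw [hy, zero_smul, add_zero, smul_add, smul_smul, smul_smul, inv_mul_cancel₀ hx, one_smul] at this
  rw [← sub_eq_zero, ← neg_eq_zero, ← this]
  module

theorem IsGeneral.nonempty_locus_two (hF : IsGeneral F) (hd : 4 ≤ d) :
    (locus F ({2} + Multiset.replicate (d - 2) 1)).Nonempty := by
  by_contra hempty
  rw [Set.not_nonempty_iff_eq_empty] at hempty
  set T := locus F ({2, 2} + Multiset.replicate (d - 4) 1) ∪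
    locus F ({3} + Multiset.replicate (d - 3) 1) with hT
  have hTf : T.Finite := hF.finite_locus_two_two.union hF.finite_locus_three
  have hmem (q : S4) (hq : alpha F (twistorLine q) ≠ Multiset.replicate d 1) : q ∈ T := by
    by_contra h
    have := (hF.alpha_eq_two_iff hd q).2 ⟨hq, h⟩
    have h1 : q ∈ locus F ({2} + Multiset.replicate (d - 2) 1) := this
    rw [hempty] at h1
    exact h1
  let q₀ : S4 := ⟨sphereVec ![0, 1], sphereVec_mem infinity_ne_zero⟩
  -- Besides all possible tangency points, `B` contains the surface points on the line over
  -- infinity. So the zero `w` of `l` on that line is off the surface and can serve as the centre of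
  -- projection.
  let B : Set CP3 := ⋃ q ∈ insert q₀ T, points (twistorLine q) ∩ surface F
  have hB : B.Finite := (hTf.insert q₀).biUnion fun q _ => hF.finite_points_inter_surface q
  have := hB.to_subtype
  -- A plane that avoids the finite set `B`.
  obtain ⟨l, hl⟩ := Module.exists_dual_forall_apply_ne_zero (K := ℂ) (fun b : B => b.1.rep)
    fun b => b.1.rep_nonzero
  have hl' (z : Fin 4 → ℂ) (hz : z ≠ 0) (hzB : Projectivization.mk ℂ z hz ∈ B) : l z ≠ 0 := by
    obtain ⟨a, ha⟩ := Projectivization.exists_smul_eq_mk_rep ℂ z hz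
    have h1 := hl ⟨_, hzB⟩
    simp only [← ha] at h1
    intro h2
    refine h1 ?_
    change l ((a : ℂ) • z) = 0
    rw [map_smul, h2, smul_zero]
  have hmemB (z : Fin 4 → ℂ) (hz : z ≠ 0) (hFz : MvPolynomial.eval z F.1 = 0) {q : S4}
      (hq : q ∈ insert q₀ T) (hzq : z ∈ twistorLine q) : Projectivization.mk ℂ z hz ∈ B := by
    refine Set.mem_biUnion hq ⟨?_, (mem_surface_mk F hz).2 hFz⟩
    change (Projectivization.mk ℂ z hz).submodule ≤ _
    rwa [Projectivization.submodule_mk, Submodule.span_singleton_le_iff_mem]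
  obtain ⟨c, hc, hc0⟩ := (Submodule.ne_bot_iff _).1 (LinearMap.ker_ne_bot_of_finrank_lt
    (f := l.comp (lineMap ![0, 1])) (by simp))
  set w := lineMap ![0, 1] c with hwdef
  have hw0 : w ≠ 0 := fun h => hc0 (lineMap_injective infinity_ne_zero (h.trans (map_zero _).symm))
  have hlw : l w = 0 := hc
  have hw : MvPolynomial.eval w F.1 ≠ 0 := fun h => hl' w hw0 (hmemB w hw0 h
    (Set.mem_insert q₀ T) ((mem_twistorLine_iff infinity_ne_zero (q := q₀) rfl w).2 ⟨c, rfl⟩)) hlw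
  obtain ⟨u, v, hu, hv, hind⟩ := exists_basis_of_dual l w
  obtain ⟨x, y, Z, hz0, hFz, hGz⟩ := exists_tangency_eq_zero (by omega) hw hind
  have hq := hmem _ (alpha_ne_of_tangency hF hz0 hFz hGz)
  refine hl' _ hz0 (hmemB _ hz0 hFz (Set.mem_insert_of_mem _ hq) ?_) ?_
  · have h1 := (submodule_le_twistorLine_iff (Projectivization.mk ℂ _ hz0) _).2 rfl
    rwa [Projectivization.submodule_mk, Submodule.span_singleton_le_iff_mem] at h1
  · simp [hu, hv, hlw]

end antipode

end Twistor

/-! ### The main theorem. -/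

theorem corollary3p4 (d : ℕ) (hd : 4 ≤ d) :
    Twistor.ForGeneral d fun F =>
      -- the surface contains no twistor line
      (∀ q : Twistor.S4, ¬ Twistor.points (Twistor.twistorLine q) ⊆ Twistor.surface F) ∧
      -- only four configurations occur
      (∀ q : Twistor.S4,
        Twistor.alpha F (Twistor.twistorLine q) = Multiset.replicate d 1 ∨
        Twistor.alpha F (Twistor.twistorLine q) = {2} + Multiset.replicate (d - 2) 1 ∨
        Twistor.alpha F (Twistor.twistorLine q) = {2, 2} + Multiset.replicate (d - 4) 1 ∨
        Twistor.alpha F (Twistor.twistorLine q) = {3} + Multiset.replicate (d - 3) 1) ∧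
      -- `(1, …, 1)`: a nonempty Zariski open set
      (Twistor.IsZariskiOpen (Twistor.locus F (Multiset.replicate d 1)) ∧
        (Twistor.locus F (Multiset.replicate d 1)).Nonempty) ∧
      -- `(2, 1, …, 1)`: a nonempty locally closed real algebraic set of pure dimension `2`
      (Twistor.IsZariskiLocallyClosed (Twistor.locus F ({2} + Multiset.replicate (d - 2) 1)) ∧
        (Twistor.locus F ({2} + Multiset.replicate (d - 2) 1)).Nonempty ∧
        Twistor.IsSmoothSubmanifold 2
          (Subtype.val '' Twistor.locus F ({2} + Multiset.replicate (d - 2) 1))) ∧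
      -- `(2, 2, 1, …, 1)` and `(3, 1, …, 1)`: finitely many twistor lines
      (Twistor.locus F ({2, 2} + Multiset.replicate (d - 4) 1)).Finite ∧
      (Twistor.locus F ({3} + Multiset.replicate (d - 3) 1)).Finite := by
  refine (Twistor.forGeneral_isGeneral hd).mono fun F hF => ?_
  exact ⟨hF.not_subset, hF.alpha_cases hd,
    ⟨hF.isZariskiOpen_locus_one (by omega), hF.nonempty_locus_one⟩,
    ⟨hF.isZariskiLocallyClosed_locus_two hd, hF.nonempty_locus_two hd,
      hF.isSmoothSubmanifold_locus_two hd⟩,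
    hF.finite_locus_two_two, hF.finite_locus_three⟩
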